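/- **Setting.** Let $\mathfrak A=\mathfrak A^+\oplus\mathfrak A^-$ be a real unital superalgebra and let $\mathfrak A[\mathsf z,\mathsf z^{-1}]=\bigoplus_{n\in\mathbb Z}\mathsf z^n\mathfrak A$ be an algebra extension by an invertible element $\mathsf z$ with $\mathsf z^{\pm1}\mathfrak A^+\mathsf z^{\mp1}\subset\mathfrak A^+$ and $\mathsf z^{\pm1}\mathfrak A^-\mathsf z^{\pm1}\subset\mathfrak A^-$. Let $\mathfrak A[\mathsf z,\mathsf z^{-1}]$ carry a Hausdorff locally convex algebra topology (jointly continuous product) in which $\mathfrak A^+$ and $\mathfrak A^-$ are sequentially complete. Let $\mathfrak B^{0,0}$ be the algebra of series $\sum_{n\in\mathbb Z}\mathsf z^n(a_n^++a_n^-)$, $a_n^\pm\in\mathfrak A^\pm$, whose terms $\mathsf z^na_n^\pm$ are rapidly decreasing in $n$ for every continuous seminorm. Adjoin a formal symbol $\mathsf z^{1/2}$ with square $\mathsf z$, and put $\mathfrak B^{i,j}=\mathsf z^{i/2}\mathfrak B^{0,0}\mathsf z^{j/2}$ for $i,j\in\{0,1\}$, with product $\mathfrak B^{i,j}\cdot\mathfrak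 B^{j,k}\subset\mathfrak B^{i,k}$. Write $\mathbb Z_0=\mathbb Z$, $\mathbb Z_1=\mathbb Z+\frac12$. An element of $\mathfrak B^{i,j}$ is a series $a=\sum_{n}\mathsf z^n(a_n^++a_n^-)$, $n\in\mathbb Z+\frac{i+j}2$, where $a_n^\pm\in\mathfrak A^\pm$ if $j=0$, and $a_n^+\in\mathsf z^{1/2}\mathfrak A^+\mathsf z^{-1/2}$, $a_n^-\in\mathsf z^{1/2}\mathfrak A^-\mathsf z^{1/2}$ if $j=1$. **Matrices.** For $a\in\mathfrak B^{0,1}$ and $\{i,j\}=\{0,1\}$ let $\mathsf U^{\mathsf z}_{\mathbb Z_i,\mathbb Z_j}(a)=\sum_{n\in\mathbb Z_i,k\in\mathbb Z_j}(\mathsf z^{-k}a^+_{n-k}\mathsf z^k+\mathsf z^ka^-_{n+k}\mathsf z^k)\,\mathbf e_{n,k}$. For $u\in\mathfrak B^{0,1}$ let $\mathsf L^{\mathsf z^{1/2}}_{\mathbb Z}[u]=\mathsf z^{1/2}\mathbf 1_{\mathbb Z^-}+u\,\mathbf e_{0,0}+\mathsf z^{-1/2}\mathbf 1_{\mathbb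 Z^+}$ and $\mathsf L^{\mathsf z^{1/2}}_{\mathbb Z_1}=\mathsf z^{1/2}\mathbf 1_{\mathbb Z_1^-}+\mathsf z^{-1/2}\mathbf 1_{\mathbb Z_1^+}$. Let $\mathsf R_{\mathbb Z_i}=\sum_{n\in\mathbb Z_i}\mathsf z^{-n}\mathbf e_{n,n}$. For $\cos\theta\ne0$ let $\mathsf D_{\mathbb Z_i}(\theta)=\mathsf F_{\mathbb Z_i}(\theta)\,(c_{n-k}(\theta))_{n,k\in\mathbb Z_i}$, where $c_m(\theta)$ are the Fourier coefficients of $x\mapsto(1-2\cos x\sin\theta+\sin^2\theta)^{-1/2}$ and $\mathsf F_{\mathbb Z_i}(\theta)$ has row $r$ equal to $\mathbf e_r^\top-\sin\theta\,\mathbf e_{r-\operatorname{sgn}r}^\top$ if $|r|\ge1$, to $\cos\frac\theta2\,\mathbf e_r^\top-\sin\frac\theta2\,\mathbf e_{-r}^\top$ if $r=\pm\frac12$, and to $\cos\theta\,\mathbf e_0^\top$ if $r=0$. Put $\mathsf D^{\mathsf z}_{\mathbb Z_i}(\theta)=\mathsf R_{\mathbb Z_i}\mathsf D_{\mathbb Z_i}(\theta)\mathsf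 R_{\mathbb Z_i}^{-1}$. Let $\mathsf U^{\mathsf z}_{\mathbb Z,\mathbb Z_1}(a,\theta)$ be the (entrywise) continuous extension to all $\theta\in\mathbb R$ of $\mathsf D^{\mathsf z}_{\mathbb Z}(\theta)\,\mathsf U^{\mathsf z}_{\mathbb Z,\mathbb Z_1}(a)\,\mathsf D^{\mathsf z}_{\mathbb Z_1}(\theta)^{-1}$, $\cos\theta\neq0$. Let $\widehat{\mathsf U}^{\mathsf z}_{\mathbb Z,\mathbb Z_1}(a)$ be the $\mathbb Z\times\mathbb Z_1$ matrix with row $0$ equal to $\frac{\sqrt2}2(\mathbf e_{-1/2}^\top+\mathbf e_{1/2}^\top)$ and, for $n\ne0$, with $(n,k)$ entry $\gamma_k\operatorname{sgn}n\operatorname{sgn}k\,\bigl(\mathsf z^{-k'}a^+_{n'-k'}\mathsf z^{k'}-\mathsf z^{k'}a^-_{n'+k'}\mathsf z^{k'}\bigr)$, where $n'=n-\frac{\operatorname{sgn}n}2$, $k'=k-\frac{\operatorname{sgn}k}2$, $\gamma_{\pm1/2}=\frac{\sqrt2}2$ and $\gamma_k=1$ otherwise. Inverses of matrices with entries in $\mathfrak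 B^{c,c}$ are taken among the matrices $A$ over $\mathfrak B^{c,c}$ for which the entries of $\mathsf R^{-1}A\mathsf R$ are rapidly decreasing (in $\mathfrak B$, in $||n|-|m||$, uniformly in $n,m$). A matrix $A$ over $\mathfrak B^{0,1}$ is *rapidly decreasing* if the entries of $\mathsf R^{-1}A\mathsf R$ are rapidly decreasing in $\mathfrak B$ as $|n|+|m|\to\infty$. For $a\in\mathfrak B^{0,1}$ invertible (with inverse in $\mathfrak B^{1,0}$) put $$\mathsf N^{\mathsf z}_{\mathbb Z}(a,\theta)=\mathsf U^{\mathsf z}_{\mathbb Z,\mathbb Z_1}(a,\theta)\,\mathsf L^{\mathsf z^{1/2}}_{\mathbb Z_1}\,\widehat{\mathsf U}^{\mathsf z}_{\mathbb Z,\mathbb Z_1}(a)^{-1}.$$ **Theorem.** For every invertible $a\in\mathfrak B^{0,1}$, the inverses and the continuous extension above exist and are unique, $\mathsf U^{\mathsf z}_{\mathbb Z,\mathbb Z_1}(a,\frac\pi2)$ has a unique inverse, the sums in the product with $\widehat{\mathsf U}^{\mathsf z}_{\mathbb Z,\mathbb Z_1}(a)^{-1}$ that defines $\mathsf N^{\mathsf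 z}_{\mathbb Z}(a,\theta)$ converge, and $\mathsf N^{\mathsf z}_{\mathbb Z}(a,\theta)=\mathsf U^{\mathsf z}_{\mathbb Z,\mathbb Z_1}(a,\theta)\,\mathsf U^{\mathsf z}_{\mathbb Z,\mathbb Z_1}(a,\frac\pi2)^{-1}\mathsf L^{\mathsf z^{1/2}}_{\mathbb Z}[a]$ for all $\theta\in\mathbb R$. Moreover: (i) for every $\theta$, $\mathsf N^{\mathsf z}_{\mathbb Z}(a,\theta)$ has entries in $\mathfrak B^{0,1}$, and $\mathsf N^{\mathsf z}_{\mathbb Z}(a,\theta)-\mathsf L^{\mathsf z^{1/2}}_{\mathbb Z}[0]$ is rapidly decreasing; (ii) $\mathsf N^{\mathsf z}_{\mathbb Z}(a,0)=\mathsf U^{\mathsf z}_{\mathbb Z,\mathbb Z_1}(a)\,\mathsf L^{\mathsf z^{1/2}}_{\mathbb Z_1}\,\widehat{\mathsf U}^{\mathsf z}_{\mathbb Z,\mathbb Z_1}(a)^{-1}$, and its entries lie in $\mathfrak A\mathsf z^{1/2}\oplus\mathfrak A\mathsf z^{-1/2}$; (iii) $\mathsf N^{\mathsf z}_{\mathbb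 Z}(a,\frac\pi2)=\mathsf L^{\mathsf z^{1/2}}_{\mathbb Z}[a]$; (iv) let $\mathsf d_{n}(\theta)$, $n=\pm\frac12$, be the identity $\mathbb Z\times\mathbb Z$ matrix with the block at $\{n-\frac12,n+\frac12\}$ replaced by $\begin{bmatrix}\cos\frac\theta2&\sin\frac\theta2\\-\sin\frac\theta2&\cos\frac\theta2\end{bmatrix}$; then for all $\theta$ $$\mathsf N^{\mathsf z}_{\mathbb Z}(\mathsf z^{1/2},\theta)=\mathsf L^{\mathsf z^{1/2}}_{\mathbb Z}[\mathsf z^{1/2}]\,\mathsf d_{\frac12}(\theta)\,\mathsf d_{\frac12}(\tfrac\pi2)^{-1},\qquad \mathsf N^{\mathsf z}_{\mathbb Z}(\mathsf z^{-1/2},\theta)=\mathsf L^{\mathsf z^{1/2}}_{\mathbb Z}[\mathsf z^{-1/2}]\,\mathsf d_{-\frac12}(-\theta)\,\mathsf d_{-\frac12}(-\tfrac\pi2)^{-1}.$$ -/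

import Mathlib

open Topology Filter

noncomputable section

namespace CyclicLoop

/-- The extension `C = 𝔄[z, z⁻¹]` of a real superalgebra `𝔄 = 𝔄⁺ ⊕ 𝔄⁻` by a cyclic variable `z`.
`part 0` is `𝔄⁺` and `part 1` is `𝔄⁻`, as subspaces of `C`; `C` is the direct sum of the
subspaces `zⁿ 𝔄⁺` and `zⁿ 𝔄⁻` with `n ∈ ℤ`. -/
structure CyclicExtension (C : Type*) [Ring C] [Algebra ℝ C] where
  part : ZMod 2 → Submodule ℝ C
  z : Cˣ
  one_mem : (1 : C) ∈ part 0
  mul_mem : ∀ ε δ : ZMod 2, ∀ a ∈ part ε, ∀ b ∈ part δ, a * b ∈ part (ε + δ)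
  conj_even : ∀ a ∈ part 0, (z : C) * a * ((z⁻¹ : Cˣ) : C) ∈ part 0
  conj_even_inv : ∀ a ∈ part 0, ((z⁻¹ : Cˣ) : C) * a * (z : C) ∈ part 0
  conj_odd : ∀ a ∈ part 1, (z : C) * a * (z : C) ∈ part 1
  conj_odd_inv : ∀ a ∈ part 1, ((z⁻¹ : Cˣ) : C) * a * ((z⁻¹ : Cˣ) : C) ∈ part 1
  internal : DirectSum.IsInternal fun d : ZMod 2 × ℤ =>
    (part d.1).map (LinearMap.mulLeft ℝ ((z ^ d.2 : Cˣ) : C))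

/-- The algebra in which the symbol `z^{1/2}` lives. The `(i, j)` corner is a copy of `C`, in which
`x` stands for the formal element `z^{-i/2} x z^{j/2}`, where `i, j ∈ {0, 1}`. -/
abbrev Half (C : Type*) := Matrix (ZMod 2) (ZMod 2) C

/-- Formal series `∑ f ε p`; the term `f ε p` has parity `ε` and degree `p / 2` in `z`, that is,
it has the shape `z^{p/2} · (coefficient of parity ε)`. -/
abbrev Series (C : Type*) := ZMod 2 → ℤ → Half C

/-- The index set `ℤ` (for `i = 0`) or `ℤ + 1/2` (for `i = 1`);
the integer `p` stands for the index `p / 2`. -/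
abbrev Idx (i : ZMod 2) := {p : ℤ // (p : ZMod 2) = i}

/-- Matrices indexed by half-integers whose entries are formal series. -/
abbrev Mat (C : Type*) (i j : ZMod 2) := Idx i → Idx j → Series C

section Algebra

variable {C : Type*} [Ring C]

/-- The unit `e_c` of the `(c, c)` corner. -/
def idem (c : ZMod 2) : Half C := Matrix.single c c 1

theorem one_eq : (1 : Half C) = Matrix.single 0 0 1 + Matrix.single 1 1 1 := by
  ext i j
  have h : ∀ i j : ZMod 2, (i = 0 ∨ i = 1) ∧ (j = 0 ∨ j = 1) := by decide
  rcases h i j with ⟨rfl | rfl, rfl | rfl⟩ <;> simp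

/-- The series with the single term `s`, of parity `ε` and degree `p / 2`. -/
def mono (ε : ZMod 2) (p : ℤ) (s : Half C) : Series C :=
  fun ε' p' => if ε' = ε ∧ p' = p then s else 0

/-- The unit of `𝔅^{c,c}`. -/
def oneS (c : ZMod 2) : Series C := mono 0 0 (idem c)

/-- The constant series with value `a + b`, where `a ∈ 𝔄⁺` and `b ∈ 𝔄⁻`. -/
def constS (a b : C) : Series C :=
  mono 0 0 (Matrix.single 0 0 a) + mono 1 0 (Matrix.single 0 0 b)

/-- The identity matrix over `𝔅^{c,c}`. -/
def oneM (c i : ZMod 2) : Mat C i i := fun n m => if n = m then oneS c else 0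

/-- The involution of `𝔅` that is `1` on even terms and `-1` on odd terms. -/
def parity (f : Series C) : Series C := fun ε p => if ε = 0 then f ε p else - f ε p

variable [TopologicalSpace C]

/-- The product of series. As odd coefficients satisfy `a z^k = z^{-k} (z^k a z^k)`, an odd term of
degree `q` times a term of degree `r` has degree `q - r`. -/
def mulS (f g : Series C) : Series C := fun ε p =>
  (∑' q : ℤ, f 0 q * g ε (p - q)) + ∑' q : ℤ, f 1 q * g (ε + 1) (q - p)

infixl:70 " ⋄ " => mulS

/-- All sums in the definition of `f ⋄ g` converge. -/
def SummableS (f g : Series C) : Prop := ∀ (ε : ZMod 2) (p : ℤ),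
  (Summable fun q : ℤ => f 0 q * g ε (p - q)) ∧ Summable fun q : ℤ => f 1 q * g (ε + 1) (q - p)

/-- The product of matrices. -/
def mulM {i j k : ZMod 2} (A : Mat C i j) (B : Mat C j k) : Mat C i k :=
  fun n m => ∑' l : Idx j, A n l ⋄ B l m

infixl:70 " ⬝ " => mulM

/-- All sums in the definition of `A ⬝ B` converge. -/
def SummableM {i j k : ZMod 2} (A : Mat C i j) (B : Mat C j k) : Prop :=
  (∀ n l m, SummableS (A n l) (B l m)) ∧ ∀ n m, Summable fun l : Idx j => A n l ⋄ B l m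

/-- The product of a matrix of series with a real matrix. -/
def mulReal [Algebra ℝ C] {i j : ZMod 2} (A : Mat C i j) (B : ℤ → ℤ → ℝ) : Mat C i j :=
  fun n m => ∑' l : Idx j, B l.1 m.1 • A n l

end Algebra

section RealMatrices

/-- `ω(x, θ) = 1 - 2 cos x sin θ + sin² θ`. -/
def omega (x θ : ℝ) : ℝ := 1 - 2 * Real.cos x * Real.sin θ + Real.sin θ ^ 2

/-- The coefficient of `z^m`, where `z = cos x + i sin x`, in the Fourier expansion of
`x ↦ ω(x, θ)^{-1/2}`, which is an even real function of `x`. -/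
def omegaCoeff (θ : ℝ) (m : ℤ) : ℝ :=
  (2 * Real.pi)⁻¹ * ∫ x in (0 : ℝ)..(2 * Real.pi), omega x θ ^ (-(1 / 2) : ℝ) * Real.cos (m * x)

/-- The matrices `F_ℤ(θ)` (on even `n`, `k`) and `F_{ℤ+1/2}(θ)` (on odd `n`, `k`):
row `0` is `cos θ e₀`, rows `±1/2` are `cos(θ/2) e_{±1/2} - sin(θ/2) e_{∓1/2}`, and row `r` is
`e_r - sin θ e_{r - sgn r}` for `|r| ≥ 1`; here `n = 2r`. -/
def Fmat (θ : ℝ) (n k : ℤ) : ℝ :=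
  if n = 0 then (if k = 0 then Real.cos θ else 0)
  else if n = 1 ∨ n = -1 then
    (if k = n then Real.cos (θ / 2) else if k = -n then - Real.sin (θ / 2) else 0)
  else (if k = n then 1 else if k = n - 2 * n.sign then - Real.sin θ else 0)

/-- The matrices `D(θ) = F(θ) U(ω(x, θ)^{-1/2})`, for `cos θ ≠ 0`. -/
def Dmat (i : ZMod 2) (θ : ℝ) (n k : Idx i) : ℝ :=
  ∑' j : Idx i, Fmat θ n.1 j.1 * omegaCoeff θ ((j.1 - k.1) / 2)

/-- The identity matrix with the block at the indices `c/2 - 1/2`, `c/2 + 1/2` replaced by `B`. -/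
def blockMat (c : ℤ) (B : Matrix (Fin 2) (Fin 2) ℝ) (n k : ℤ) : ℝ :=
  if n = c - 1 ∧ k = c - 1 then B 0 0
  else if n = c - 1 ∧ k = c + 1 then B 0 1
  else if n = c + 1 ∧ k = c - 1 then B 1 0
  else if n = c + 1 ∧ k = c + 1 then B 1 1
  else if n = k then 1 else 0

/-- The rotation block by the angle `θ / 2`. -/
def halfBlock (θ : ℝ) : Matrix (Fin 2) (Fin 2) ℝ :=
  !![Real.cos (θ / 2), Real.sin (θ / 2); - Real.sin (θ / 2), Real.cos (θ / 2)]

/-- The elementary half-rotation centred at `c / 2`. -/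
def halfRot (c : ℤ) (θ : ℝ) : ℤ → ℤ → ℝ := blockMat c (halfBlock θ)

/-- The inverse of the elementary half-rotation centred at `c / 2`. -/
def halfRotInv (c : ℤ) (θ : ℝ) : ℤ → ℤ → ℝ := blockMat c (halfBlock θ)⁻¹

end RealMatrices

namespace CyclicExtension

variable {C : Type*} [Ring C] [Algebra ℝ C] (E : CyclicExtension C)

/-- `𝔄⁺` and `𝔄⁻` are sequentially complete. -/
def SeqComplete [UniformSpace C] : Prop := ∀ (ε : ZMod 2) (u : ℕ → C),
  (∀ n, u n ∈ E.part ε) → CauchySeq u → ∃ x ∈ E.part ε, Tendsto u atTop (𝓝 x)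

/-- The symbol `z^{1/2}`: the matrix with rows `(0, 1)` and `(z, 0)`. Its square is `z`. -/
def zHalf : (Half C)ˣ where
  val := Matrix.single 0 1 1 + Matrix.single 1 0 (E.z : C)
  inv := Matrix.single 0 1 ((E.z⁻¹ : Cˣ) : C) + Matrix.single 1 0 1
  val_inv := by
    have h : (1 : Half C) = Matrix.single 0 0 1 + Matrix.single 1 1 1 := one_eq
    simp [add_mul, mul_add, h, add_comm]
  inv_val := by
    have h : (1 : Half C) = Matrix.single 0 0 1 + Matrix.single 1 1 1 := one_eq
    simp [add_mul, mul_add, h, add_comm]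

/-- `z^{p/2}`. -/
def zp (p : ℤ) : Half C := ((E.zHalf ^ p : (Half C)ˣ) : Half C)

/-- `z^{p/2}` as a series. -/
def zS (p : ℤ) : Series C := mono 0 p (E.zp p)

/-- `z^{p/2}` as an element of `𝔅^{i,j}`, where `i ≡ p + j` modulo `2`. -/
def zPow (j : ZMod 2) (p : ℤ) : Series C := mono 0 p (E.zp p * idem j)

/-- The coefficients of parity `ε` of the elements of `𝔅^{i,j}`: for `j = 0` the elements of
`𝔄^±`, for `j = 1` those of `z^{1/2} 𝔄⁺ z^{-1/2}` (`ε = 0`) or `z^{1/2} 𝔄⁻ z^{1/2}` (`ε = 1`). -/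
def coeff (j ε : ZMod 2) : Set (Half C) := {s | ∃ a ∈ E.part ε,
  s = if j = 0 then Matrix.single 0 0 a
    else if ε = 0 then E.zp 1 * Matrix.single 0 0 a * E.zp (-1)
    else E.zp 1 * Matrix.single 0 0 a * E.zp 1}

/-- The entries of the matrix of the left multiplication by `a = ∑ z^n a_n` in the basis `z^k`:
the `(n, k)` entry is `z^{-k} a⁺_{n-k} z^k + z^k a⁻_{n+k} z^k`. -/
def multEntry (a : Series C) (n k : ℤ) : Series C :=
  mono 0 0 (E.zp (-k) * (E.zp (-(n - k)) * a 0 (n - k)) * E.zp k)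
    + mono 1 0 (E.zp k * (E.zp (-(n + k)) * a 1 (n + k)) * E.zp k)

/-- `U_{i,j}(a)`. -/
def multMat (i j : ZMod 2) (a : Series C) : Mat C i j := fun n k => E.multEntry a n.1 k.1

/-- `z^{1/2} 1_{-} + u e_{0,0} + z^{-1/2} 1_{+}`, with entries in `𝔅^{0,1}`. For `i = 0` this is
`L_ℤ[u]`; for `i = 1` there is no index `0`, and it is `L_{ℤ+1/2}` whatever `u` is. -/
def Lmat (i : ZMod 2) (u : Series C) : Mat C i i := fun n m =>
  if n = m then (if n.1 < 0 then E.zPow 1 1 else if 0 < n.1 then E.zPow 1 (-1) else u) else 0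

/-- The matrix `Û_{ℤ,ℤ+1/2}(a)`. In block form it is `U_{ℤ+1/2,ℤ}(a) ⊕ 1`: the entry at `(0, ±1/2)`
is `√2/2`; for `n ≠ 0` the entry at `(n, k)` is
`sgn n sgn k (U⁺ - U⁻)` at `(n - sgn n / 2, k - sgn k / 2)`, times `√2/2` if `k = ±1/2`. -/
def hatMat (a : Series C) : Mat C 0 1 := fun n k =>
  if n.1 = 0 then (if k.1 = 1 ∨ k.1 = -1 then (√2 / 2) • oneS 1 else 0)
  else (((n.1.sign * k.1.sign : ℤ) : ℝ) * (if k.1 = 1 ∨ k.1 = -1 then √2 / 2 else 1)) •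
    parity (E.multEntry a (n.1 - n.1.sign) (k.1 - k.1.sign))

/-- `D^z(θ) = R D(θ) R⁻¹` with the symbolic rotation `R = ∑ z^{-n} e_{n,n}`:
the `(n, k)` entry is `z^{-n} D(θ)_{n,k} z^k`, an element of `𝔅^{0,0}`. -/
def Dz (i : ZMod 2) (θ : ℝ) : Mat C i i := fun n k => Dmat i θ n k • E.zPow 0 (k.1 - n.1)

variable [TopologicalSpace C]

/-- The elements of `𝔅^{i,j} = z^{i/2} 𝔅^{0,0} z^{j/2}`: rapidly decreasing series `∑ z^n a_n` with
`n ∈ ℤ + (i+j)/2` and with coefficients as in `coeff`. -/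
structure IsLoop (i j : ZMod 2) (f : Series C) : Prop where
  coeff_mem : ∀ (ε : ZMod 2) (p : ℤ), (p : ZMod 2) = i + j → ∃ c ∈ E.coeff j ε, f ε p = E.zp p * c
  eq_zero : ∀ (ε : ZMod 2) (p : ℤ), (p : ZMod 2) ≠ i + j → f ε p = 0
  rapid : ∀ q : Seminorm ℝ (Half C), Continuous q → ∀ s : ℕ, ∃ K : ℝ, ∀ (ε : ZMod 2) (p : ℤ),
    (1 + |(p : ℝ)|) ^ s * q (f ε p) ≤ K

/-- `a ∈ 𝔅^{0,1}` has an inverse in `𝔅^{1,0}`. -/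
def IsInvertible (a : Series C) : Prop :=
  ∃ b : Series C, E.IsLoop 1 0 b ∧ a ⋄ b = oneS 0 ∧ b ⋄ a = oneS 1

/-- The matrix `R⁻¹ A R`, with entries `z^n A_{n,m} z^{-m}`. -/
def rot {i j : ZMod 2} (A : Mat C i j) : Mat C i j := fun n m => E.zS n.1 ⋄ A n m ⋄ E.zS (-m.1)

/-- `A` is rapidly decreasing after symbolic rotation. -/
def IsRapid {i j : ZMod 2} (A : Mat C i j) : Prop :=
  ∀ q : Seminorm ℝ (Half C), Continuous q → ∀ s : ℕ, ∃ K : ℝ,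
    ∀ (n : Idx i) (m : Idx j) (ε : ZMod 2) (p : ℤ),
      (1 + |(n.1 : ℝ)| + |(m.1 : ℝ)| + |(p : ℝ)|) ^ s * q (E.rot A n m ε p) ≤ K

/-- After symbolic rotation, `A` is rapidly decreasing away from the two diagonals, uniformly.
These matrices include the rotationally Toeplitz ones coming from smooth loops, and their rapidly
decreasing perturbations. -/
def IsTame {i j : ZMod 2} (A : Mat C i j) : Prop :=
  ∀ q : Seminorm ℝ (Half C), Continuous q → ∀ s : ℕ, ∃ K : ℝ,
    ∀ (n : Idx i) (m : Idx j) (ε : ZMod 2) (p : ℤ),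
      (1 + |(|(n.1 : ℝ)| - |(m.1 : ℝ)|)| + |(p : ℝ)|) ^ s * q (E.rot A n m ε p) ≤ K

/-- `W` is an inverse of `A` among the tame matrices over `𝔅^{c,c}`. -/
structure IsInverse (c : ZMod 2) {i j : ZMod 2} (A : Mat C i j) (W : Mat C j i) : Prop where
  loop : ∀ n m, E.IsLoop c c (W n m)
  tame : E.IsTame W
  mul_inv : A ⬝ W = oneM c i
  inv_mul : W ⬝ A = oneM c j

open Classical in
/-- The inverse of `A` among the tame matrices over `𝔅^{c,c}` (`0` if there is none). -/
def inv (c : ZMod 2) {i j : ZMod 2} (A : Mat C i j) : Mat C j i :=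
  if h : ∃ W, E.IsInverse c A W then h.choose else 0

/-- `D^z_ℤ(θ) U(a) D^z_{ℤ+1/2}(θ)⁻¹`, for `cos θ ≠ 0`. -/
def deform₀ (a : Series C) (θ : ℝ) : Mat C 0 1 :=
  E.Dz 0 θ ⬝ E.multMat 0 1 a ⬝ E.inv 0 (E.Dz 1 θ)

/-- `U_{ℤ,ℤ+1/2}(a, θ)`: the continuous extension of `deform₀` to all `θ`. -/
def deform (a : Series C) : ℝ → Mat C 0 1 := extendFrom {θ | Real.cos θ ≠ 0} (E.deform₀ a)

/-- `N_ℤ(a, θ) = U(a, θ) L Û(a)⁻¹`. -/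
def N (a : Series C) (θ : ℝ) : Mat C 0 0 :=
  E.deform a θ ⬝ E.Lmat 1 0 ⬝ E.inv 1 (E.hatMat a)

end CyclicExtension

end CyclicLoop

end

open CyclicLoop

set_option linter.unusedSectionVars false

/-! A term of a series is labelled by a parity ε and a degree p. Moving an odd coefficient across
`z` inverts `z`, so labels multiply as in the infinite dihedral group: (ε, p)(δ, q) = (ε + δ, p ±
q). Conjugation by `R` turns the product of matrices into a convolution over the inner index and
this group (`ro_mulM`). In this picture U(a) places the term of `a` with label (ε, p) at the entries
with n = ±k + p, and D^z(θ) is a real matrix sitting at the identity of the group. For tame matrices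
the convolution is summable in every continuous seminorm. Sequential completeness of 𝔄⁺ and 𝔄⁻ then
suffices for convergence, associativity and uniqueness of inverses, and matrices decreasing in |n| +
|m| stay so after multiplication by a tame matrix on the right (`mulM_assoc`, `rapid_mulM`).

Write D = F T, where T is the Toeplitz matrix of ω^{-1/2}. Since ω is even in x, T passes through
U(a), so X(θ) = D U(a) D⁻¹ is determined by X F_{ℤ+1/2} = F_ℤ U(a). The solution, term by term, is
`deformCoeff`: the factor 1/cos θ in the inverse of F cancels, and what is left is polynomial in the
sines and cosines of θ and θ/2. Hence X extends continuously to all θ (`deform_eq`). For a fixed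
degree the coefficients depend on θ only at finitely many entries, in a range bounded linearly by
the degree, so X(θ) - X(φ) is rapidly decreasing (`decays_deformMat_sub`).

At θ = π/2 the coefficients collapse to the factorization X(π/2) L = L[a] Û(a)
(`deformMat_mul_Lmat`), and Û(a) has an explicit inverse built from U(a⁻¹). This gives N(π/2) =
L[a], the inverse of X(π/2), the second formula for N(θ), and N(θ) - L[0] = (X(θ) - X(π/2)) L Û(a)⁻¹
+ a e_{0,0}, which is rapidly decreasing. At θ = 0, X(0) = U(a); the entries of U(a) and Û(a)⁻¹ have
degree zero, so only L contributes powers z^{±1/2}. For a = z^{±1/2} there is a single term, and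
changing θ rotates two rows of X. -/

namespace CyclicLoop

/-! ### Continuous seminorms and summation in sequentially complete subspaces. -/

section Seminorms

variable {H : Type*} [AddCommGroup H] [Module ℝ H]

/-- A linear subspace in which every Cauchy sequence has a limit. -/
def SeqCompleteSubspace [UniformSpace H] (V : Submodule ℝ H) : Prop :=
  ∀ u : ℕ → H, (∀ n, u n ∈ V) → CauchySeq u → ∃ x ∈ V, Tendsto u atTop (𝓝 x)

/-- The gauge seminorms define the topology, so a ball of some radius `r` for a finite supremum of
them fits into `U`. Scaling by `r⁻¹` normalizes the radius to `1`. -/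
theorem exists_seminorm_ball_subset [TopologicalSpace H] [IsTopologicalAddGroup H]
    [ContinuousSMul ℝ H] [LocallyConvexSpace ℝ H] {U : Set H} (hU : U ∈ 𝓝 (0 : H)) :
    ∃ q : Seminorm ℝ H, Continuous q ∧ ∀ x, q x < 1 → x ∈ U := by
  have hw : WithSeminorms (gaugeSeminormFamily ℝ H) := with_gaugeSeminormFamily
  obtain ⟨s, r, hr, hs⟩ := (hw.mem_nhds_iff 0 U).1 hU
  have hc : Continuous ⇑(Finset.sup s (gaugeSeminormFamily ℝ H)) := by
    refine Seminorm.continuous' (r := 1) (𝕜 := ℝ) ?_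
    refine (hw.mem_nhds_iff 0 _).2 ⟨s, 1, one_pos, fun x hx => ?_⟩
    rw [Seminorm.mem_closedBall]
    exact ((Seminorm.mem_ball _).1 hx).le
  obtain ⟨c, hcr⟩ : ∃ c : NNReal, (c : ℝ) = r⁻¹ := ⟨⟨r⁻¹, by positivity⟩, rfl⟩
  refine ⟨c • s.sup (gaugeSeminormFamily ℝ H), ?_, fun x hx => hs ?_⟩
  · exact hc.const_smul _
  · rw [Seminorm.mem_ball, sub_zero]
    have hx' : c * (s.sup (gaugeSeminormFamily ℝ H)) x < 1 := hx
    rw [hcr] at hx'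
    rwa [inv_mul_lt_one₀ hr] at hx'

/-- Small seminorms of tails make the net of finite partial sums Cauchy. Since `ι` is countable,
some sequence of finite sets tends to `atTop`. Sequential completeness gives a limit along that
sequence, and a Cauchy net converges to the limit of such a subsequence. -/
theorem hasSum_of_summable_seminorms [UniformSpace H] [IsUniformAddGroup H]
    [ContinuousSMul ℝ H] [LocallyConvexSpace ℝ H] {ι : Type*} [Countable ι]
    {V : Submodule ℝ H} (hV : SeqCompleteSubspace V) {u : ι → H} (hu : ∀ i, u i ∈ V)
    (hq : ∀ q : Seminorm ℝ H, Continuous q → Summable fun i => q (u i)) :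
    ∃ x ∈ V, HasSum u x := by
  have hC : CauchySeq fun s : Finset ι => ∑ i ∈ s, u i := by
    rw [cauchySeq_finset_iff_sum_vanishing]
    intro e he
    obtain ⟨q, hqc, hqe⟩ := exists_seminorm_ball_subset he
    obtain ⟨s, hs⟩ := summable_iff_vanishing_norm.1 (hq q hqc) 1 one_pos
    refine ⟨s, fun t ht => hqe _ ?_⟩
    refine lt_of_le_of_lt ?_ (lt_of_le_of_lt (le_abs_self _) (hs t ht))
    exact Finset.le_sum_of_subadditive q (map_zero q).le (map_add_le_add q) _ _
  obtain ⟨S, hS⟩ := exists_seq_tendsto (atTop : Filter (Finset ι))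
  obtain ⟨x, hxV, hx⟩ := hV (fun n => ∑ i ∈ S n, u i)
    (fun n => V.sum_mem fun i _ => hu i) (hC.comp_tendsto hS)
  exact ⟨x, hxV, tendsto_nhds_of_cauchySeq_of_subseq hC hS hx⟩

theorem seminorm_tsum_le [TopologicalSpace H] [T2Space H] {ι : Type*} {u : ι → H}
    (hu : Summable u) (q : Seminorm ℝ H) (hqc : Continuous q) {φ : ι → ℝ} (hφ : Summable φ)
    (h : ∀ i, q (u i) ≤ φ i) : q (∑' i, u i) ≤ ∑' i, φ i := by
  have h1 : Tendsto (fun s : Finset ι => q (∑ i ∈ s, u i)) atTop (𝓝 (q (∑' i, u i))) :=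
    (hqc.tendsto _).comp hu.hasSum
  refine le_of_tendsto' h1 fun s => ?_
  refine (Finset.le_sum_of_subadditive q (map_zero q).le (map_add_le_add q) _ _).trans ?_
  refine (Finset.sum_le_sum fun i _ => h i).trans ?_
  exact hφ.sum_le_tsum s fun i _ => (apply_nonneg q (u i)).trans (h i)

/-- Joint continuity at the origin bounds `q (x * y)` on the product of two unit balls of one
seminorm; homogeneity extends the bound to all `x` and `y`. -/
theorem exists_seminorm_mul_le {H : Type*} [Ring H] [Algebra ℝ H] [TopologicalSpace H]
    [IsTopologicalRing H] [ContinuousSMul ℝ H] [LocallyConvexSpace ℝ H]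
    (q : Seminorm ℝ H) (hqc : Continuous q) :
    ∃ r : Seminorm ℝ H, Continuous r ∧ ∀ x y, q (x * y) ≤ r x * r y := by
  have hU : {p : H × H | q (p.1 * p.2) < 1} ∈ 𝓝 ((0 : H), (0 : H)) := by
    refine IsOpen.mem_nhds ?_ (by simp)
    exact isOpen_lt (hqc.comp (continuous_fst.mul continuous_snd)) continuous_const
  rw [nhds_prod_eq, mem_prod_iff] at hU
  obtain ⟨U₁, hU₁, U₂, hU₂, hU⟩ := hU
  obtain ⟨r, hrc, hr⟩ := exists_seminorm_ball_subset (inter_mem hU₁ hU₂)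
  refine ⟨r, hrc, fun x y => ?_⟩
  have key : ∀ a b : ℝ, r x < a → r y < b → q (x * y) ≤ a * b := by
    intro a b ha hb
    have ha0 : 0 < a := (apply_nonneg r x).trans_lt ha
    have hb0 : 0 < b := (apply_nonneg r y).trans_lt hb
    have h1 : r (a⁻¹ • x) < 1 := by
      rw [map_smul_eq_mul, norm_inv, Real.norm_of_nonneg ha0.le, inv_mul_lt_one₀ ha0]; exact ha
    have h2 : r (b⁻¹ • y) < 1 := by
      rw [map_smul_eq_mul, norm_inv, Real.norm_of_nonneg hb0.le, inv_mul_lt_one₀ hb0]; exact hb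
    have h3 : q ((a⁻¹ • x) * (b⁻¹ • y)) < 1 := hU (Set.mk_mem_prod (hr _ h1).1 (hr _ h2).2)
    rw [smul_mul_smul_comm, map_smul_eq_mul, ← mul_inv, norm_inv,
      Real.norm_of_nonneg (by positivity), inv_mul_lt_one₀ (by positivity)] at h3
    exact h3.le
  -- `r x` or `r y` may vanish, so the elements are scaled by slightly larger numbers, which are
  -- then decreased to `r x` and `r y`.
  have hlim : Tendsto (fun t : ℝ => (r x + t) * (r y + t)) (𝓝[>] 0) (𝓝 (r x * r y)) := by
    have : Tendsto (fun t : ℝ => (r x + t) * (r y + t)) (𝓝 0) (𝓝 ((r x + 0) * (r y + 0))) :=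
      (Continuous.tendsto (by fun_prop) 0)
    simp only [add_zero] at this
    exact this.mono_left nhdsWithin_le_nhds
  refine ge_of_tendsto hlim ?_
  filter_upwards [self_mem_nhdsWithin] with t ht
  have ht' : (0 : ℝ) < t := ht
  exact key _ _ (by linarith) (by linarith)

theorem exists_seminorm_mul_mul_le {H : Type*} [Ring H] [Algebra ℝ H] [TopologicalSpace H]
    [IsTopologicalRing H] [ContinuousSMul ℝ H] [LocallyConvexSpace ℝ H]
    (q : Seminorm ℝ H) (hqc : Continuous q) :
    ∃ r : Seminorm ℝ H, Continuous r ∧ ∀ x y z, q (x * y * z) ≤ r x * r y * r z := by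
  obtain ⟨r, hrc, hr⟩ := exists_seminorm_mul_le q hqc
  obtain ⟨r', hrc', hr'⟩ := exists_seminorm_mul_le r hrc
  refine ⟨r' ⊔ r, ?_, fun x y z => (hr _ _).trans ?_⟩
  · exact hrc'.sup hrc
  · refine mul_le_mul ((hr' x y).trans ?_) le_sup_right (apply_nonneg _ _) ?_
    · exact mul_le_mul le_sup_left le_sup_left (apply_nonneg _ _)
        ((apply_nonneg _ _).trans le_sup_left)
    · exact mul_nonneg (apply_nonneg _ _) (apply_nonneg _ _)

/-- Left and right multiplication by fixed elements distort a continuous seminorm boundedly. -/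
theorem exists_seminorm_conj_le {H : Type*} [Ring H] [Algebra ℝ H] [TopologicalSpace H]
    [IsTopologicalRing H] (q : Seminorm ℝ H) (hqc : Continuous q) (a b : H) :
    ∃ r : Seminorm ℝ H, Continuous r ∧ ∀ x, q (a * x * b) = r x :=
  ⟨q.comp ((LinearMap.mulRight ℝ b).comp (LinearMap.mulLeft ℝ a)),
    hqc.comp ((continuous_const.mul continuous_id).mul continuous_const), fun _ => rfl⟩

end Seminorms

/-! ### Summable weights on the integers. -/

section Weights

theorem summable_one_add_abs_inv_sq : Summable fun n : ℤ => ((1 + |(n : ℝ)|) ^ 2)⁻¹ := by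
  have h : Summable fun n : ℤ => 4 * (1 / (n : ℝ) ^ 2) + if n = 0 then 1 else 0 := by
    refine Summable.add ?_ ?_
    · exact (Real.summable_one_div_int_pow.2 (by norm_num)).mul_left 4
    · exact (hasSum_ite_eq (0 : ℤ) (1 : ℝ)).summable
  refine Summable.of_nonneg_of_le (fun n => by positivity) (fun n => ?_) h
  split_ifs with hn
  · simp [hn]
  · have h1 : (1 : ℝ) ≤ |(n : ℝ)| := by exact_mod_cast Int.one_le_abs hn
    rw [add_zero, ← sq_abs (n : ℝ), one_div, ← div_eq_mul_inv, inv_eq_one_div,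
      div_le_div_iff₀ (by positivity) (by positivity)]
    nlinarith

/-- `∑ (1 + |n|)⁻²` over the integers. -/
noncomputable def weightSum : ℝ := ∑' n : ℤ, ((1 + |(n : ℝ)|) ^ 2)⁻¹

/-- On each half-line the weight is a translate of (1 + |l|)⁻², so two translates dominate it. The
bound does not depend on `N`; this gives the uniform estimates for products of tame matrices. -/
theorem summable_abs_sub_abs (N : ℤ) :
    Summable (fun l : ℤ => ((1 + |(|(N : ℝ)| - |(l : ℝ)|)|) ^ 2)⁻¹) ∧
      ∑' l : ℤ, ((1 + |(|(N : ℝ)| - |(l : ℝ)|)|) ^ 2)⁻¹ ≤ 2 * weightSum := by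
  obtain ⟨w, hw⟩ : ∃ w : ℤ → ℝ, w = fun n : ℤ => ((1 + |(n : ℝ)|) ^ 2)⁻¹ := ⟨_, rfl⟩
  have h0 : HasSum w weightSum := hw ▸ summable_one_add_abs_inv_sq.hasSum
  have hw0 : ∀ n, 0 ≤ w n := fun n => by rw [hw]; positivity
  have h3 : HasSum (fun l => w (l - |N|) + w (l + |N|)) (weightSum + weightSum) :=
    ((Equiv.subRight |N|).hasSum_iff.2 h0).add ((Equiv.addRight |N|).hasSum_iff.2 h0)
  have hle : ∀ l : ℤ, ((1 + |(|(N : ℝ)| - |(l : ℝ)|)|) ^ 2)⁻¹ ≤ w (l - |N|) + w (l + |N|) := by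
    intro l
    rcases le_total 0 (l : ℝ) with h | h
    · refine le_trans (le_of_eq ?_) (le_add_of_nonneg_right (hw0 _))
      rw [hw, abs_of_nonneg h, abs_sub_comm]
      push_cast
      rfl
    · refine le_trans (le_of_eq ?_) (le_add_of_nonneg_left (hw0 _))
      rw [hw, abs_of_nonpos h, sub_neg_eq_add, add_comm (|(N : ℝ)|)]
      push_cast
      rfl
  have hs := Summable.of_nonneg_of_le (fun l => by positivity) hle h3.summable
  refine ⟨hs, (hs.tsum_le_tsum hle h3.summable).trans ?_⟩
  rw [h3.tsum_eq, two_mul]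

end Weights

end CyclicLoop

/-! ### The dihedral group of parities and degrees. -/

namespace CyclicLoop

/-- The sign by which an element of parity `ε` acts on degrees. -/
def sg (ε : ZMod 2) : ℤ := if ε = 0 then 1 else -1

@[simp] theorem sg_zero : sg 0 = 1 := rfl
@[simp] theorem sg_one : sg 1 = -1 := rfl

theorem zmod_two_cases (ε : ZMod 2) : ε = 0 ∨ ε = 1 := by revert ε; decide

theorem sg_add (ε δ : ZMod 2) : sg (ε + δ) = sg ε * sg δ := by revert ε δ; decide
theorem sg_mul_self (ε : ZMod 2) : sg ε * sg ε = 1 := by revert ε; decide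
theorem add_self_two (ε : ZMod 2) : ε + ε = 0 := by revert ε; decide
theorem cast_sg (ε : ZMod 2) : ((sg ε : ℤ) : ZMod 2) = 1 := by revert ε; decide
theorem neg_two (ε : ZMod 2) : -ε = ε := by revert ε; decide

theorem zmod_two_cast_eq_iff (m n : ℤ) : ((m : ZMod 2) = n) ↔ ∃ u : ℤ, n = m + 2 * u := by
  rw [ZMod.intCast_eq_intCast_iff_dvd_sub]
  constructor
  · rintro ⟨u, hu⟩
    exact ⟨u, by push_cast at hu; omega⟩
  · rintro ⟨u, hu⟩
    exact ⟨u, by push_cast; omega⟩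

/-- The infinite dihedral group: parities and degrees of the terms of series. -/
@[ext] structure Dih where
  ε : ZMod 2
  p : ℤ
  deriving DecidableEq

namespace Dih

instance : Mul Dih := ⟨fun x y => ⟨x.ε + y.ε, x.p + sg x.ε * y.p⟩⟩
instance : One Dih := ⟨⟨0, 0⟩⟩
instance : Inv Dih := ⟨fun x => ⟨x.ε, -(sg x.ε * x.p)⟩⟩

@[simp] theorem mul_ε (x y : Dih) : (x * y).ε = x.ε + y.ε := rfl
@[simp] theorem mul_p (x y : Dih) : (x * y).p = x.p + sg x.ε * y.p := rfl
@[simp] theorem one_ε : (1 : Dih).ε = 0 := rfl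
@[simp] theorem one_p : (1 : Dih).p = 0 := rfl
@[simp] theorem inv_ε (x : Dih) : (x⁻¹).ε = x.ε := rfl
@[simp] theorem inv_p (x : Dih) : (x⁻¹).p = -(sg x.ε * x.p) := rfl

instance : Group Dih := Group.ofLeftAxioms
  (fun x y z => by
    ext
    · simp [add_assoc]
    · simp only [mul_p, mul_ε, sg_add]; ring)
  (fun x => by ext <;> simp)
  (fun x => by
    ext
    · simp [add_self_two]
    · simp)

/-- The underlying pair. -/
def equivProd : Dih ≃ ZMod 2 × ℤ := ⟨fun x => (x.ε, x.p), fun x => ⟨x.1, x.2⟩, fun _ => rfl, fun _ => rfl⟩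

instance : Countable Dih := equivProd.injective.countable

theorem inv_mul_p (y x : Dih) : (y⁻¹ * x).p = sg y.ε * (x.p - y.p) := by
  simp only [mul_p, inv_p, inv_ε]; ring

theorem inv_mul_ε (y x : Dih) : (y⁻¹ * x).ε = y.ε + x.ε := rfl

end Dih

section Half

variable {C : Type*} [Ring C]

theorem idem_mul_single (i j : ZMod 2) (x : C) :
    idem i * Matrix.single i j x = Matrix.single i j x := by simp [idem]

theorem single_mul_idem (i j : ZMod 2) (x : C) :
    Matrix.single i j x * idem j = Matrix.single i j x := by simp [idem]

theorem idem_mul_idem (i : ZMod 2) : (idem i : Half C) * idem i = idem i := by simp [idem]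

end Half

/-! ### Powers of `z^{1/2}` and the spaces of homogeneous terms. -/

namespace CyclicExtension

variable {C : Type*} [Ring C] [Algebra ℝ C] (E : CyclicExtension C)

/-- The four conjugation axioms, iterated: an even element is conjugated by `z ^ u`, an odd one
receives the same power on both sides. -/
theorem part_conj {ε : ZMod 2} {a : C} (ha : a ∈ E.part ε) (u : ℤ) :
    ((E.z ^ u : Cˣ) : C) * a * ((E.z ^ (-(sg ε * u)) : Cˣ) : C) ∈ E.part ε := by
  have h1 : ∀ a ∈ E.part ε, (E.z : C) * a * ((E.z ^ (-sg ε) : Cˣ) : C) ∈ E.part ε := by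
    rcases zmod_two_cases ε with rfl | rfl
    · simpa using E.conj_even
    · simpa using E.conj_odd
  have h2 : ∀ a ∈ E.part ε, ((E.z⁻¹ : Cˣ) : C) * a * ((E.z ^ (sg ε) : Cˣ) : C) ∈ E.part ε := by
    rcases zmod_two_cases ε with rfl | rfl
    · simpa using E.conj_even_inv
    · simpa using E.conj_odd_inv
  induction u using Int.induction_on with
  | zero => simpa using ha
  | succ n ih =>
    have := h1 _ ih
    rw [show (n : ℤ) + 1 = 1 + n by ring, zpow_add, zpow_one, mul_add, neg_add, mul_one, add_comm,
      zpow_add]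
    simpa [mul_assoc] using this
  | pred n ih =>
    have := h2 _ ih
    rw [show -(n : ℤ) - 1 = -1 + -n by ring, zpow_add, zpow_neg_one, mul_add, neg_add,
      mul_neg_one, neg_neg, add_comm, zpow_add]
    simpa [mul_assoc] using this

theorem zp_add (p q : ℤ) : E.zp (p + q) = E.zp p * E.zp q := by
  simp [zp, zpow_add]

@[simp] theorem zp_zero : E.zp 0 = 1 := by simp [zp]

@[simp] theorem zp_mul_zp_neg (p : ℤ) : E.zp p * E.zp (-p) = 1 := by
  rw [← zp_add]; simp

@[simp] theorem zp_neg_mul_zp (p : ℤ) : E.zp (-p) * E.zp p = 1 := by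
  rw [← zp_add]; simp

@[simp] theorem zp_mul_zp_neg_mul (p : ℤ) (x : Half C) : E.zp p * (E.zp (-p) * x) = x := by
  rw [← mul_assoc]; simp

@[simp] theorem zp_neg_mul_zp_mul (p : ℤ) (x : Half C) : E.zp (-p) * (E.zp p * x) = x := by
  rw [← mul_assoc]; simp

/-- Integral powers of `z` act on both corners alike. They can therefore be absorbed into the
coefficients, and only the parity of a half-power matters. -/
theorem zp_two_mul (u : ℤ) : E.zp (2 * u) = Matrix.scalar (ZMod 2) ((E.z ^ u : Cˣ) : C) := by
  have h : E.zHalf ^ (2 : ℤ) = Units.map (Matrix.scalar (ZMod 2)).toMonoidHom E.z := by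
    ext1
    have h0 : ((1 : ZMod 2) = 0) = False := by decide
    rw [zpow_ofNat, pow_two]
    ext i j
    rcases zmod_two_cases i with rfl | rfl <;> rcases zmod_two_cases j with rfl | rfl <;>
      simp [zHalf, mul_add, add_mul, Matrix.scalar_apply]
  rw [zp, zpow_mul, h, ← map_zpow]
  rfl

theorem zp_two_mul_mul_single (u : ℤ) (i j : ZMod 2) (x : C) :
    E.zp (2 * u) * Matrix.single i j x = Matrix.single i j (((E.z ^ u : Cˣ) : C) * x) := by
  rw [zp_two_mul, Matrix.scalar_apply]
  ext k l
  simp [Matrix.single_apply]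

theorem single_mul_zp_two_mul (u : ℤ) (i j : ZMod 2) (x : C) :
    Matrix.single i j x * E.zp (2 * u) = Matrix.single i j (x * ((E.z ^ u : Cˣ) : C)) := by
  rw [zp_two_mul, Matrix.scalar_apply]
  ext k l
  simp [Matrix.single_apply]

/-- Each factor `z^{±1/2}` exchanges the two corners. -/
theorem zp_mul_idem (p : ℤ) (j : ZMod 2) : E.zp p * idem j = idem (j + p) * E.zp p := by
  have h1 : ∀ j : ZMod 2, E.zp 1 * idem j = idem (j + 1) * E.zp 1 := by
    intro j
    rcases zmod_two_cases j with rfl | rfl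
    · simp [zp, zHalf, idem, add_mul, mul_add]
    · simp [zp, zHalf, idem, add_mul, mul_add, show (1 + 1 : ZMod 2) = 0 from rfl]
  have h2 : ∀ j : ZMod 2, E.zp (-1) * idem j = idem (j + 1) * E.zp (-1) := by
    intro j
    have := h1 (j + 1)
    rw [add_assoc, add_self_two, add_zero] at this
    calc E.zp (-1) * idem j = E.zp (-1) * (idem j * E.zp 1) * E.zp (-1) := by simp [mul_assoc]
      _ = _ := by rw [← this]; simp
  induction p using Int.induction_on generalizing j with
  | zero => simp
  | succ n ih =>
    rw [zp_add, mul_assoc, h1, ← mul_assoc, ih, mul_assoc]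
    push_cast
    rw [add_assoc, add_comm (1 : ZMod 2)]
  | pred n ih =>
    rw [sub_eq_add_neg, zp_add, mul_assoc, h2, ← mul_assoc, ih, mul_assoc]
    push_cast
    rw [add_assoc, add_comm (1 : ZMod 2), neg_two 1]

/-- The linear map `a ↦ z^{(p+t)/2} a z^{∓t/2}` into the coefficients of parity `ε`. -/
def coefMap (t : ℤ) (x : Dih) : C →ₗ[ℝ] Half C where
  toFun a := E.zp (x.p + t) * Matrix.single 0 0 a * E.zp (-(sg x.ε * t))
  map_add' a b := by rw [Matrix.single_add, mul_add, add_mul]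
  map_smul' r a := by rw [← Matrix.smul_single, RingHom.id_apply, mul_smul_comm, smul_mul_assoc]

theorem coefMap_apply (t : ℤ) (x : Dih) (a : C) :
    E.coefMap t x a = E.zp (x.p + t) * Matrix.single 0 0 a * E.zp (-(sg x.ε * t)) := rfl

/-- Two more half-powers amount to a whole power of `z` on each side, which `part_conj` absorbs into
`a`. So the image depends on `t` only modulo 2, and a convenient `t` may be chosen in each
computation. -/
theorem map_coefMap_le (t u : ℤ) (x : Dih) :
    (E.part x.ε).map (E.coefMap (t + 2 * u) x) ≤ (E.part x.ε).map (E.coefMap t x) := by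
  rintro _ ⟨a, ha, rfl⟩
  refine ⟨_, E.part_conj ha u, ?_⟩
  have h : -(sg x.ε * (t + 2 * u)) = 2 * (-(sg x.ε * u)) + -(sg x.ε * t) := by ring
  rw [coefMap_apply, coefMap_apply, h, ← add_assoc, E.zp_add (x.p + t), E.zp_add (2 * _),
    ← single_mul_zp_two_mul, ← zp_two_mul_mul_single]
  simp only [mul_assoc]

theorem map_coefMap_congr {t t' : ℤ} (h : (t : ZMod 2) = t') (x : Dih) :
    (E.part x.ε).map (E.coefMap t x) = (E.part x.ε).map (E.coefMap t' x) := by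
  refine le_antisymm ?_ ?_
  · obtain ⟨u, rfl⟩ := (zmod_two_cast_eq_iff _ _).1 h.symm
    exact E.map_coefMap_le _ _ _
  · obtain ⟨u, rfl⟩ := (zmod_two_cast_eq_iff _ _).1 h
    exact E.map_coefMap_le _ _ _

/-- The terms of parity and degree `x` of the elements of `𝔅^{i,j}`. -/
def term (i j : ZMod 2) (x : Dih) : Submodule ℝ (Half C) :=
  if (x.p : ZMod 2) = i + j then (E.part x.ε).map (E.coefMap j.val x) else ⊥

theorem mem_term_iff {i j : ZMod 2} {x : Dih} {s : Half C} {t : ℤ} (ht : (t : ZMod 2) = j)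
    (hx : (x.p : ZMod 2) = i + j) :
    s ∈ E.term i j x ↔ ∃ a ∈ E.part x.ε,
      E.zp (x.p + t) * Matrix.single 0 0 a * E.zp (-(sg x.ε * t)) = s := by
  rw [term, if_pos hx, E.map_coefMap_congr (t' := t) (by simp [ht])]
  rfl

theorem eq_zero_of_mem_term {i j : ZMod 2} {x : Dih} {s : Half C} (hx : (x.p : ZMod 2) ≠ i + j)
    (hs : s ∈ E.term i j x) : s = 0 := by
  rw [term, if_neg hx] at hs
  exact (Submodule.mem_bot ℝ).1 hs

/-- With suitable representatives, the power of `z` at the right end of `s` cancels the one at the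
left end of `s'`, and the two coefficients become adjacent. -/
theorem term_mul {i j k : ZMod 2} {x y : Dih} {s s' : Half C} (hs : s ∈ E.term i j x)
    (hs' : s' ∈ E.term j k y) : s * s' ∈ E.term i k (x * y) := by
  by_cases hx : (x.p : ZMod 2) = i + j
  swap
  · rw [E.eq_zero_of_mem_term hx hs, zero_mul]; exact zero_mem _
  by_cases hy : (y.p : ZMod 2) = j + k
  swap
  · rw [E.eq_zero_of_mem_term hy hs', mul_zero]; exact zero_mem _
  obtain ⟨t, rfl⟩ := ZMod.intCast_surjective k
  rw [E.mem_term_iff (t := t) rfl hy] at hs'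
  obtain ⟨b, hb, rfl⟩ := hs'
  -- This exponent is the representative for the left factor that produces the cancellation.
  have hj : ((sg x.ε * (y.p + t) : ℤ) : ZMod 2) = j := by
    push_cast
    rw [cast_sg, one_mul, hy, add_assoc, add_self_two, add_zero]
  rw [E.mem_term_iff hj hx] at hs
  obtain ⟨a, ha, rfl⟩ := hs
  have h1 : ((sg x.ε * t : ℤ) : ZMod 2) = t := by push_cast; rw [cast_sg, one_mul]
  have h2 : ((x * y).p : ZMod 2) = i + t := by
    rw [Dih.mul_p]
    push_cast
    rw [cast_sg, one_mul, hx, hy, add_assoc, ← add_assoc j, add_self_two, zero_add]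
  rw [E.mem_term_iff h1 h2]
  refine ⟨a * b, E.mul_mem _ _ _ ha _ hb, ?_⟩
  rw [Dih.mul_p, Dih.mul_ε, sg_add, show -(sg x.ε * (sg x.ε * (y.p + t))) = -(y.p + t) by
    rw [← mul_assoc, sg_mul_self, one_mul], mul_assoc (_ * Matrix.single 0 0 a),
    ← mul_assoc (E.zp _) (_ * _), ← mul_assoc (E.zp (-(y.p + t))), zp_neg_mul_zp, one_mul,
    mul_assoc (E.zp _) (Matrix.single 0 0 a), ← mul_assoc (Matrix.single 0 0 a),
    Matrix.single_mul_single_same,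
    show x.p + sg x.ε * y.p + sg x.ε * t = x.p + sg x.ε * (y.p + t) by ring,
    show -(sg x.ε * sg y.ε * (sg x.ε * t)) = -(sg y.ε * t) by
      rw [show sg x.ε * sg y.ε * (sg x.ε * t) = (sg x.ε * sg x.ε) * (sg y.ε * t) by ring,
        sg_mul_self, one_mul]]
  simp only [mul_assoc]

/-- A power z^{-m/2} on the right of a term of parity ε counts as degree -sg ε · m, because odd
coefficients invert `z`. -/
theorem term_conj {i j i' j' : ZMod 2} {x y : Dih} {s : Half C} (hs : s ∈ E.term i j x) {n m : ℤ}
    (hi : i' = i + n) (hj : j' = j + m) (hε : y.ε = x.ε) (hp : y.p = x.p + n - sg x.ε * m) :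
    E.zp n * s * E.zp (-m) ∈ E.term i' j' y := by
  by_cases hx : (x.p : ZMod 2) = i + j
  swap
  · rw [E.eq_zero_of_mem_term hx hs]; simp
  obtain ⟨t, rfl⟩ := ZMod.intCast_surjective j
  rw [E.mem_term_iff (t := t) rfl hx] at hs
  obtain ⟨a, ha, rfl⟩ := hs
  have h1 : ((t + sg x.ε * m : ℤ) : ZMod 2) = j' := by
    push_cast; rw [cast_sg, one_mul, hj]
  have h2 : (y.p : ZMod 2) = i' + j' := by
    rw [hp, hi, hj]
    push_cast
    rw [cast_sg, one_mul, hx, sub_eq_add_neg, neg_two]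
    abel
  rw [E.mem_term_iff h1 h2]
  refine ⟨a, hε ▸ ha, ?_⟩
  rw [hp, hε, show x.p + n - sg x.ε * m + (t + sg x.ε * m) = n + (x.p + t) by ring, E.zp_add n,
    show -(sg x.ε * (t + sg x.ε * m)) = -(sg x.ε * t) + -m by
      rw [mul_add, ← mul_assoc, sg_mul_self]; ring, E.zp_add (-(sg x.ε * t))]
  simp only [mul_assoc]

theorem term_eq_single {i j : ZMod 2} {x : Dih} {s : Half C} (hs : s ∈ E.term i j x) :
    idem i * s = s ∧ s * idem j = s := by
  by_cases hx : (x.p : ZMod 2) = i + j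
  swap
  · rw [E.eq_zero_of_mem_term hx hs]; simp
  obtain ⟨t, rfl⟩ := ZMod.intCast_surjective j
  rw [E.mem_term_iff (t := t) rfl hx] at hs
  obtain ⟨a, -, rfl⟩ := hs
  constructor
  · have : (idem i : Half C) = idem (0 + ((x.p + t : ℤ) : ZMod 2)) := by
      push_cast
      rw [hx, add_assoc, add_self_two, zero_add, add_zero]
    rw [this, ← mul_assoc, ← mul_assoc, ← zp_mul_idem, mul_assoc (E.zp _), idem_mul_single]
  · rw [mul_assoc, zp_mul_idem]
    push_cast
    rw [cast_sg, one_mul, neg_two, add_self_two, ← mul_assoc, mul_assoc (E.zp _), single_mul_idem]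

theorem isLoop_mem_term [TopologicalSpace C] {i j : ZMod 2} {f : Series C} (hf : E.IsLoop i j f)
    (x : Dih) : f x.ε x.p ∈ E.term i j x := by
  by_cases hx : (x.p : ZMod 2) = i + j
  swap
  · rw [hf.eq_zero _ _ hx]; exact zero_mem _
  obtain ⟨c, ⟨a, ha, hc⟩, h⟩ := hf.coeff_mem x.ε x.p hx
  rw [h, hc]
  rcases zmod_two_cases j with rfl | rfl
  · rw [E.mem_term_iff (t := 0) (by simp) hx]
    exact ⟨a, ha, by simp⟩
  · rw [E.mem_term_iff (t := 1) (by simp) hx]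
    refine ⟨a, ha, ?_⟩
    rcases zmod_two_cases x.ε with hε | hε
    · simp [hε, zp_add, mul_assoc]
    · simp [hε, zp_add, mul_assoc]

theorem isLoop_of_mem_term [TopologicalSpace C] {i j : ZMod 2} {f : Series C}
    (hf : ∀ x : Dih, f x.ε x.p ∈ E.term i j x)
    (hr : ∀ q : Seminorm ℝ (Half C), Continuous q → ∀ s : ℕ, ∃ K : ℝ, ∀ (ε : ZMod 2) (p : ℤ),
      (1 + |(p : ℝ)|) ^ s * q (f ε p) ≤ K) : E.IsLoop i j f where
  coeff_mem ε p hp := by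
    have h := hf ⟨ε, p⟩
    rcases zmod_two_cases j with rfl | rfl
    · rw [E.mem_term_iff (t := 0) (by simp) hp] at h
      obtain ⟨a, ha, h⟩ := h
      exact ⟨_, ⟨a, ha, rfl⟩, by simpa using h.symm⟩
    · rw [E.mem_term_iff (t := 1) (by simp) hp] at h
      obtain ⟨a, ha, h⟩ := h
      refine ⟨_, ⟨a, ha, rfl⟩, ?_⟩
      rw [← h]
      rcases zmod_two_cases ε with rfl | rfl
      · simp [zp_add, mul_assoc]
      · simp [zp_add, mul_assoc]
  eq_zero ε p hp := E.eq_zero_of_mem_term (x := ⟨ε, p⟩) hp (hf _)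
  rapid := hr

end CyclicExtension

section Topology

variable {C : Type*} [Ring C] [Algebra ℝ C]

instance [TopologicalSpace C] [LocallyConvexSpace ℝ C] : LocallyConvexSpace ℝ (Half C) :=
  inferInstanceAs (LocallyConvexSpace ℝ (ZMod 2 → ZMod 2 → C))

variable [UniformSpace C] [IsUniformAddGroup C] [IsTopologicalRing C] (E : CyclicExtension C)

/-- Removing the outer powers of `z` and taking the (0, 0) entry is a continuous additive inverse of
the parametrization by 𝔄^ε. Cauchy sequences and limits thus transfer to and from `E.part x.ε`. -/
theorem CyclicExtension.seqComplete_term (hE : E.SeqComplete) (i j : ZMod 2) (x : Dih) :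
    SeqCompleteSubspace (E.term i j x) := by
  intro u hu hc
  by_cases hx : (x.p : ZMod 2) = i + j
  swap
  · refine ⟨0, zero_mem _, ?_⟩
    rw [show u = fun _ => 0 from funext fun n => E.eq_zero_of_mem_term hx (hu n)]
    exact tendsto_const_nhds
  obtain ⟨t, rfl⟩ := ZMod.intCast_surjective j
  have hu' := fun n => (E.mem_term_iff (t := t) rfl hx).1 (hu n)
  choose a ha hau using hu'
  let ψ : Half C →+ C :=
    { toFun := fun s => (E.zp (-(x.p + t)) * s * E.zp (sg x.ε * t)) 0 0
      map_zero' := by simp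
      map_add' := by intro s s'; simp [mul_add, add_mul] }
  have hψ : Continuous ψ := by
    have : Continuous fun s : Half C => E.zp (-(x.p + t)) * s * E.zp (sg x.ε * t) := by fun_prop
    exact this.matrix_elem 0 0
  have hψu : (ψ ∘ u) = a := by
    funext n
    simp only [Function.comp, ψ, AddMonoidHom.coe_mk, ZeroHom.coe_mk, ← hau n, mul_assoc,
      zp_neg_mul_zp_mul, zp_neg_mul_zp]
    simp
  have hca : CauchySeq a := hψu ▸ hc.map (uniformContinuous_addMonoidHom_of_continuous hψ)
  obtain ⟨b, hb, hlim⟩ := hE x.ε a ha hca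
  refine ⟨_, (E.mem_term_iff (t := t) rfl hx).2 ⟨b, hb, rfl⟩, ?_⟩
  have hcont : Continuous fun a : C =>
      E.zp (x.p + t) * Matrix.single 0 0 a * E.zp (-(sg x.ε * t)) := by
    have : Continuous fun a : C => (Matrix.single 0 0 a : Half C) := by
      refine continuous_matrix fun i j => ?_
      simp only [Matrix.single_apply]
      split_ifs <;> fun_prop
    fun_prop
  exact ((hcont.tendsto b).comp hlim).congr hau

end Topology

end CyclicLoop

/-! ### Rotated entries, weights and tame matrices. -/

namespace CyclicLoop

section Mono

variable {C : Type*} [Ring C] [TopologicalSpace C]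

theorem mono_mulS (p : ℤ) (s : Half C) (f : Series C) (ε : ZMod 2) (r : ℤ) :
    (mono 0 p s ⋄ f) ε r = s * f ε (r - p) := by
  have h : ((1 : ZMod 2) = 0) = False := by decide
  simp only [mulS, mono, true_and, h, false_and, if_false, zero_mul, tsum_zero, add_zero]
  rw [tsum_eq_single p (fun q hq => by rw [if_neg hq, zero_mul]), if_pos rfl]

theorem mulS_mono (f : Series C) (r : ℤ) (s : Half C) (ε : ZMod 2) (p : ℤ) :
    (f ⋄ mono 0 r s) ε p = f ε (p - sg ε * r) * s := by
  have h1 : ((1 : ZMod 2) = 0) = False := by decide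
  have h2 : (1 + 1 : ZMod 2) = 0 := by decide
  simp only [mulS, mono]
  rcases zmod_two_cases ε with rfl | rfl
  · simp only [true_and, zero_add, h1, false_and, if_false, mul_zero, tsum_zero, add_zero,
      sg_zero, one_mul]
    rw [tsum_eq_single (p - r) (fun q hq => by rw [if_neg (by omega), mul_zero]),
      if_pos (by omega)]
  · simp only [h1, h2, false_and, if_false, mul_zero, tsum_zero, zero_add, true_and,
      sg_one, neg_mul, one_mul, sub_neg_eq_add]
    rw [tsum_eq_single (p + r) (fun q hq => by rw [if_neg (by omega), mul_zero]),
      if_pos (by omega)]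

end Mono

/-- (1 + u + v)⁴ ≥ (1 + u)²(1 + v)² separates the index from the degree. The bound on the sum is
uniform in `n`. -/
theorem summable_weights (j : ZMod 2) : ∃ K : ℝ, ∀ n : ℤ,
    Summable (fun z : Idx j × Dih =>
      ((1 + |(|(n : ℝ)| - |(z.1.1 : ℝ)|)| + |(z.2.p : ℝ)|) ^ 4)⁻¹) ∧
    ∑' z : Idx j × Dih, ((1 + |(|(n : ℝ)| - |(z.1.1 : ℝ)|)| + |(z.2.p : ℝ)|) ^ 4)⁻¹ ≤ K := by
  obtain ⟨g, hg⟩ : ∃ g : ℤ → ℝ, ∀ p, g p = ((1 + |(p : ℝ)|) ^ 2)⁻¹ := ⟨_, fun _ => rfl⟩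
  have hg0 : ∀ p, 0 ≤ g p := fun p => by rw [hg]; positivity
  have hgs : Summable g := (summable_congr hg).2 summable_one_add_abs_inv_sq
  have hD : Summable fun y : Dih => g y.p := by
    rw [← Dih.equivProd.symm.summable_iff]
    have h0 : Summable fun _ : ZMod 2 => (1 : ℝ) := (hasSum_fintype _).summable
    have := h0.mul_of_nonneg hgs (fun _ => zero_le_one) hg0
    refine this.congr fun z => ?_
    simp [Dih.equivProd]
  refine ⟨2 * weightSum * ∑' y : Dih, g y.p, fun n => ?_⟩
  obtain ⟨f, hf⟩ : ∃ f : ℤ → ℝ, ∀ l, f l = ((1 + |(|(n : ℝ)| - |(l : ℝ)|)|) ^ 2)⁻¹ :=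
    ⟨_, fun _ => rfl⟩
  have hf0 : ∀ l, 0 ≤ f l := fun l => by rw [hf]; positivity
  obtain ⟨h1, h2⟩ := summable_abs_sub_abs n
  rw [← summable_congr hf] at h1
  rw [← tsum_congr hf] at h2
  have h3 : Summable fun l : Idx j => f l.1 := h1.comp_injective Subtype.val_injective
  have h4 : ∑' l : Idx j, f l.1 ≤ 2 * weightSum :=
    (h1.tsum_subtype_le _ {p : ℤ | (p : ZMod 2) = j} hf0).trans h2
  have h5 : Summable fun z : Idx j × Dih => f z.1.1 * g z.2.p :=
    h3.mul_of_nonneg hD (fun l => hf0 _) (fun y => hg0 _)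
  have hle : ∀ z : Idx j × Dih,
      ((1 + |(|(n : ℝ)| - |(z.1.1 : ℝ)|)| + |(z.2.p : ℝ)|) ^ 4)⁻¹ ≤ f z.1.1 * g z.2.p := by
    intro z
    rw [hf, hg, ← mul_inv, ← mul_pow]
    have ha := abs_nonneg (|(n : ℝ)| - |(z.1.1 : ℝ)|)
    have hb := abs_nonneg (z.2.p : ℝ)
    refine inv_anti₀ (by positivity) ?_
    rw [show 4 = 2 * 2 from rfl, pow_mul]
    refine pow_le_pow_left₀ (by positivity) ?_ 2
    nlinarith
  have h6 := Summable.of_nonneg_of_le (fun z => by positivity) hle h5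
  refine ⟨h6, (h6.tsum_le_tsum hle h5).trans ?_⟩
  have h7 : HasSum (fun z : Idx j × Dih => f z.1.1 * g z.2.p)
      ((∑' l : Idx j, f l.1) * ∑' y : Dih, g y.p) := h3.hasSum.mul hD.hasSum h5
  rw [h7.tsum_eq]
  exact mul_le_mul_of_nonneg_right h4 (tsum_nonneg fun y => hg0 _)

namespace CyclicExtension

theorem abs_p_le (x y : Dih) : |(x.p : ℝ)| ≤ |(y.p : ℝ)| + |((y⁻¹ * x).p : ℝ)| := by
  have h : |((y⁻¹ * x).p : ℝ)| = |(x.p : ℝ) - y.p| := by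
    rw [Dih.inv_mul_p]
    rcases zmod_two_cases y.ε with h | h <;> simp [h, abs_sub_comm]
  rw [h]
  have := abs_add_le (y.p : ℝ) (x.p - y.p)
  rwa [add_sub_cancel] at this

/-- Pairs of a parity and a shifted degree. -/
def shiftEquiv (n l : ℤ) : ZMod 2 × ℤ ≃ Dih where
  toFun y := ⟨y.1, y.2 + n - sg y.1 * l⟩
  invFun y := ⟨y.ε, y.p - n + sg y.ε * l⟩
  left_inv y := by ext <;> simp only; ring
  right_inv y := by ext <;> simp only; ring

variable {C : Type*} [Ring C] [Algebra ℝ C] [UniformSpace C] (E : CyclicExtension C)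
variable {i j k l : ZMod 2}

/-- The entries of the matrix `R⁻¹ A R`, as functions on the dihedral group. -/
noncomputable def ro (A : Mat C i j) (n : Idx i) (m : Idx j) (x : Dih) : Half C := E.rot A n m x.ε x.p

theorem ro_apply (A : Mat C i j) (n : Idx i) (m : Idx j) (x : Dih) :
    E.ro A n m x = E.zp n.1 * A n m x.ε (x.p - n.1 + sg x.ε * m.1) * E.zp (-m.1) := by
  rw [ro, rot, zS, zS, mulS_mono, mono_mulS, mul_neg, sub_neg_eq_add]
  congr 3
  ring

theorem apply_eq_ro (A : Mat C i j) (n : Idx i) (m : Idx j) (ε : ZMod 2) (p : ℤ) :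
    A n m ε p = E.zp (-n.1) * E.ro A n m ⟨ε, p + n.1 - sg ε * m.1⟩ * E.zp m.1 := by
  simp only [ro_apply, mul_assoc, zp_neg_mul_zp_mul, zp_neg_mul_zp, mul_one]
  congr 1
  ring

theorem ro_injective {A B : Mat C i j} (h : ∀ n m x, E.ro A n m x = E.ro B n m x) : A = B := by
  funext n m ε p
  rw [E.apply_eq_ro A, E.apply_eq_ro B, h]

/-- Rapid decrease of the rotated entries with respect to a weight on pairs of indices. -/
def Decays (κ : ℤ → ℤ → ℝ) (A : Mat C i j) : Prop :=
  ∀ q : Seminorm ℝ (Half C), Continuous q → ∀ s : ℕ, ∃ K : ℝ, ∀ n m (x : Dih),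
    (1 + κ n.1 m.1 + |(x.p : ℝ)|) ^ s * q (E.ro A n m x) ≤ K

/-- The distance between the absolute values of indices. -/
noncomputable def diagWeight (n m : ℤ) : ℝ := |(|(n : ℝ)| - |(m : ℝ)|)|

/-- The sum of the absolute values of indices. -/
noncomputable def sumWeight (n m : ℤ) : ℝ := |(n : ℝ)| + |(m : ℝ)|

theorem isTame_iff (A : Mat C i j) : E.IsTame A ↔ E.Decays diagWeight A :=
  forall₃_congr fun _ _ _ => exists_congr fun _ => ⟨fun h n m x => h n m x.ε x.p,
    fun h n m ε p => h n m ⟨ε, p⟩⟩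

theorem isRapid_iff (A : Mat C i j) : E.IsRapid A ↔ E.Decays sumWeight A :=
  forall₃_congr fun _ _ _ => exists_congr fun _ => by
    simp only [sumWeight, ← add_assoc]
    exact ⟨fun h n m x => h n m x.ε x.p, fun h n m ε p => h n m ⟨ε, p⟩⟩

theorem diagWeight_nonneg (n m : ℤ) : 0 ≤ diagWeight n m := abs_nonneg _

theorem diagWeight_le_sumWeight (n m : ℤ) : diagWeight n m ≤ sumWeight n m := by
  rw [diagWeight, sumWeight, abs_le]
  constructor <;> linarith [abs_nonneg (n : ℝ), abs_nonneg (m : ℝ)]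

theorem diagWeight_triangle (n l m : ℤ) :
    diagWeight n m ≤ diagWeight n l + diagWeight l m := abs_sub_le _ _ _

/-- The inequality is asymmetric on purpose: only the left factor has to decrease in both indices,
while the right factor merely stays near the two diagonals. -/
theorem sumWeight_triangle (n l m : ℤ) :
    sumWeight n m ≤ sumWeight n l + diagWeight l m := by
  have := neg_abs_le (|(l : ℝ)| - |(m : ℝ)|)
  rw [sumWeight, sumWeight, diagWeight]
  linarith

variable {E} in
theorem Decays.mono {κ κ' : ℤ → ℤ → ℝ} (h0 : ∀ n m, 0 ≤ κ' n m) (h : ∀ n m, κ' n m ≤ κ n m)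
    {A : Mat C i j} (hA : E.Decays κ A) : E.Decays κ' A := by
  intro q hq s
  obtain ⟨K, hK⟩ := hA q hq s
  refine ⟨K, fun n m x => (mul_le_mul_of_nonneg_right ?_ (apply_nonneg _ _)).trans (hK n m x)⟩
  have := h0 n.1 m.1
  have := h n.1 m.1
  exact pow_le_pow_left₀ (by positivity) (by linarith) s

/-- The matrices over `𝔅^{c,d}` with tame rotated entries. -/
structure TameLoop (c d : ZMod 2) (A : Mat C i j) : Prop where
  mem : ∀ n m x, E.ro A n m x ∈ E.term (c + i) (d + j) x
  tame : E.Decays diagWeight A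

/-- Rotation multiplies by z^{n/2} and z^{-m/2} and so moves the corner (c, d) to (c + i, d + j). -/
theorem TameLoop.of_isLoop {c d : ZMod 2} {A : Mat C i j} (h : ∀ n m, E.IsLoop c d (A n m))
    (hA : E.IsTame A) : E.TameLoop c d A where
  mem n m x := by
    rw [ro_apply]
    exact E.term_conj (E.isLoop_mem_term (h n m) ⟨x.ε, x.p - n.1 + sg x.ε * m.1⟩)
      (by rw [n.2]) (by rw [m.2]) rfl (by simp only; ring)
  tame := (E.isTame_iff A).1 hA

end CyclicExtension

end CyclicLoop

/-! ### Convergence and decay of products of tame matrices. -/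

namespace CyclicLoop.CyclicExtension

variable {C : Type*} [Ring C] [Algebra ℝ C] [UniformSpace C]
variable {E : CyclicExtension C}
variable {i j k l c d e f : ZMod 2}

theorem TameLoop.isLoop [IsTopologicalRing C] {A : Mat C i j} (hA : E.TameLoop c d A) (n : Idx i)
    (m : Idx j) : E.IsLoop c d (A n m) := by
  refine E.isLoop_of_mem_term (fun x => ?_) fun q hq s => ?_
  · have h := E.term_conj (hA.mem n m ⟨x.ε, x.p + n.1 - sg x.ε * m.1⟩) (n := -n.1) (m := -m.1)
      (i' := c) (j' := d) (y := x) (by push_cast; rw [n.2, neg_two, add_assoc, add_self_two, add_zero])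
      (by push_cast; rw [m.2, neg_two, add_assoc, add_self_two, add_zero]) rfl
      (by simp only; ring)
    rw [neg_neg] at h
    rwa [E.apply_eq_ro A]
  · obtain ⟨r, hr, hqr⟩ := exists_seminorm_conj_le q hq (E.zp (-n.1)) (E.zp m.1)
    obtain ⟨K, hK⟩ := hA.tame r hr s
    -- Undoing the rotation shifts the degree by at most |n| + |m|. The resulting constant depends
    -- on the entry, which is harmless since `n` and `m` are fixed here.
    refine ⟨(1 + |(n.1 : ℝ)| + |(m.1 : ℝ)|) ^ s * K, fun ε p => ?_⟩
    rw [E.apply_eq_ro A, hqr]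
    refine le_trans ?_ (mul_le_mul_of_nonneg_left (hK n m ⟨ε, p + n.1 - sg ε * m.1⟩)
      (by positivity))
    rw [← mul_assoc, ← mul_pow]
    refine mul_le_mul_of_nonneg_right (pow_le_pow_left₀ (by positivity) ?_ s) (apply_nonneg _ _)
    have h1 : |(p : ℝ)| ≤ |((p + n.1 - sg ε * m.1 : ℤ) : ℝ)| + |(n.1 : ℝ)| + |(m.1 : ℝ)| := by
      have : |(sg ε : ℝ)| = 1 := by rcases zmod_two_cases ε with rfl | rfl <;> simp
      have h2 : |(sg ε : ℝ) * m.1| = |(m.1 : ℝ)| := by rw [abs_mul, this, one_mul]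
      calc |(p : ℝ)| = |((p + n.1 - sg ε * m.1 : ℤ) : ℝ) + (-(n.1 : ℝ) + sg ε * m.1)| := by
            push_cast; congr 1; ring
        _ ≤ _ := (abs_add_le _ _).trans (by
            rw [add_assoc]
            exact add_le_add_right ((abs_add_le _ _).trans (by rw [abs_neg, h2])) _)
    have h2 := diagWeight_nonneg n.1 m.1
    have h3 := abs_nonneg (n.1 : ℝ)
    have h4 := abs_nonneg (m.1 : ℝ)
    have h5 := abs_nonneg ((p + n.1 - sg ε * m.1 : ℤ) : ℝ)
    simp only
    nlinarith [mul_nonneg (add_nonneg h3 h4) (add_nonneg h2 h5)]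

theorem TameLoop.isTame {A : Mat C i j} (hA : E.TameLoop c d A) : E.IsTame A :=
  (E.isTame_iff A).2 hA.tame

variable [IsUniformAddGroup C] [IsTopologicalRing C] [ContinuousSMul ℝ C] [LocallyConvexSpace ℝ C]
variable (E) in
/-- The terms of the product of two matrices. -/
noncomputable def flat (A : Mat C i j) (B : Mat C j k) (n : Idx i) (m : Idx k) (x : Dih) (z : Idx j × Dih) :
    Half C := E.ro A n z.1 z.2 * E.ro B z.1 m (z.2⁻¹ * x)

/-- The weight at (n, m, x) is at most the product of the weights of the two factors, by the
triangle inequality for `κ` and for degrees. -/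
theorem flat_bound {κ : ℤ → ℤ → ℝ} (hκ : ∀ n m, diagWeight n m ≤ κ n m)
    (hκ' : ∀ n l m, κ n m ≤ κ n l + diagWeight l m) {A : Mat C i j} {B : Mat C j k}
    (hA : E.Decays κ A) (hB : E.Decays diagWeight B) (q : Seminorm ℝ (Half C)) (hq : Continuous q)
    (s : ℕ) : ∃ K : ℝ, ∀ n m x z, q (E.flat A B n m x z) ≤
      K * ((1 + κ n.1 m.1 + |(x.p : ℝ)|) ^ s)⁻¹ *
        ((1 + |(|(n.1 : ℝ)| - |(z.1.1 : ℝ)|)| + |(z.2.p : ℝ)|) ^ 4)⁻¹ := by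
  obtain ⟨r, hr, hqr⟩ := exists_seminorm_mul_le q hq
  -- `s` powers provide the decay of the product; four more make the sum over the inner index and
  -- degree converge.
  obtain ⟨K₁, hK₁⟩ := hA r hr (s + 4)
  obtain ⟨K₂, hK₂⟩ := hB r hr s
  refine ⟨K₁ * K₂, fun n m x z => ?_⟩
  have e1 := hK₁ n z.1 z.2
  have e2 := hK₂ z.1 m (z.2⁻¹ * x)
  have d1 := hκ n.1 z.1.1
  have d2 := hκ' n.1 z.1.1 m.1
  have d3 := abs_p_le x z.2
  have d4 := hκ n.1 m.1
  have p1 := diagWeight_nonneg n.1 z.1.1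
  have p2 := diagWeight_nonneg z.1.1 m.1
  have p3 := diagWeight_nonneg n.1 m.1
  have p4 := abs_nonneg (z.2.p : ℝ)
  have p5 := abs_nonneg ((z.2⁻¹ * x).p : ℝ)
  have p6 := abs_nonneg (x.p : ℝ)
  have hw0 : |(|(n.1 : ℝ)| - |(z.1.1 : ℝ)|)| = diagWeight n.1 z.1.1 := rfl
  rw [hw0]
  set w := 1 + κ n.1 m.1 + |(x.p : ℝ)| with hw
  set w₀ := 1 + diagWeight n.1 z.1.1 + |(z.2.p : ℝ)| with hw₀
  set w₁ := 1 + κ n.1 z.1.1 + |(z.2.p : ℝ)| with hw₁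
  set w₂ := 1 + diagWeight z.1.1 m.1 + |((z.2⁻¹ * x).p : ℝ)| with hw₂
  have hwp : 0 < w := by linarith
  have hw₀p : 0 < w₀ := by linarith
  have hw₁p : 0 < w₁ := by linarith
  have hw₂p : 0 < w₂ := by linarith
  have hw01 : w₀ ≤ w₁ := by linarith
  have hww : w ≤ w₁ * w₂ := by
    have : 0 ≤ (κ n.1 z.1.1 + |(z.2.p : ℝ)|) * (diagWeight z.1.1 m.1 + |((z.2⁻¹ * x).p : ℝ)|) :=
      mul_nonneg (by linarith) (by linarith)
    rw [hw, hw₁, hw₂]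
    nlinarith
  refine (hqr _ _).trans ?_
  have ra := apply_nonneg r (E.ro A n z.1 z.2)
  have rb := apply_nonneg r (E.ro B z.1 m (z.2⁻¹ * x))
  rw [mul_assoc, ← mul_inv, ← div_eq_mul_inv, le_div_iff₀ (by positivity)]
  calc r (E.ro A n z.1 z.2) * r (E.ro B z.1 m (z.2⁻¹ * x)) * (w ^ s * w₀ ^ 4)
      ≤ r (E.ro A n z.1 z.2) * r (E.ro B z.1 m (z.2⁻¹ * x)) * ((w₁ * w₂) ^ s * w₁ ^ 4) := by
        gcongr
    _ = (w₁ ^ (s + 4) * r (E.ro A n z.1 z.2)) * (w₂ ^ s * r (E.ro B z.1 m (z.2⁻¹ * x))) := by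
        rw [mul_pow, pow_add]; ring
    _ ≤ K₁ * K₂ := mul_le_mul e1 e2 (by positivity) ((by positivity : (0 : ℝ) ≤ _).trans e1)

theorem flat_mem {A : Mat C i j} {B : Mat C j k} (hA : E.TameLoop c d A) (hB : E.TameLoop d e B)
    (n : Idx i) (m : Idx k) (x : Dih) (z : Idx j × Dih) :
    E.flat A B n m x z ∈ E.term (c + i) (e + k) x := by
  have := E.term_mul (hA.mem n z.1 z.2) (hB.mem z.1 m (z.2⁻¹ * x))
  rwa [mul_inv_cancel_left] at this

theorem summable_flat_seminorm {A : Mat C i j} {B : Mat C j k} (hA : E.TameLoop c d A)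
    (hB : E.TameLoop d e B) (n : Idx i) (m : Idx k) (x : Dih)
    (q : Seminorm ℝ (Half C)) (hq : Continuous q) : Summable fun z => q (E.flat A B n m x z) := by
  obtain ⟨K, hK⟩ := flat_bound (fun _ _ => le_rfl) diagWeight_triangle hA.tame hB.tame q hq 0
  obtain ⟨W, hW⟩ := summable_weights j
  exact Summable.of_nonneg_of_le (fun z => apply_nonneg _ _) (hK n m x) ((hW n.1).1.mul_left _)

theorem exists_hasSum_flat (hE : E.SeqComplete) {A : Mat C i j} {B : Mat C j k}
    (hA : E.TameLoop c d A) (hB : E.TameLoop d e B) (n : Idx i) (m : Idx k) (x : Dih)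
    {ι : Type*} [Countable ι] {φ : ι → Idx j × Dih} (hφ : Function.Injective φ) :
    ∃ s ∈ E.term (c + i) (e + k) x, HasSum (fun a => E.flat A B n m x (φ a)) s :=
  hasSum_of_summable_seminorms (E.seqComplete_term hE _ _ x) (fun _ => flat_mem hA hB n m x _)
    fun q hq => (summable_flat_seminorm hA hB n m x q hq).comp_injective hφ

theorem summable_flat (hE : E.SeqComplete) {A : Mat C i j} {B : Mat C j k}
    (hA : E.TameLoop c d A) (hB : E.TameLoop d e B) (n : Idx i) (m : Idx k) (x : Dih) :
    Summable (E.flat A B n m x) :=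
  let ⟨s, _, hs⟩ := exists_hasSum_flat hE hA hB n m x (φ := id) Function.injective_id
  ⟨s, hs⟩

/-- Both sums defining `⋄`, for δ = 0 and δ = 1, are the same convolution: the second degree `sg δ *
(P - q)` is that of a quotient in the dihedral group. After rotation the shift by the inner index
`l` is absorbed by `shiftEquiv`. -/
theorem mul_apply_eq_flat (A : Mat C i j) (B : Mat C j k) (n : Idx i) (m : Idx k) (l : Idx j)
    (ε δ : ZMod 2) (P q : ℤ) :
    A n l δ q * B l m (δ + ε) (sg δ * (P - q)) =
      E.zp (-n.1) * E.flat A B n m ⟨ε, P + n.1 - sg ε * m.1⟩ (l, shiftEquiv n.1 l.1 (δ, q)) *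
        E.zp m.1 := by
  rw [E.apply_eq_ro A, E.apply_eq_ro B, flat]
  simp only [mul_assoc, zp_mul_zp_neg_mul]
  congr 4
  ext1
  · simp [shiftEquiv]
  · have h := sg_mul_self δ
    simp only [Dih.inv_mul_p, shiftEquiv, Equiv.coe_fn_mk, sg_add]
    linear_combination (-(l.1 : ℤ)) * h

variable [T2Space C]

theorem hasSum_mulM (hE : E.SeqComplete) {A : Mat C i j} {B : Mat C j k}
    (hA : E.TameLoop c d A) (hB : E.TameLoop d e B) (n : Idx i) (m : Idx k) (ε : ZMod 2) (P : ℤ) :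
    (∀ l, (Summable fun q : ℤ => A n l 0 q * B l m ε (P - q)) ∧
      Summable fun q : ℤ => A n l 1 q * B l m (ε + 1) (q - P)) ∧
    HasSum (fun l => (A n l ⋄ B l m) ε P) (E.zp (-n.1) *
      (∑' z, E.flat A B n m ⟨ε, P + n.1 - sg ε * m.1⟩ z) * E.zp m.1) := by
  set x : Dih := ⟨ε, P + n.1 - sg ε * m.1⟩ with hx
  have key : ∀ l, ((Summable fun q : ℤ => A n l 0 q * B l m ε (P - q)) ∧
      Summable fun q : ℤ => A n l 1 q * B l m (ε + 1) (q - P)) ∧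
      ∃ s, HasSum (fun y => E.flat A B n m x (l, y)) s ∧
        (A n l ⋄ B l m) ε P = E.zp (-n.1) * s * E.zp m.1 := by
    intro l
    obtain ⟨s, -, hs⟩ := exists_hasSum_flat hE hA hB n m x (φ := fun y => (l, y))
      (fun y y' h => (Prod.mk.inj h).2)
    have hδ : ∀ δ : ZMod 2, ∃ t, HasSum
        (fun q : ℤ => A n l δ q * B l m (δ + ε) (sg δ * (P - q))) t := by
      intro δ
      obtain ⟨t, -, ht⟩ := exists_hasSum_flat hE hA hB n m x
        (φ := fun q : ℤ => (l, shiftEquiv n.1 l.1 (δ, q)))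
        (fun q q' h => by simpa [shiftEquiv] using h)
      refine ⟨E.zp (-n.1) * t * E.zp m.1, ?_⟩
      simp only [mul_apply_eq_flat (E := E)]
      exact (ht.mul_left _).mul_right _
    choose t ht using hδ
    have h1 : HasSum (fun y : ZMod 2 × ℤ => A n l y.1 y.2 * B l m (y.1 + ε) (sg y.1 * (P - y.2)))
        (E.zp (-n.1) * s * E.zp m.1) := by
      simp only [mul_apply_eq_flat (E := E)]
      exact (((shiftEquiv n.1 l.1).hasSum_iff.2 hs).mul_left _).mul_right _
    -- Summing over `q` for each parity separately gives the two series in the definition of `⋄`;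
    -- their total equals the sum over the group.
    have h2 := h1.prod_fiberwise ht
    have h3 := h2.unique (hasSum_fintype t)
    have h4 : ∑ δ, t δ = t 0 + t 1 := Fin.sum_univ_two t
    have ht0 := ht 0
    have ht1 := ht 1
    simp only [zero_add, sg_zero, one_mul, sg_one, neg_mul, neg_sub, add_comm (1 : ZMod 2)] at ht0 ht1
    refine ⟨⟨ht0.summable, ht1.summable⟩, s, hs, ?_⟩
    rw [h3, h4, ← ht0.tsum_eq, ← ht1.tsum_eq]
    rfl
  choose h s hs hs' using key
  refine ⟨h, ?_⟩
  simp only [hs']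
  exact (((summable_flat hE hA hB n m x).hasSum.prod_fiberwise hs).mul_left _).mul_right _

theorem summableM (hE : E.SeqComplete) {A : Mat C i j} {B : Mat C j k}
    (hA : E.TameLoop c d A) (hB : E.TameLoop d e B) : SummableM A B :=
  ⟨fun n l m ε p => (hasSum_mulM hE hA hB n m ε p).1 l, fun n m =>
    Pi.summable.2 fun ε => Pi.summable.2 fun p => (hasSum_mulM hE hA hB n m ε p).2.summable⟩

theorem mulM_apply (hE : E.SeqComplete) {A : Mat C i j} {B : Mat C j k}
    (hA : E.TameLoop c d A) (hB : E.TameLoop d e B) (n : Idx i) (m : Idx k) (ε : ZMod 2) (p : ℤ) :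
    (A ⬝ B) n m ε p = ∑' l, (A n l ⋄ B l m) ε p := by
  have h := (summableM hE hA hB).2 n m
  rw [mulM, tsum_apply h, tsum_apply (Pi.summable.1 h ε)]

/-- The convolution formula. Most later identities between matrices are verified through it, on
rotated entries. -/
theorem ro_mulM (hE : E.SeqComplete) {A : Mat C i j} {B : Mat C j k}
    (hA : E.TameLoop c d A) (hB : E.TameLoop d e B) (n : Idx i) (m : Idx k) (x : Dih) :
    E.ro (A ⬝ B) n m x = ∑' z, E.flat A B n m x z := by
  rw [ro_apply, mulM_apply hE hA hB, (hasSum_mulM hE hA hB _ _ _ _).2.tsum_eq]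
  have h : x.p - n.1 + sg x.ε * m.1 + n.1 - sg x.ε * m.1 = x.p := by ring
  simp [mul_assoc, h]

theorem decays_mulM (hE : E.SeqComplete) {κ : ℤ → ℤ → ℝ} (hκ : ∀ n m, diagWeight n m ≤ κ n m)
    (hκ' : ∀ n l m, κ n m ≤ κ n l + diagWeight l m) {A : Mat C i j} {B : Mat C j k}
    (hA : E.TameLoop c d A) (hAκ : E.Decays κ A) (hB : E.TameLoop d e B) :
    E.Decays κ (A ⬝ B) := by
  intro q hq s
  obtain ⟨K, hK⟩ := flat_bound hκ hκ' hAκ hB.tame q hq s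
  obtain ⟨W, hW⟩ := summable_weights j
  refine ⟨|K| * W, fun n m x => ?_⟩
  have h0 : 0 < 1 + κ n.1 m.1 + |(x.p : ℝ)| := by
    have := hκ n.1 m.1
    have := diagWeight_nonneg n.1 m.1
    have := abs_nonneg (x.p : ℝ)
    linarith
  have h1 := seminorm_tsum_le (summable_flat hE hA hB n m x) q hq ((hW n.1).1.mul_left _)
    (hK n m x)
  rw [tsum_mul_left] at h1
  rw [ro_mulM hE hA hB]
  have h2 := (tsum_nonneg fun z : Idx j × Dih => by positivity).trans (hW n.1).2
  calc _ ≤ (1 + κ n.1 m.1 + |(x.p : ℝ)|) ^ s * (|K| * ((1 + κ n.1 m.1 + |(x.p : ℝ)|) ^ s)⁻¹ * W) := by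
        refine mul_le_mul_of_nonneg_left (h1.trans ?_) (by positivity)
        refine mul_le_mul ?_ (hW n.1).2 (tsum_nonneg fun z => by positivity) (by positivity)
        exact mul_le_mul_of_nonneg_right (le_abs_self K) (by positivity)
    _ = |K| * W := by field_simp

theorem TameLoop.mul (hE : E.SeqComplete) {A : Mat C i j} {B : Mat C j k}
    (hA : E.TameLoop c d A) (hB : E.TameLoop d e B) : E.TameLoop c e (A ⬝ B) where
  mem n m x := by
    rw [ro_mulM hE hA hB]
    obtain ⟨s, hs, h⟩ := exists_hasSum_flat hE hA hB n m x (φ := id) Function.injective_id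
    exact h.tsum_eq ▸ hs
  tame := decays_mulM hE (fun _ _ => le_rfl) diagWeight_triangle hA hA.tame hB

/-- Rapidly decreasing matrices absorb tame factors on the right; this is what makes N(θ) - L[0]
rapidly decreasing. -/
theorem rapid_mulM (hE : E.SeqComplete) {A : Mat C i j} {B : Mat C j k}
    (hA : E.TameLoop c d A) (hAr : E.Decays sumWeight A) (hB : E.TameLoop d e B) :
    E.Decays sumWeight (A ⬝ B) :=
  decays_mulM hE diagWeight_le_sumWeight sumWeight_triangle hA hAr hB

end CyclicLoop.CyclicExtension

/-! ### Sums, associativity, and uniqueness of inverses. -/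

namespace CyclicLoop.CyclicExtension

variable {C : Type*} [Ring C] [Algebra ℝ C] [UniformSpace C]
variable {E : CyclicExtension C}
variable {i j k l c d e f : ZMod 2}

theorem ro_add (A B : Mat C i j) (n : Idx i) (m : Idx j) (x : Dih) :
    E.ro (A + B) n m x = E.ro A n m x + E.ro B n m x := by
  simp [ro_apply, mul_add, add_mul]

theorem ro_sub (A B : Mat C i j) (n : Idx i) (m : Idx j) (x : Dih) :
    E.ro (A - B) n m x = E.ro A n m x - E.ro B n m x := by
  simp [ro_apply, mul_sub, sub_mul]

theorem Decays.add {κ : ℤ → ℤ → ℝ} (hκ : ∀ n m, 0 ≤ κ n m) {A B : Mat C i j} (hA : E.Decays κ A)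
    (hB : E.Decays κ B) : E.Decays κ (A + B) := by
  intro q hq s
  obtain ⟨K₁, h₁⟩ := hA q hq s
  obtain ⟨K₂, h₂⟩ := hB q hq s
  refine ⟨K₁ + K₂, fun n m x => ?_⟩
  rw [ro_add]
  have := hκ n.1 m.1
  refine le_trans ?_ (add_le_add (h₁ n m x) (h₂ n m x))
  rw [← mul_add]
  exact mul_le_mul_of_nonneg_left (map_add_le_add q _ _) (by positivity)

theorem TameLoop.add {A B : Mat C i j} (hA : E.TameLoop c d A) (hB : E.TameLoop c d B) :
    E.TameLoop c d (A + B) where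
  mem n m x := by rw [ro_add]; exact add_mem (hA.mem n m x) (hB.mem n m x)
  tame := hA.tame.add diagWeight_nonneg hB.tame

theorem TameLoop.neg {A : Mat C i j} (hA : E.TameLoop c d A) : E.TameLoop c d (-A) := by
  have h : ∀ n m x, E.ro (-A) n m x = -E.ro A n m x := fun n m x => by simp [ro_apply]
  refine ⟨fun n m x => ?_, fun q hq s => ?_⟩
  · rw [h]; exact neg_mem (hA.mem n m x)
  · obtain ⟨K, hK⟩ := hA.tame q hq s
    exact ⟨K, fun n m x => by rw [h, map_neg_eq_map]; exact hK n m x⟩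

theorem TameLoop.sub {A B : Mat C i j} (hA : E.TameLoop c d A) (hB : E.TameLoop c d B) :
    E.TameLoop c d (A - B) := by
  rw [sub_eq_add_neg]; exact hA.add hB.neg

variable [IsTopologicalRing C]

/-- A matrix whose rotated entries are, up to bounded factors, the terms of a rapidly decreasing
series whose degrees control the weights of the entries. -/
theorem Decays.of_series {κ : ℤ → ℤ → ℝ} (hκ : ∀ n m, 0 ≤ κ n m) {f : Series C}
    (hf : ∀ q : Seminorm ℝ (Half C), Continuous q → ∀ s : ℕ, ∃ K : ℝ, ∀ (ε : ZMod 2) (p : ℤ),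
      (1 + |(p : ℝ)|) ^ s * q (f ε p) ≤ K) {A : Mat C i j} {M R : ℝ}
    (hA : ∀ n m (x : Dih), E.ro A n m x = 0 ∨ ∃ (r : ℝ) (a b : ℤ) (y : Dih), |r| ≤ R ∧ |a| ≤ 1 ∧
      |b| ≤ 1 ∧ 1 + κ n.1 m.1 + |(x.p : ℝ)| ≤ M * (1 + |(y.p : ℝ)|) ∧
      E.ro A n m x = r • (E.zp a * f y.ε y.p * E.zp b)) : E.Decays κ A := by
  intro q hq s
  have h1 : ∀ a b : ℤ, ∃ K : ℝ, ∀ (ε : ZMod 2) (p : ℤ),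
      (1 + |(p : ℝ)|) ^ s * q (E.zp a * f ε p * E.zp b) ≤ K := by
    intro a b
    obtain ⟨r, hr, hqr⟩ := exists_seminorm_conj_le q hq (E.zp a) (E.zp b)
    simp only [hqr]
    exact hf r hr s
  choose K hK using h1
  -- Only nine pairs of outer powers occur, so the sum of their constants is a bound independent of
  -- the entry.
  set T := ∑ a ∈ Finset.Icc (-1 : ℤ) 1, ∑ b ∈ Finset.Icc (-1 : ℤ) 1, |K a b| with hT
  have hT0 : 0 ≤ T := Finset.sum_nonneg fun a _ => Finset.sum_nonneg fun b _ => abs_nonneg _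
  refine ⟨|R| * |M| ^ s * T, fun n m x => ?_⟩
  have hκ0 := hκ n.1 m.1
  rcases hA n m x with h | ⟨r, a, b, y, hr, ha, hb, hM, h⟩
  · rw [h, map_zero, mul_zero]; positivity
  · rw [h, map_smul_eq_mul, Real.norm_eq_abs]
    have hKT : (1 + |(y.p : ℝ)|) ^ s * q (E.zp a * f y.ε y.p * E.zp b) ≤ T := by
      refine ((hK a b y.ε y.p).trans (le_abs_self _)).trans ?_
      have h2 : |K a b| ≤ ∑ b ∈ Finset.Icc (-1 : ℤ) 1, |K a b| :=
        Finset.single_le_sum (f := fun b => |K a b|) (fun b _ => abs_nonneg _)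
          (Finset.mem_Icc.2 (abs_le.1 hb))
      exact h2.trans (Finset.single_le_sum
        (f := fun a => ∑ b ∈ Finset.Icc (-1 : ℤ) 1, |K a b|)
        (fun a _ => Finset.sum_nonneg fun b _ => abs_nonneg _) (Finset.mem_Icc.2 (abs_le.1 ha)))
    have hq0 := apply_nonneg q (E.zp a * f y.ε y.p * E.zp b)
    calc (1 + κ n.1 m.1 + |(x.p : ℝ)|) ^ s * (|r| * q (E.zp a * f y.ε y.p * E.zp b))
        ≤ (|M| * (1 + |(y.p : ℝ)|)) ^ s * (|R| * q (E.zp a * f y.ε y.p * E.zp b)) := by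
          have : M * (1 + |(y.p : ℝ)|) ≤ |M| * (1 + |(y.p : ℝ)|) :=
            mul_le_mul_of_nonneg_right (le_abs_self _) (by positivity)
          have := hr.trans (le_abs_self R)
          gcongr
          linarith
      _ = |R| * |M| ^ s * ((1 + |(y.p : ℝ)|) ^ s * q (E.zp a * f y.ε y.p * E.zp b)) := by
          rw [mul_pow]; ring
      _ ≤ _ := mul_le_mul_of_nonneg_left hKT (by positivity)

theorem rapid_mono (ε₀ : ZMod 2) (p₀ : ℤ) (v : Half C) (q : Seminorm ℝ (Half C)) (s : ℕ) :
    ∃ K : ℝ, ∀ (ε : ZMod 2) (p : ℤ), (1 + |(p : ℝ)|) ^ s * q (mono ε₀ p₀ v ε p) ≤ K := by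
  refine ⟨(1 + |(p₀ : ℝ)|) ^ s * q v, fun ε p => ?_⟩
  rw [mono]
  split_ifs with h
  · rw [h.2]
  · rw [map_zero, mul_zero]
    exact mul_nonneg (by positivity) (apply_nonneg _ _)

variable [IsUniformAddGroup C] [ContinuousSMul ℝ C] [LocallyConvexSpace ℝ C] [T2Space C]

theorem mulM_sub (hE : E.SeqComplete) {A A' : Mat C i j} {B : Mat C j k} (hA : E.TameLoop c d A)
    (hA' : E.TameLoop c d A') (hB : E.TameLoop d e B) : (A - A') ⬝ B = A ⬝ B - A' ⬝ B := by
  refine E.ro_injective fun n m x => ?_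
  rw [ro_sub, ro_mulM hE hA hB, ro_mulM hE hA' hB, ro_mulM hE (hA.sub hA') hB,
    ← (summable_flat hE hA hB n m x).tsum_sub (summable_flat hE hA' hB n m x)]
  exact tsum_congr fun z => by rw [flat, ro_sub, sub_mul]; rfl

/-- Both sides are iterated sums of one family `T` of triple products. It is summable over pairs, so
the order of summation may be exchanged. -/
theorem mulM_assoc (hE : E.SeqComplete) {A : Mat C i j} {B : Mat C j k} {D : Mat C k l}
    (hA : E.TameLoop c d A) (hB : E.TameLoop d e B) (hD : E.TameLoop e f D) :
    A ⬝ B ⬝ D = A ⬝ (B ⬝ D) := by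
  refine E.ro_injective fun n m x => ?_
  set T : (Idx j × Dih) → (Idx k × Dih) → Half C := fun z w =>
    E.ro A n z.1 z.2 * E.ro B z.1 w.1 (z.2⁻¹ * w.2) * E.ro D w.1 m (w.2⁻¹ * x) with hT
  have hleft : E.ro (A ⬝ B ⬝ D) n m x = ∑' w, ∑' z, T z w := by
    rw [ro_mulM hE (hA.mul hE hB) hD]
    refine tsum_congr fun w => ?_
    rw [flat, ro_mulM hE hA hB, ← (summable_flat hE hA hB _ _ _).tsum_mul_right]
    rfl
  -- The inner product `B ⬝ D` is evaluated at `z.2⁻¹ * x`; left translation by `z.2⁻¹` matches its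
  -- summation variable with that of the other order.
  let g : Dih → (Idx k × Dih) ≃ (Idx k × Dih) := fun y =>
    (Equiv.refl _).prodCongr (Equiv.mulLeft y⁻¹)
  have hg : ∀ z w, T z w = E.ro A n z.1 z.2 * E.flat B D z.1 m (z.2⁻¹ * x) (g z.2 w) := by
    intro z w
    simp only [hT, flat, g, mul_assoc, Equiv.prodCongr_apply, Prod.map, Equiv.refl_apply,
      Equiv.coe_mulLeft, mul_inv_rev, inv_inv, mul_inv_cancel_left]
  have hright : E.ro (A ⬝ (B ⬝ D)) n m x = ∑' z, ∑' w, T z w := by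
    rw [ro_mulM hE hA (hB.mul hE hD)]
    refine tsum_congr fun z => ?_
    simp only [hg]
    have h := ((g z.2).hasSum_iff.2 (summable_flat hE hB hD z.1 m (z.2⁻¹ * x)).hasSum).mul_left
      (E.ro A n z.1 z.2)
    rw [flat, ro_mulM hE hB hD]
    exact h.tsum_eq.symm
  have hsum : Summable (Function.uncurry T) := by
    refine Exists.elim (hasSum_of_summable_seminorms (E.seqComplete_term hE (c + i) (f + l) x)
      (u := Function.uncurry T) ?_ ?_) fun s hs => ⟨s, hs.2⟩
    · rintro ⟨z, w⟩
      have h := E.term_mul (E.term_mul (hA.mem n z.1 z.2) (hB.mem z.1 w.1 (z.2⁻¹ * w.2)))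
        (hD.mem w.1 m (w.2⁻¹ * x))
      rwa [mul_inv_cancel_left, mul_inv_cancel_left] at h
    · intro q hq
      obtain ⟨r, hr, hqr⟩ := exists_seminorm_mul_mul_le q hq
      -- `A` controls the sum over `z`, measured from `n`, and `D` the sum over `w`, measured from
      -- `m`; boundedness of `B` is enough. The dominating family is then a product.
      obtain ⟨K₁, h₁⟩ := hA.tame r hr 4
      obtain ⟨K₂, h₂⟩ := hB.tame r hr 0
      obtain ⟨K₃, h₃⟩ := hD.tame r hr 4
      obtain ⟨W₁, hW₁⟩ := summable_weights j
      obtain ⟨W₂, hW₂⟩ := summable_weights k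
      have hs := ((hW₁ n.1).1.mul_of_nonneg (hW₂ m.1).1 (fun z => by positivity)
        (fun z => by positivity)).mul_left (K₁ * K₂ * (K₃ * (1 + |(x.p : ℝ)|) ^ 4))
      refine Summable.of_nonneg_of_le (fun z => apply_nonneg _ _) ?_ hs
      rintro ⟨z, w⟩
      refine (hqr _ _ _).trans ?_
      have e1 := h₁ n z.1 z.2
      have e2 := h₂ z.1 w.1 (z.2⁻¹ * w.2)
      have e3 := h₃ w.1 m (w.2⁻¹ * x)
      rw [pow_zero, one_mul] at e2
      have ra := apply_nonneg r (E.ro A n z.1 z.2)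
      have rb := apply_nonneg r (E.ro B z.1 w.1 (z.2⁻¹ * w.2))
      have rd := apply_nonneg r (E.ro D w.1 m (w.2⁻¹ * x))
      have d1 := diagWeight_nonneg n.1 z.1.1
      have d2 := diagWeight_nonneg w.1.1 m.1
      have c1 : r (E.ro A n z.1 z.2) ≤
          K₁ * ((1 + |(|(n.1 : ℝ)| - |(z.1.1 : ℝ)|)| + |(z.2.p : ℝ)|) ^ 4)⁻¹ := by
        rw [← div_eq_mul_inv, le_div_iff₀ (by positivity), mul_comm]
        exact e1
      have c3 : r (E.ro D w.1 m (w.2⁻¹ * x)) ≤ (K₃ * (1 + |(x.p : ℝ)|) ^ 4) *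
          ((1 + |(|(m.1 : ℝ)| - |(w.1.1 : ℝ)|)| + |(w.2.p : ℝ)|) ^ 4)⁻¹ := by
        rw [← div_eq_mul_inv, le_div_iff₀ (by positivity), mul_comm]
        -- The decay of `D` is in the degree of `w.2⁻¹ * x`. For fixed `x` it is traded for decay in
        -- the degree of `w.2`, at the cost of a power of 1 + |x.p|.
        have hw : 1 + |(|(m.1 : ℝ)| - |(w.1.1 : ℝ)|)| + |(w.2.p : ℝ)| ≤
            (1 + diagWeight w.1.1 m.1 + |((w.2⁻¹ * x).p : ℝ)|) * (1 + |(x.p : ℝ)|) := by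
          have h5 : |((w.2⁻¹ * x).p : ℝ)| = |(x.p : ℝ) - w.2.p| := by
            rw [Dih.inv_mul_p]
            rcases zmod_two_cases w.2.ε with h | h <;> simp [h, abs_sub_comm]
          have h6 : |(w.2.p : ℝ)| ≤ |(x.p : ℝ)| + |(x.p : ℝ) - w.2.p| := by
            have := abs_sub_abs_le_abs_sub (w.2.p : ℝ) x.p
            rw [abs_sub_comm (w.2.p : ℝ)] at this
            linarith
          have h7 : |(|(m.1 : ℝ)| - |(w.1.1 : ℝ)|)| = diagWeight w.1.1 m.1 := abs_sub_comm _ _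
          rw [h5, h7]
          nlinarith [abs_nonneg (x.p : ℝ), abs_nonneg ((x.p : ℝ) - w.2.p),
            mul_nonneg d2 (abs_nonneg (x.p : ℝ)),
            mul_nonneg (abs_nonneg ((x.p : ℝ) - w.2.p)) (abs_nonneg (x.p : ℝ))]
        calc _ ≤ ((1 + diagWeight w.1.1 m.1 + |((w.2⁻¹ * x).p : ℝ)|) * (1 + |(x.p : ℝ)|)) ^ 4 *
              r (E.ro D w.1 m (w.2⁻¹ * x)) :=
              mul_le_mul_of_nonneg_right (pow_le_pow_left₀ (by positivity) hw 4) rd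
          _ = ((1 + diagWeight w.1.1 m.1 + |((w.2⁻¹ * x).p : ℝ)|) ^ 4 *
              r (E.ro D w.1 m (w.2⁻¹ * x))) * (1 + |(x.p : ℝ)|) ^ 4 := by rw [mul_pow]; ring
          _ ≤ _ := mul_le_mul_of_nonneg_right e3 (by positivity)
      refine (mul_le_mul (mul_le_mul c1 e2 rb (ra.trans c1)) c3 rd
        (mul_nonneg (ra.trans c1) (rb.trans e2))).trans (le_of_eq ?_)
      ring
  rw [hleft, hright]
  refine Summable.tsum_comm' hsum (fun z => ?_) fun w => ?_
  · exact (summable_congr (hg z)).2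
      (((g z.2).summable_iff.2 (summable_flat hE hB hD z.1 m (z.2⁻¹ * x))).mul_left _)
  · exact (summable_flat hE hA hB n w.1 w.2).mul_right _

theorem ro_oneM (c i : ZMod 2) (n m : Idx i) (x : Dih) :
    E.ro (oneM c i) n m x = if n = m ∧ x = 1 then idem (c + i) else 0 := by
  rw [ro_apply, oneM]
  by_cases h : n = m
  · subst h
    have hx : (x = 1) ↔ (x.ε = 0 ∧ x.p - n.1 + sg x.ε * n.1 = 0) := by
      rw [Dih.ext_iff]
      refine and_congr_right fun h => ?_
      rw [h]; simp
    simp only [if_true, true_and, oneS, mono]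
    split_ifs with h1 h2 h2
    · rw [zp_mul_idem, n.2, mul_assoc, zp_mul_zp_neg, mul_one]
    · exact absurd (hx.2 h1) h2
    · exact absurd (hx.1 h2) h1
    · simp
  · simp [h]

theorem tameLoop_oneM (c i : ZMod 2) : E.TameLoop c c (oneM c i : Mat C i i) where
  mem n m x := by
    rw [ro_oneM]
    split_ifs with h
    · obtain ⟨t, ht⟩ := ZMod.intCast_surjective (c + i)
      rw [h.2, E.mem_term_iff (t := t) ht (by simp [add_self_two])]
      refine ⟨1, E.one_mem, ?_⟩
      have : (Matrix.single 0 0 1 : Half C) = idem 0 := rfl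
      simp [this, zp_mul_idem, mul_assoc, ht]
    · exact zero_mem _
  tame := by
    refine Decays.of_series diagWeight_nonneg (f := mono 0 0 (idem (c + i)))
      (fun q _ s => rapid_mono _ _ _ q s) (M := 1) (R := 1) fun n m x => ?_
    rw [ro_oneM]
    split_ifs with h
    · refine Or.inr ⟨1, 0, 0, 1, by simp, by simp, by simp, ?_, ?_⟩
      · rw [h.1, h.2]; simp [diagWeight]
      · simp [mono]
    · exact Or.inl rfl

theorem oneM_mulM (hE : E.SeqComplete) {A : Mat C i j} (hA : E.TameLoop c d A) :
    oneM c i ⬝ A = A := by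
  refine E.ro_injective fun n m x => ?_
  rw [ro_mulM hE (tameLoop_oneM c i) hA, tsum_eq_single (n, 1)]
  · rw [flat, ro_oneM, if_pos ⟨rfl, rfl⟩, inv_one, one_mul]
    exact (E.term_eq_single (hA.mem n m x)).1
  · rintro ⟨l, y⟩ h
    rw [flat, ro_oneM, if_neg, zero_mul]
    rintro ⟨rfl, rfl⟩
    exact h rfl

theorem mulM_oneM (hE : E.SeqComplete) {A : Mat C i j} (hA : E.TameLoop c d A) :
    A ⬝ oneM d j = A := by
  refine E.ro_injective fun n m x => ?_
  rw [ro_mulM hE hA (tameLoop_oneM d j), tsum_eq_single (m, x)]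
  · rw [flat, ro_oneM, if_pos ⟨rfl, inv_mul_cancel _⟩]
    exact (E.term_eq_single (hA.mem n m x)).2
  · rintro ⟨l, y⟩ h
    rw [flat, ro_oneM, if_neg, mul_zero]
    rintro ⟨rfl, h'⟩
    exact h (Prod.ext rfl (inv_mul_eq_one.1 h'))

theorem IsInverse.tameLoop {A : Mat C i j} {W : Mat C j i} (hW : E.IsInverse c A W) :
    E.TameLoop c c W := .of_isLoop E hW.loop hW.tame

theorem IsInverse.of_tameLoop {A : Mat C i j} {W : Mat C j i} (hW : E.TameLoop c c W)
    (h : A ⬝ W = oneM c i) (h' : W ⬝ A = oneM c j) : E.IsInverse c A W :=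
  ⟨hW.isLoop, hW.isTame, h, h'⟩

theorem IsInverse.unique (hE : E.SeqComplete) {A : Mat C i j} (hA : E.TameLoop c c A)
    {W W' : Mat C j i} (hW : E.IsInverse c A W) (hW' : E.IsInverse c A W') : W = W' := by
  rw [← mulM_oneM hE hW.tameLoop, ← hW'.mul_inv, ← mulM_assoc hE hW.tameLoop hA hW'.tameLoop,
    hW.inv_mul, oneM_mulM hE hW'.tameLoop]

theorem IsInverse.existsUnique (hE : E.SeqComplete) {A : Mat C i j} (hA : E.TameLoop c c A)
    {W : Mat C j i} (hW : E.IsInverse c A W) : ∃! W, E.IsInverse c A W :=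
  ⟨W, hW, fun _ hW' => hW'.unique hE hA hW⟩

theorem IsInverse.inv_eq (hE : E.SeqComplete) {A : Mat C i j} (hA : E.TameLoop c c A)
    {W : Mat C j i} (hW : E.IsInverse c A W) : E.inv c A = W := by
  have h : ∃ W, E.IsInverse c A W := ⟨W, hW⟩
  rw [inv, dif_pos h]
  exact h.choose_spec.unique hE hA hW

end CyclicLoop.CyclicExtension

/-! ### Fourier coefficients of smooth even periodic functions. -/

namespace CyclicLoop

section Fourier

open Real intervalIntegral
open scoped ContDiff

/-- The function `e^{imx}`. -/
noncomputable def expI (m : ℤ) (x : ℝ) : ℂ := Complex.exp ((m : ℂ) * Complex.I * x)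

theorem expI_hasDerivAt (m : ℤ) (x : ℝ) :
    HasDerivAt (expI m) ((m : ℂ) * Complex.I * expI m x) x := by
  have h : HasDerivAt (fun x : ℝ => (m : ℂ) * Complex.I * (x : ℂ)) ((m : ℂ) * Complex.I * 1) x :=
    (Complex.ofRealCLM.hasDerivAt (x := x)).const_mul _
  have := h.cexp
  rw [mul_one, mul_comm (Complex.exp _)] at this
  exact this

theorem expI_continuous (m : ℤ) : Continuous (expI m) :=
  continuous_iff_continuousAt.2 fun x => (expI_hasDerivAt m x).continuousAt

theorem norm_expI (m : ℤ) (x : ℝ) : ‖expI m x‖ = 1 := by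
  rw [expI, show (m : ℂ) * Complex.I * x = ((m * x : ℝ) : ℂ) * Complex.I by push_cast; ring,
    Complex.norm_exp_ofReal_mul_I]

theorem expI_two_pi (m : ℤ) : expI m (2 * π) = 1 := by
  rw [expI, show (m : ℂ) * Complex.I * ((2 * π : ℝ) : ℂ) = m * (2 * π * Complex.I) by
    push_cast; ring, Complex.exp_int_mul_two_pi_mul_I]

theorem expI_zero (m : ℤ) : expI m 0 = 1 := by simp [expI]

theorem expI_mul (m n : ℤ) (x : ℝ) : expI m x * expI n x = expI (m + n) x := by
  rw [expI, expI, expI, ← Complex.exp_add]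
  congr 1
  push_cast
  ring

theorem integral_expI (m : ℤ) :
    ∫ x in (0 : ℝ)..(2 * π), expI m x = if m = 0 then 2 * (π : ℂ) else 0 := by
  split_ifs with h
  · simp [h, expI]
  · have hc : (m : ℂ) * Complex.I ≠ 0 := mul_ne_zero (by exact_mod_cast h) Complex.I_ne_zero
    have h1 := integral_exp_mul_complex (a := 0) (b := 2 * π) hc
    have h2 := expI_two_pi m
    have h3 := expI_zero m
    rw [expI] at h2 h3
    rw [h2, h3, sub_self, zero_div] at h1
    exact h1

/-- Integration by parts; periodicity cancels the boundary terms. -/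
theorem integral_deriv_mul_expI {f : ℝ → ℂ} (hf : ContDiff ℝ ∞ f)
    (hp : Function.Periodic f (2 * π)) (m : ℤ) :
    ∫ x in (0 : ℝ)..(2 * π), deriv f x * expI (-m) x =
      (m : ℂ) * Complex.I * ∫ x in (0 : ℝ)..(2 * π), f x * expI (-m) x := by
  have hf' := contDiff_infty_iff_deriv.1 hf
  have h := integral_deriv_mul_eq_sub (a := 0) (b := 2 * π) (u := f) (v := expI (-m))
    (u' := deriv f) (v' := fun x => ((-m : ℤ) : ℂ) * Complex.I * expI (-m) x)
    (fun x _ => (hf'.1 x).hasDerivAt) (fun x _ => expI_hasDerivAt _ x)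
    (hf'.2.continuous.intervalIntegrable _ _)
    ((continuous_const.mul (expI_continuous _)).intervalIntegrable _ _)
  rw [expI_two_pi, expI_zero, show f (2 * π) = f 0 by simpa using hp 0, sub_self,
    integral_add] at h
  · rw [← integral_const_mul, eq_neg_of_add_eq_zero_left h, ← integral_neg]
    refine integral_congr fun x _ => ?_
    push_cast
    ring
  · exact (hf'.2.continuous.mul (expI_continuous _)).intervalIntegrable _ _
  · exact (hf.continuous.mul (continuous_const.mul (expI_continuous _))).intervalIntegrable _ _

theorem periodic_deriv {f : ℝ → ℂ} {c : ℝ} (hp : Function.Periodic f c) :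
    Function.Periodic (deriv f) c := fun x => by
  rw [← deriv_comp_add_const]
  exact congrArg (deriv · x) (funext hp)

/-- Each integration by parts gains one factor `m`. The induction must range over all `f`, as it
passes to the derivative. -/
theorem exists_bound_integral_mul_expI (s : ℕ) : ∀ {f : ℝ → ℂ}, ContDiff ℝ ∞ f →
    Function.Periodic f (2 * π) →
    ∃ K : ℝ, ∀ m : ℤ, |(m : ℝ)| ^ s * ‖∫ x in (0 : ℝ)..(2 * π), f x * expI (-m) x‖ ≤ K := by
  induction s with
  | zero =>
    intro f hf hp
    obtain ⟨B, hB⟩ := isCompact_uIcc.exists_bound_of_continuousOn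
      (s := Set.uIcc 0 (2 * π)) hf.continuous.continuousOn
    refine ⟨B * |2 * π - 0|, fun m => ?_⟩
    rw [pow_zero, one_mul]
    refine norm_integral_le_of_norm_le_const fun x hx => ?_
    rw [norm_mul, norm_expI, mul_one]
    exact hB x (Set.uIoc_subset_uIcc hx)
  | succ s ih =>
    intro f hf hp
    obtain ⟨K, hK⟩ := ih (contDiff_infty_iff_deriv.1 hf).2 (periodic_deriv hp)
    refine ⟨K, fun m => (le_of_eq ?_).trans (hK m)⟩
    rw [integral_deriv_mul_expI hf hp, norm_mul, norm_mul, Complex.norm_I, mul_one,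
      Complex.norm_intCast, pow_succ]
    ring

/-- The coefficients of the cosine expansion of an even function. -/
noncomputable def cosCoeff (f : ℝ → ℝ) (m : ℤ) : ℝ :=
  (2 * π)⁻¹ * ∫ x in (0 : ℝ)..(2 * π), f x * Real.cos (m * x)

theorem cosCoeff_neg (f : ℝ → ℝ) (m : ℤ) : cosCoeff f (-m) = cosCoeff f m := by
  simp [cosCoeff]

variable {f g : ℝ → ℝ}

/-- For even `f` the sine integral changes sign under x ↦ 2π - x and hence vanishes, so the cosine
coefficients are the exponential ones. -/
theorem ofReal_cosCoeff (hf : Continuous f) (he : ∀ x, f (-x) = f x)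
    (hp : Function.Periodic f (2 * π)) (m : ℤ) :
    (cosCoeff f m : ℂ) = (2 * (π : ℂ))⁻¹ * ∫ x in (0 : ℝ)..(2 * π), (f x : ℂ) * expI m x := by
  have h0 : ∫ x in (0 : ℝ)..(2 * π), f x * Real.sin (m * x) = 0 := by
    have h := integral_comp_sub_left (a := 0) (b := 2 * π)
      (fun x => f x * Real.sin (m * x)) (2 * π)
    rw [sub_self, sub_zero] at h
    have h1 : ∀ x, f (2 * π - x) * Real.sin (m * (2 * π - x)) = -(f x * Real.sin (m * x)) := by
      intro x
      rw [show 2 * π - x = -x + 2 * π by ring, hp, he, mul_add, mul_neg,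
        Real.sin_add_int_mul_two_pi, Real.sin_neg, mul_neg]
    simp only [h1, integral_neg] at h
    linarith
  have h2 : ∀ x : ℝ, (f x : ℂ) * expI m x =
      ((f x * Real.cos (m * x) : ℝ) : ℂ) + ((f x * Real.sin (m * x) : ℝ) : ℂ) * Complex.I := by
    intro x
    rw [expI, show (m : ℂ) * Complex.I * x = ((m * x : ℝ) : ℂ) * Complex.I by push_cast; ring,
      Complex.exp_mul_I, ← Complex.ofReal_cos, ← Complex.ofReal_sin]
    push_cast
    ring
  simp only [h2]
  rw [integral_add, integral_mul_const, integral_ofReal, integral_ofReal, h0, cosCoeff]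
  · push_cast
    ring
  · exact (Complex.continuous_ofReal.comp (hf.mul (by fun_prop))).intervalIntegrable _ _
  · exact ((Complex.continuous_ofReal.comp (hf.mul (by fun_prop))).mul
      continuous_const).intervalIntegrable _ _

theorem cosCoeff_rapid (hf : ContDiff ℝ ∞ f) (he : ∀ x, f (-x) = f x)
    (hp : Function.Periodic f (2 * π)) (s : ℕ) :
    ∃ K : ℝ, ∀ m : ℤ, (1 + |(m : ℝ)|) ^ s * |cosCoeff f m| ≤ K := by
  have hf' : ContDiff ℝ ∞ fun x => (f x : ℂ) := Complex.ofRealCLM.contDiff.comp hf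
  have hp' : Function.Periodic (fun x => (f x : ℂ)) (2 * π) := fun x => by simp only [hp x]
  have hb : ∀ t : ℕ, ∃ K : ℝ, ∀ m : ℤ, |(m : ℝ)| ^ t * |cosCoeff f m| ≤ K := by
    intro t
    obtain ⟨K, hK⟩ := exists_bound_integral_mul_expI t hf' hp'
    refine ⟨(2 * π)⁻¹ * K, fun m => ?_⟩
    have h1 : |cosCoeff f m| =
        (2 * π)⁻¹ * ‖∫ x in (0 : ℝ)..(2 * π), (f x : ℂ) * expI (-m) x‖ := by
      rw [← cosCoeff_neg, ← Real.norm_eq_abs, ← Complex.norm_real,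
        ofReal_cosCoeff hf.continuous he hp, norm_mul]
      congr 1
      rw [norm_inv, norm_mul, Complex.norm_real, Real.norm_of_nonneg pi_pos.le]
      simp
    rw [h1, mul_left_comm]
    exact mul_le_mul_of_nonneg_left (hK m) (by positivity)
  obtain ⟨K₀, h₀⟩ := hb 0
  obtain ⟨K, hK⟩ := hb s
  refine ⟨2 ^ s * (K₀ + K), fun m => ?_⟩
  have h1 : (1 + |(m : ℝ)|) ^ s ≤ 2 ^ s * (1 + |(m : ℝ)| ^ s) := by
    rcases le_total |(m : ℝ)| 1 with h | h
    · calc (1 + |(m : ℝ)|) ^ s ≤ 2 ^ s := pow_le_pow_left₀ (by positivity) (by linarith) s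
        _ ≤ _ := le_mul_of_one_le_right (by positivity) (by
          have : 0 ≤ |(m : ℝ)| ^ s := by positivity
          linarith)
    · calc (1 + |(m : ℝ)|) ^ s ≤ (2 * |(m : ℝ)|) ^ s :=
            pow_le_pow_left₀ (by positivity) (by linarith) s
        _ ≤ _ := by rw [mul_pow]; exact mul_le_mul_of_nonneg_left (by linarith) (by positivity)
  have h2 := h₀ m
  rw [pow_zero] at h2
  calc _ ≤ 2 ^ s * (1 + |(m : ℝ)| ^ s) * |cosCoeff f m| :=
        mul_le_mul_of_nonneg_right h1 (abs_nonneg _)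
    _ = 2 ^ s * (1 * |cosCoeff f m| + |(m : ℝ)| ^ s * |cosCoeff f m|) := by ring
    _ ≤ _ := mul_le_mul_of_nonneg_left (add_le_add h2 (hK m)) (by positivity)

theorem summable_cosCoeff (hf : ContDiff ℝ ∞ f) (he : ∀ x, f (-x) = f x)
    (hp : Function.Periodic f (2 * π)) : Summable fun m => |cosCoeff f m| := by
  obtain ⟨K, hK⟩ := cosCoeff_rapid hf he hp 2
  refine Summable.of_nonneg_of_le (fun m => abs_nonneg _) (fun m => ?_)
    (summable_one_add_abs_inv_sq.mul_left K)
  rw [← div_eq_mul_inv, le_div_iff₀ (by positivity), mul_comm]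
  exact hK m

theorem hasSum_cosCoeff_mul_expI (hf : ContDiff ℝ ∞ f) (he : ∀ x, f (-x) = f x)
    (hp : Function.Periodic f (2 * π)) (x : ℝ) :
    HasSum (fun m => (cosCoeff f m : ℂ) * expI m x) (f x : ℂ) := by
  have : Fact (0 < 2 * π) := ⟨two_pi_pos⟩
  have hp' : Function.Periodic (fun x => (f x : ℂ)) (2 * π) := fun x => by simp only [hp x]
  let F : C(AddCircle (2 * π), ℂ) := ⟨hp'.lift,
    (Complex.continuous_ofReal.comp hf.continuous).quotient_lift _⟩
  have hexp : ∀ (n : ℤ) (x : ℝ), fourier n (x : AddCircle (2 * π)) = expI n x := by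
    intro n x
    rw [fourier_coe_apply, expI]
    congr 1
    have : (π : ℂ) ≠ 0 := by exact_mod_cast pi_ne_zero
    push_cast
    field_simp
  have hc : ∀ m, fourierCoeff F m = (cosCoeff f m : ℂ) := by
    intro m
    rw [fourierCoeff_eq_intervalIntegral F m 0, ← cosCoeff_neg, ofReal_cosCoeff hf.continuous he hp,
      zero_add, Complex.real_smul]
    congr 1
    · push_cast; ring
    · refine integral_congr fun x _ => ?_
      simp only [hexp, smul_eq_mul]
      exact mul_comm _ _
  have hs : Summable (fourierCoeff F) := by
    refine Summable.of_norm ?_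
    simp only [hc, Complex.norm_real, Real.norm_eq_abs]
    exact summable_cosCoeff hf he hp
  have := has_pointwise_sum_fourier_series_of_summable hs (x : AddCircle (2 * π))
  simp only [hc, hexp, smul_eq_mul] at this
  exact this

/-- Expand `g` in ∫ f g e^{-imx} = ∫ e^{-imx} and integrate termwise. Summability of the
coefficients of `g` and boundedness of `f` dominate the series. Reciprocal functions thus give
inverse Toeplitz matrices. -/
theorem hasSum_cosCoeff_mul_cosCoeff (hf : ContDiff ℝ ∞ f) (hfe : ∀ x, f (-x) = f x)
    (hfp : Function.Periodic f (2 * π)) (hg : ContDiff ℝ ∞ g) (hge : ∀ x, g (-x) = g x)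
    (hgp : Function.Periodic g (2 * π)) (hfg : ∀ x, f x * g x = 1) (m : ℤ) :
    HasSum (fun k => cosCoeff f (m - k) * cosCoeff g k) (if m = 0 then 1 else 0) := by
  have hcf : Continuous fun x => (f x : ℂ) := Complex.continuous_ofReal.comp hf.continuous
  obtain ⟨B, hB⟩ := isCompact_uIcc.exists_bound_of_continuousOn
    (s := Set.uIcc 0 (2 * π)) hf.continuous.continuousOn
  have h := intervalIntegral.hasSum_integral_of_dominated_convergence (μ := MeasureTheory.volume) (a := 0)
    (b := 2 * π)
    (F := fun (k : ℤ) x => (cosCoeff g k : ℂ) * (f x * expI (k - m) x))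
    (f := fun x => expI (-m) x) (fun k _ => |cosCoeff g k| * B) (fun k => ?_) (fun k => ?_) ?_ ?_ ?_
  · rw [integral_expI] at h
    have h2 : ∀ k : ℤ, (2 * (π : ℂ))⁻¹ * ∫ x in (0 : ℝ)..(2 * π),
        (cosCoeff g k : ℂ) * (f x * expI (k - m) x) =
        ((cosCoeff f (m - k) * cosCoeff g k : ℝ) : ℂ) := by
      intro k
      rw [integral_const_mul, mul_left_comm, ← ofReal_cosCoeff hf.continuous hfe hfp,
        ← cosCoeff_neg f, neg_sub]
      push_cast
      ring
    have h3 := h.mul_left (2 * (π : ℂ))⁻¹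
    simp only [h2] at h3
    rw [← Complex.hasSum_ofReal]
    have : (π : ℂ) ≠ 0 := by exact_mod_cast pi_ne_zero
    have h4 : (2 * (π : ℂ))⁻¹ * (if -m = 0 then 2 * (π : ℂ) else 0) =
        ((if m = 0 then 1 else 0 : ℝ) : ℂ) := by
      by_cases hm : m = 0
      · simp only [hm, neg_zero, if_true, Complex.ofReal_one]
        field_simp
      · simp [hm]
    rwa [h4] at h3
  · exact (continuous_const.mul (hcf.mul (expI_continuous _))).aestronglyMeasurable
  · refine Eventually.of_forall fun x hx => ?_
    rw [norm_mul, norm_mul, norm_expI, mul_one, Complex.norm_real, Complex.norm_real,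
      Real.norm_eq_abs]
    exact mul_le_mul_of_nonneg_left (hB x (Set.uIoc_subset_uIcc hx)) (abs_nonneg _)
  · exact Eventually.of_forall fun x _ => (summable_cosCoeff hg hge hgp).mul_right B
  · exact continuous_const.intervalIntegrable _ _
  · refine Eventually.of_forall fun x _ => ?_
    have h := (hasSum_cosCoeff_mul_expI hg hge hgp x).mul_right ((f x : ℂ) * expI (-m) x)
    have h1 : (g x : ℂ) * (f x * expI (-m) x) = expI (-m) x := by
      rw [← mul_assoc, ← Complex.ofReal_mul, mul_comm (g x), hfg, Complex.ofReal_one, one_mul]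
    rw [h1] at h
    refine HasSum.congr_fun h fun k => ?_
    rw [sub_eq_add_neg, ← expI_mul]
    ring

end Fourier

/-! ### Powers of ω and their coefficients. -/

section Omega

open Real
open scoped ContDiff

theorem omega_pos {θ : ℝ} (hθ : Real.cos θ ≠ 0) (x : ℝ) : 0 < omega x θ := by
  have h1 : 0 < Real.cos θ ^ 2 := by positivity
  have h2 := Real.sin_sq_add_cos_sq θ
  have h3 := Real.sin_sq_add_cos_sq x
  -- ω is |e^{ix} - sin θ|², and it vanishes only if sin x = 0 and sin θ = cos x = ±1.
  have h4 : omega x θ = (Real.cos x - Real.sin θ) ^ 2 + Real.sin x ^ 2 := by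
    rw [omega]; linear_combination -h3
  rw [h4]
  by_contra h
  have h5 : Real.cos x - Real.sin θ = 0 := by nlinarith [sq_nonneg (Real.cos x - Real.sin θ), sq_nonneg (Real.sin x)]
  have h6 : Real.sin x ^ 2 ≤ 0 := by nlinarith [sq_nonneg (Real.cos x - Real.sin θ)]
  nlinarith

/-- The functions `ω(x, θ)^α`. -/
noncomputable def omegaPow (α θ x : ℝ) : ℝ := omega x θ ^ α

theorem omegaPow_even (α θ x : ℝ) : omegaPow α θ (-x) = omegaPow α θ x := by
  simp [omegaPow, omega]

theorem omegaPow_periodic (α θ : ℝ) : Function.Periodic (omegaPow α θ) (2 * π) := fun x => by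
  simp [omegaPow, omega]

theorem omegaPow_contDiff {θ : ℝ} (hθ : Real.cos θ ≠ 0) (α : ℝ) :
    ContDiff ℝ ∞ (omegaPow α θ) := by
  refine ContDiff.rpow_const_of_ne ?_ fun x => (omega_pos hθ x).ne'
  unfold omega
  fun_prop

theorem omegaPow_mul_neg {θ : ℝ} (hθ : Real.cos θ ≠ 0) (α x : ℝ) :
    omegaPow α θ x * omegaPow (-α) θ x = 1 := by
  rw [omegaPow, omegaPow, ← Real.rpow_add (omega_pos hθ x), add_neg_cancel, Real.rpow_zero]

/-- The Fourier coefficients of `ω(x, θ)^α`. -/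
noncomputable def powCoeff (α θ : ℝ) (m : ℤ) : ℝ := cosCoeff (omegaPow α θ) m

theorem powCoeff_neg (α θ : ℝ) (m : ℤ) : powCoeff α θ (-m) = powCoeff α θ m := cosCoeff_neg _ _

theorem powCoeff_rapid {θ : ℝ} (hθ : Real.cos θ ≠ 0) (α : ℝ) (s : ℕ) :
    ∃ K : ℝ, ∀ m : ℤ, (1 + |(m : ℝ)|) ^ s * |powCoeff α θ m| ≤ K :=
  cosCoeff_rapid (omegaPow_contDiff hθ α) (omegaPow_even α θ) (omegaPow_periodic α θ) s

theorem hasSum_powCoeff {θ : ℝ} (hθ : Real.cos θ ≠ 0) (α : ℝ) (m : ℤ) :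
    HasSum (fun k => powCoeff α θ (m - k) * powCoeff (-α) θ k) (if m = 0 then 1 else 0) :=
  hasSum_cosCoeff_mul_cosCoeff (omegaPow_contDiff hθ α) (omegaPow_even α θ) (omegaPow_periodic α θ)
    (omegaPow_contDiff hθ _) (omegaPow_even _ θ) (omegaPow_periodic _ θ) (omegaPow_mul_neg hθ α) m

end Omega

end CyclicLoop

/-! ### Matrices with real coefficients on the terms of a series. -/

namespace CyclicLoop

theorem exists_bound_pow_mul_geometric {r : ℝ} (hr : |r| < 1) (s : ℕ) :
    ∃ K : ℝ, ∀ t : ℕ, (1 + 2 * (t : ℝ)) ^ s * |r| ^ t ≤ K := by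
  have h1 := tendsto_pow_const_mul_const_pow_of_abs_lt_one s (r := |r|) (by rwa [abs_abs])
  obtain ⟨K, hK⟩ := h1.bddAbove_range
  refine ⟨3 ^ s * (K + 1), fun t => ?_⟩
  have h2 : (t : ℝ) ^ s * |r| ^ t ≤ K := hK ⟨t, rfl⟩
  have h3 : |r| ^ t ≤ 1 := pow_le_one₀ (abs_nonneg _) hr.le
  have h4 : (1 + 2 * (t : ℝ)) ^ s ≤ 3 ^ s * ((t : ℝ) ^ s + 1) := by
    have ht : (0 : ℝ) ≤ (t : ℝ) ^ s := by positivity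
    rcases Nat.eq_zero_or_pos t with rfl | h
    · simp only [Nat.cast_zero, mul_zero, add_zero, one_pow]
      exact one_le_mul_of_one_le_of_one_le (one_le_pow₀ (by norm_num)) (le_add_of_nonneg_left (by positivity))
    · have : (1 : ℝ) ≤ t := by exact_mod_cast h
      calc (1 + 2 * (t : ℝ)) ^ s ≤ (3 * (t : ℝ)) ^ s :=
            pow_le_pow_left₀ (by positivity) (by linarith) s
        _ ≤ _ := by rw [mul_pow]; exact mul_le_mul_of_nonneg_left (by linarith) (by positivity)
  calc _ ≤ 3 ^ s * ((t : ℝ) ^ s + 1) * |r| ^ t := mul_le_mul_of_nonneg_right h4 (by positivity)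
    _ = 3 ^ s * ((t : ℝ) ^ s * |r| ^ t + |r| ^ t) := by ring
    _ ≤ _ := mul_le_mul_of_nonneg_left (add_le_add h2 h3) (by positivity)

namespace CyclicExtension

variable {C : Type*} [Ring C] [Algebra ℝ C] [UniformSpace C] (E : CyclicExtension C)
variable {i j k l c d e f : ZMod 2}

/-- The matrix with rotated entries `∑ M x n m • a x`, where `x` runs over parities and degrees. -/
noncomputable def famMat (M : Dih → Idx i → Idx j → ℝ) (a : Series C) : Mat C i j :=
  fun n m ε p => E.zp (-n.1) * (M ⟨ε, p + n.1 - sg ε * m.1⟩ n m • a ε (p + n.1 - sg ε * m.1)) *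
    E.zp m.1

/-- The matrix whose rotation is a real matrix. -/
noncomputable def realMat (A : Idx i → Idx i → ℝ) : Mat C i i := E.famMat (fun _ => A) (oneS i)

theorem ro_famMat (M : Dih → Idx i → Idx j → ℝ) (a : Series C) (n : Idx i) (m : Idx j) (x : Dih) :
    E.ro (E.famMat M a) n m x = M x n m • a x.ε x.p := by
  have h : x.p - n.1 + sg x.ε * m.1 + n.1 - sg x.ε * m.1 = x.p := by ring
  simp only [ro_apply, famMat, mul_assoc, zp_mul_zp_neg_mul, zp_mul_zp_neg, mul_one, h]

variable {E}

theorem famMat_congr {M M' : Dih → Idx i → Idx j → ℝ} {a : Series C}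
    (h : ∀ x : Dih, a x.ε x.p ≠ 0 → ∀ n m, M x n m = M' x n m) : E.famMat M a = E.famMat M' a := by
  refine E.ro_injective fun n m x => ?_
  rw [ro_famMat, ro_famMat]
  by_cases hx : a x.ε x.p = 0
  · rw [hx, smul_zero, smul_zero]
  · rw [h x hx]

theorem oneS_apply (c : ZMod 2) (x : Dih) :
    (oneS c : Series C) x.ε x.p = if x = 1 then idem c else 0 := by
  simp only [oneS, mono, Dih.ext_iff, Dih.one_ε, Dih.one_p]

theorem ro_realMat (A : Idx i → Idx i → ℝ) (n m : Idx i) (x : Dih) :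
    E.ro (E.realMat A) n m x = if x = 1 then A n m • idem i else 0 := by
  rw [realMat, ro_famMat, oneS_apply]
  split_ifs <;> simp

theorem idem_mem_term (i : ZMod 2) : (idem i : Half C) ∈ E.term i i 1 := by
  obtain ⟨t, ht⟩ := ZMod.intCast_surjective i
  rw [E.mem_term_iff (t := t) ht (by simp [add_self_two])]
  refine ⟨1, E.one_mem, ?_⟩
  have : (Matrix.single 0 0 1 : Half C) = idem 0 := rfl
  simp [this, zp_mul_idem, mul_assoc, ht]

theorem tameLoop_realMat {A : Idx i → Idx i → ℝ}
    (hA : ∀ s : ℕ, ∃ K : ℝ, ∀ n m, (1 + diagWeight n.1 m.1) ^ s * |A n m| ≤ K) :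
    E.TameLoop 0 0 (E.realMat A) where
  mem n m x := by
    rw [ro_realMat, zero_add]
    split_ifs with h
    · rw [h]; exact Submodule.smul_mem _ _ (idem_mem_term i)
    · exact zero_mem _
  tame q hq s := by
    obtain ⟨K, hK⟩ := hA s
    refine ⟨K * q (idem i), fun n m x => ?_⟩
    have h0 := diagWeight_nonneg n.1 m.1
    have h1 : 0 ≤ K := (by positivity : (0 : ℝ) ≤ _).trans (hK n m)
    rw [ro_realMat]
    split_ifs with h
    · rw [h, map_smul_eq_mul, Real.norm_eq_abs, ← mul_assoc]
      refine mul_le_mul_of_nonneg_right ?_ (apply_nonneg _ _)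
      simpa using hK n m
    · rw [map_zero, mul_zero]
      exact mul_nonneg h1 (apply_nonneg _ _)

variable [IsTopologicalRing C]

theorem famMat_mem {M : Dih → Idx i → Idx j → ℝ} {a : Series C} (ha : E.IsLoop (c + i) (d + j) a)
    (n : Idx i) (m : Idx j) (x : Dih) :
    E.ro (E.famMat M a) n m x ∈ E.term (c + i) (d + j) x := by
  rw [ro_famMat]
  exact Submodule.smul_mem _ _ (E.isLoop_mem_term ha x)

/-- If the coefficients are bounded and, where nonzero, the weight of the entry is at most linear in
the degree, then the rapid decrease of `a` in the degree becomes decrease of the matrix in its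
indices. -/
theorem decays_famMat {κ : ℤ → ℤ → ℝ} (hκ : ∀ n m, 0 ≤ κ n m) {M : Dih → Idx i → Idx j → ℝ}
    {a : Series C} (ha : E.IsLoop (c + i) (d + j) a) {R B : ℝ} (hR : ∀ x n m, |M x n m| ≤ R)
    (hM : ∀ x : Dih, (x.p : ZMod 2) = (c + i) + (d + j) →
      ∀ n m, M x n m ≠ 0 → 1 + κ n.1 m.1 ≤ B * (1 + |(x.p : ℝ)|)) :
    E.Decays κ (E.famMat M a) := by
  refine Decays.of_series hκ ha.rapid (M := B + 1) (R := R) fun n m x => ?_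
  rw [ro_famMat]
  by_cases hp : (x.p : ZMod 2) = (c + i) + (d + j)
  swap
  · exact Or.inl (by rw [ha.eq_zero _ _ hp, smul_zero])
  by_cases h : M x n m = 0
  · exact Or.inl (by rw [h, zero_smul])
  · refine Or.inr ⟨M x n m, 0, 0, x, hR x n m, by simp, by simp, ?_, by simp⟩
    have := hM x hp n m h
    nlinarith

theorem tameLoop_famMat {M : Dih → Idx i → Idx j → ℝ} {a : Series C}
    (ha : E.IsLoop (c + i) (d + j) a) {R B : ℝ} (hR : ∀ x n m, |M x n m| ≤ R)
    (hM : ∀ x : Dih, (x.p : ZMod 2) = (c + i) + (d + j) →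
      ∀ n m, M x n m ≠ 0 → 1 + diagWeight n.1 m.1 ≤ B * (1 + |(x.p : ℝ)|)) :
    E.TameLoop c d (E.famMat M a) :=
  ⟨famMat_mem ha, decays_famMat diagWeight_nonneg ha hR hM⟩

variable [IsUniformAddGroup C] [ContinuousSMul ℝ C] [LocallyConvexSpace ℝ C] [T2Space C]

/-- `realMat B` is concentrated at the identity of the group, so the convolution does not mix
labels. For each label it is an ordinary product of real matrices, and identities between such
products reduce to real sums. -/
theorem famMat_mul_realMat (hE : E.SeqComplete) {M M' : Dih → Idx i → Idx j → ℝ} {a : Series C}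
    {B : Idx j → Idx j → ℝ} (ha : E.IsLoop (c + i) j a) (hM : E.TameLoop c 0 (E.famMat M a))
    (hB : E.TameLoop 0 0 (E.realMat B)) (h : ∀ x : Dih, a x.ε x.p ≠ 0 →
      ∀ n m, HasSum (fun l => M x n l * B l m) (M' x n m)) :
    E.famMat M a ⬝ E.realMat B = E.famMat M' a := by
  refine E.ro_injective fun n m x => ?_
  have hinj : Function.Injective fun l : Idx j => (l, x) := fun l l' h => (Prod.mk.inj h).1
  rw [ro_mulM hE hM hB, ro_famMat, ← hinj.tsum_eq]
  · have hx : ∀ l, E.flat (E.famMat M a) (E.realMat B) n m x (l, x) =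
        (M x n l * B l m) • a x.ε x.p := by
      intro l
      have := (E.term_eq_single (E.isLoop_mem_term ha x)).2
      rw [flat, ro_famMat, ro_realMat, inv_mul_cancel, if_pos rfl, smul_mul_smul_comm, this]
    simp only [hx]
    by_cases h0 : a x.ε x.p = 0
    · simp [h0]
    · exact ((h x h0 n m).smul_const _).tsum_eq
  · rintro ⟨l, y⟩ hy
    by_contra hxy
    refine hy ?_
    rw [flat, ro_realMat, if_neg, mul_zero]
    intro h1
    exact hxy ⟨l, Prod.ext rfl (inv_mul_eq_one.1 h1).symm⟩

theorem realMat_mul_famMat (hE : E.SeqComplete) {M M' : Dih → Idx i → Idx j → ℝ} {a : Series C}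
    {A : Idx i → Idx i → ℝ} (ha : E.IsLoop i (d + j) a) (hM : E.TameLoop 0 d (E.famMat M a))
    (hA : E.TameLoop 0 0 (E.realMat A)) (h : ∀ x : Dih, a x.ε x.p ≠ 0 →
      ∀ n m, HasSum (fun l => A n l * M x l m) (M' x n m)) :
    E.realMat A ⬝ E.famMat M a = E.famMat M' a := by
  refine E.ro_injective fun n m x => ?_
  have hinj : Function.Injective fun l : Idx i => (l, (1 : Dih)) := fun l l' h => (Prod.mk.inj h).1
  rw [ro_mulM hE hA hM, ro_famMat, ← hinj.tsum_eq]
  · have hx : ∀ l, E.flat (E.realMat A) (E.famMat M a) n m x (l, 1) =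
        (A n l * M x l m) • a x.ε x.p := by
      intro l
      have := (E.term_eq_single (E.isLoop_mem_term ha x)).1
      rw [flat, ro_realMat, if_pos rfl, inv_one, one_mul, ro_famMat, smul_mul_smul_comm, this]
    simp only [hx]
    by_cases h0 : a x.ε x.p = 0
    · simp [h0]
    · exact ((h x h0 n m).smul_const _).tsum_eq
  · rintro ⟨l, y⟩ hy
    by_contra hxy
    refine hy ?_
    rw [flat, ro_realMat, if_neg, zero_mul]
    rintro rfl
    exact hxy ⟨l, rfl⟩

theorem isLoop_oneS (i : ZMod 2) : E.IsLoop i i (oneS i) := by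
  refine E.isLoop_of_mem_term (fun x => ?_) fun q _ s => rapid_mono _ _ _ q s
  rw [oneS_apply]
  split_ifs with h
  · rw [h]; exact idem_mem_term i
  · exact zero_mem _

theorem realMat_mul_realMat (hE : E.SeqComplete) {A B P : Idx i → Idx i → ℝ}
    (hA : E.TameLoop 0 0 (E.realMat A)) (hB : E.TameLoop 0 0 (E.realMat B))
    (h : ∀ n m, HasSum (fun l => A n l * B l m) (P n m)) :
    E.realMat A ⬝ E.realMat B = E.realMat P :=
  famMat_mul_realMat hE (c := 0) (by rw [zero_add]; exact isLoop_oneS i) hA hB fun _ _ => h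

theorem realMat_one : E.realMat (fun n m : Idx i => if n = m then 1 else 0) = oneM 0 i := by
  refine E.ro_injective fun n m x => ?_
  rw [ro_realMat, ro_oneM, zero_add]
  by_cases h1 : n = m <;> by_cases h2 : x = 1 <;> simp [h1, h2]

end CyclicExtension

/-! ### The Toeplitz matrices and the matrices F(θ). -/

section RealMatrices

/-- The Toeplitz matrices of `ω(x, θ)^α`. -/
noncomputable def toepMat (i : ZMod 2) (α θ : ℝ) (n m : Idx i) : ℝ :=
  powCoeff α θ ((n.1 - m.1) / 2)

theorem Idx.even_sub {i : ZMod 2} (n m : Idx i) : ∃ u : ℤ, n.1 = m.1 + 2 * u :=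
  (zmod_two_cast_eq_iff _ _).1 (m.2.trans n.2.symm)

/-- The indices congruent to a given one. -/
def Idx.shiftEquiv {i : ZMod 2} (m : Idx i) : ℤ ≃ Idx i where
  toFun u := ⟨m.1 + 2 * u, by push_cast; rw [m.2, show (2 : ZMod 2) = 0 from rfl]; ring⟩
  invFun n := (n.1 - m.1) / 2
  left_inv u := by simp
  right_inv n := by
    obtain ⟨u, hu⟩ := n.even_sub m
    ext
    simp [hu]

theorem hasSum_toepMat {θ : ℝ} (hθ : Real.cos θ ≠ 0) (i : ZMod 2) (α : ℝ) (n m : Idx i) :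
    HasSum (fun l => toepMat i α θ n l * toepMat i (-α) θ l m) (if n = m then 1 else 0) := by
  rw [← m.shiftEquiv.hasSum_iff]
  obtain ⟨u, hu⟩ := n.even_sub m
  have h := hasSum_powCoeff hθ α u
  have h1 : (n = m) ↔ (u = 0) := by
    rw [Subtype.ext_iff]; omega
  simp only [h1]
  refine h.congr_fun fun t => ?_
  simp only [Function.comp, toepMat, Idx.shiftEquiv, Equiv.coe_fn_mk]
  congr 2 <;> omega

theorem toepMat_rapid {θ : ℝ} (hθ : Real.cos θ ≠ 0) (i : ZMod 2) (α : ℝ) (s : ℕ) :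
    ∃ K : ℝ, ∀ n m : Idx i,
      (1 + CyclicExtension.diagWeight n.1 m.1) ^ s * |toepMat i α θ n m| ≤ K := by
  obtain ⟨K, hK⟩ := powCoeff_rapid hθ α s
  refine ⟨2 ^ s * K, fun n m => ?_⟩
  obtain ⟨u, hu⟩ := n.even_sub m
  have h0 := CyclicExtension.diagWeight_nonneg n.1 m.1
  have h1 : toepMat i α θ n m = powCoeff α θ u := by
    rw [toepMat]; congr 1; omega
  have h2 : CyclicExtension.diagWeight n.1 m.1 ≤ 2 * |(u : ℝ)| := by
    refine (abs_abs_sub_abs_le_abs_sub _ _).trans (le_of_eq ?_)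
    rw [hu]; push_cast
    rw [add_sub_cancel_left, abs_mul, abs_two]
  rw [h1]
  refine le_trans ?_ (mul_le_mul_of_nonneg_left (hK u) (by positivity))
  rw [← mul_assoc, ← mul_pow]
  exact mul_le_mul_of_nonneg_right (pow_le_pow_left₀ (by positivity) (by linarith) s)
    (abs_nonneg _)

/-- The matrices `F(θ)`. -/
noncomputable def fMat (i : ZMod 2) (θ : ℝ) (n m : Idx i) : ℝ := Fmat θ n.1 m.1

theorem hasSum_single_index {i : ZMod 2} {a : ℤ} (ha : (a : ZMod 2) = i) (v : ℤ → ℝ) (r : ℝ) :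
    HasSum (fun l : Idx i => (if l.1 = a then r else 0) * v l.1) (r * v a) := by
  have h := hasSum_ite_eq (⟨a, ha⟩ : Idx i) (r * v a)
  refine h.congr_fun fun l => ?_
  by_cases hl : l.1 = a
  · rw [if_pos hl, if_pos (Subtype.ext hl), hl]
  · rw [if_neg hl, if_neg (fun h => hl (by rw [h])), zero_mul]

theorem cast_sub_two_sign {i : ZMod 2} {n : ℤ} (hn : (n : ZMod 2) = i) (u : ℤ) :
    ((n + 2 * u : ℤ) : ZMod 2) = i := by
  push_cast; rw [hn, show (2 : ZMod 2) = 0 from rfl]; ring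

theorem cast_neg_index {i : ZMod 2} {n : ℤ} (hn : (n : ZMod 2) = i) : ((-n : ℤ) : ZMod 2) = i := by
  push_cast; rw [hn, neg_two]

theorem hasSum_fMat_mul {i : ZMod 2} (θ : ℝ) (n : Idx i) (v : ℤ → ℝ) :
    HasSum (fun l : Idx i => fMat i θ n l * v l.1)
      (if n.1 = 0 then Real.cos θ * v 0 else if n.1 = 1 ∨ n.1 = -1 then
        Real.cos (θ / 2) * v n.1 + -Real.sin (θ / 2) * v (-n.1)
        else 1 * v n.1 + -Real.sin θ * v (n.1 - 2 * n.1.sign)) := by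
  obtain ⟨n, hn⟩ := n
  simp only [fMat, Fmat]
  split_ifs with h0 h1
  · subst h0
    exact hasSum_single_index hn v _
  · refine ((hasSum_single_index hn v _).add
      (hasSum_single_index (cast_neg_index hn) v _)).congr_fun fun l => ?_
    by_cases h2 : l.1 = n
    · rw [if_pos h2, if_pos h2, if_neg (by omega), zero_mul, add_zero]
    · rw [if_neg h2, if_neg h2, zero_mul, zero_add]
  · have hs : ((n - 2 * n.sign : ℤ) : ZMod 2) = i := by
      have := cast_sub_two_sign hn (-n.sign)
      rwa [mul_neg, ← sub_eq_add_neg] at this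
    refine ((hasSum_single_index hn v _).add (hasSum_single_index hs v _)).congr_fun fun l => ?_
    have : n.sign ≠ 0 := by rw [Ne, Int.sign_eq_zero_iff_zero]; exact h0
    by_cases h2 : l.1 = n
    · rw [if_pos h2, if_pos h2, if_neg (by omega), zero_mul, add_zero]
    · rw [if_neg h2, if_neg h2, zero_mul, zero_add]

/-- Column k of F meets row k, the next row outwards k + 2 sgn k, and, for k = ±1, also row -k. -/
theorem hasSum_mul_fMat (θ : ℝ) (k : Idx 1) (v : ℤ → ℝ) :
    HasSum (fun l : Idx 1 => v l.1 * fMat 1 θ l k)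
      ((if k.1 = 1 ∨ k.1 = -1 then Real.cos (θ / 2) * v k.1 - Real.sin (θ / 2) * v (-k.1)
        else v k.1) - Real.sin θ * v (k.1 + 2 * k.1.sign)) := by
  obtain ⟨k, hk⟩ := k
  have hk0 : k ≠ 0 := by rintro rfl; exact absurd hk (by decide)
  change HasSum _ ((if k = 1 ∨ k = -1 then Real.cos (θ / 2) * v k - Real.sin (θ / 2) * v (-k)
    else v k) - Real.sin θ * v (k + 2 * k.sign))
  have hks : k.sign = 1 ∧ 0 < k ∨ k.sign = -1 ∧ k < 0 := by
    rcases lt_or_gt_of_ne hk0 with h | h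
    · exact Or.inr ⟨Int.sign_eq_neg_one_of_neg h, h⟩
    · exact Or.inl ⟨Int.sign_eq_one_of_pos h, h⟩
  have h3 := hasSum_single_index (cast_sub_two_sign hk k.sign) v (-Real.sin θ)
  have hodd : ∀ l : Idx 1, ∃ u, l.1 = 1 + 2 * u := fun l => l.even_sub ⟨1, by decide⟩
  obtain ⟨w, hw⟩ : ∃ u, k = 1 + 2 * u := hodd ⟨k, hk⟩
  have hl0 : ∀ l : Idx 1, l.1 ≠ 0 := by
    rintro ⟨l, hl⟩ (rfl : l = 0)
    exact absurd hl (by decide)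
  have hls : ∀ l : Idx 1, l.1.sign = 1 ∧ 0 < l.1 ∨ l.1.sign = -1 ∧ l.1 < 0 := by
    intro l
    rcases lt_or_gt_of_ne (hl0 l) with h | h
    · exact Or.inr ⟨Int.sign_eq_neg_one_of_neg h, h⟩
    · exact Or.inl ⟨Int.sign_eq_one_of_pos h, h⟩
  split_ifs with h1
  · have h := ((hasSum_single_index hk v (Real.cos (θ / 2))).add
      (hasSum_single_index (cast_neg_index hk) v (-Real.sin (θ / 2)))).add h3
    rw [show Real.cos (θ / 2) * v k - Real.sin (θ / 2) * v (-k) -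
      Real.sin θ * v (k + 2 * k.sign) = Real.cos (θ / 2) * v k + -Real.sin (θ / 2) * v (-k) +
      -Real.sin θ * v (k + 2 * k.sign) by ring]
    refine h.congr_fun fun l => ?_
    have e1 := hl0 l
    have e2 := hls l
    obtain ⟨u, hu⟩ := hodd l
    simp only [fMat, Fmat, if_neg e1]
    split_ifs <;> first | (exfalso; omega) | ring1
  · have h := (hasSum_single_index hk v 1).add h3
    rw [show v k - Real.sin θ * v (k + 2 * k.sign) = 1 * v k + -Real.sin θ * v (k + 2 * k.sign) by
      ring]
    refine h.congr_fun fun l => ?_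
    have e1 := hl0 l
    have e2 := hls l
    obtain ⟨u, hu⟩ := hodd l
    simp only [fMat, Fmat, if_neg e1]
    split_ifs <;> first | (exfalso; omega) | ring1

theorem fMat_rapid (i : ZMod 2) (θ : ℝ) (s : ℕ) : ∃ K : ℝ, ∀ n m : Idx i,
    (1 + CyclicExtension.diagWeight n.1 m.1) ^ s * |fMat i θ n m| ≤ K := by
  -- The entries are at most 1 in absolute value and vanish unless |n| and |m| differ by at most 2
  -- in doubled indices.
  refine ⟨3 ^ s, fun n m => ?_⟩
  have h0 := CyclicExtension.diagWeight_nonneg n.1 m.1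
  have h1 : |fMat i θ n m| ≤ 1 := by
    simp only [fMat, Fmat]
    split_ifs <;> simp [Real.abs_cos_le_one, Real.abs_sin_le_one]
  by_cases hz : fMat i θ n m = 0
  · rw [hz, abs_zero, mul_zero]; positivity
  have h2 : CyclicExtension.diagWeight n.1 m.1 ≤ 2 := by
    have h3 : m.1 = n.1 ∨ m.1 = -n.1 ∨ m.1 = n.1 - 2 * n.1.sign := by
      simp only [fMat, Fmat] at hz
      by_contra hcon
      push Not at hcon
      refine hz ?_
      split_ifs <;> first | rfl | (exfalso; omega)
    rw [CyclicExtension.diagWeight]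
    rcases h3 with h | h | h
    · rw [h, sub_self, abs_zero]; norm_num
    · rw [h]; push_cast; rw [abs_neg, sub_self, abs_zero]; norm_num
    · refine (abs_abs_sub_abs_le_abs_sub _ _).trans ?_
      have : |(n.1.sign : ℝ)| ≤ 1 := by
        rcases lt_trichotomy n.1 0 with h | h | h
        · rw [Int.sign_eq_neg_one_of_neg h]; simp
        · rw [h]; simp
        · rw [Int.sign_eq_one_of_pos h]; simp
      rw [h]; push_cast
      rw [sub_sub_cancel, abs_mul, abs_two]
      linarith
  calc _ ≤ (1 + CyclicExtension.diagWeight n.1 m.1) ^ s * 1 :=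
        mul_le_mul_of_nonneg_left h1 (by positivity)
    _ ≤ 3 ^ s := by rw [mul_one]; exact pow_le_pow_left₀ (by positivity) (by linarith) s

theorem hasSum_Dmat (i : ZMod 2) (θ : ℝ) (n m : Idx i) :
    HasSum (fun l => fMat i θ n l * toepMat i (-(1 / 2)) θ l m) (Dmat i θ n m) := by
  have h := hasSum_fMat_mul θ n (fun l => powCoeff (-(1 / 2)) θ ((l - m.1) / 2))
  have := h.summable.hasSum
  exact this

end RealMatrices

end CyclicLoop

/-! ### The inverse of F on the half-integers. -/

namespace CyclicLoop

section RealMatrices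

/-- `s^{t/2}` for even `t ≥ 0`, and `0` for `t < 0`. -/
noncomputable def geo (s : ℝ) (t : ℤ) : ℝ := if 0 ≤ t then s ^ (t / 2).toNat else 0

theorem geo_of_neg (s : ℝ) {t : ℤ} (ht : t < 0) : geo s t = 0 := if_neg (by omega)

theorem geo_zero (s : ℝ) : geo s 0 = 1 := by simp [geo]

/-- The coefficient recurrence of the geometric series 1/(1 - s t). Multiplication by F subtracts
sin θ times a neighbour, so the identities with F below telescope by it. -/
theorem geo_eq {s : ℝ} {t : ℤ} (ht : 2 ∣ t) :
    geo s t = (if t = 0 then 1 else 0) + s * geo s (t - 2) := by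
  obtain ⟨u, rfl⟩ := ht
  rcases lt_trichotomy u 0 with h | h | h
  · rw [geo_of_neg s (show 2 * u < 0 by omega), geo_of_neg s (show 2 * u - 2 < 0 by omega),
      if_neg (by omega)]
    simp
  · subst h
    rw [mul_zero, geo_zero, geo_of_neg s (show (0 : ℤ) - 2 < 0 by omega)]
    simp
  · rw [geo, geo, if_pos (show 0 ≤ 2 * u by omega), if_neg (show ¬ 2 * u = 0 by omega),
      if_pos (show 0 ≤ 2 * u - 2 by omega), zero_add, ← pow_succ']
    congr 1
    omega

theorem abs_geo_le {s : ℝ} (hs : |s| ≤ 1) (t : ℤ) : |geo s t| ≤ 1 := by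
  rw [geo]
  split_ifs
  · rw [abs_pow]; exact pow_le_one₀ (abs_nonneg _) hs
  · simp

theorem continuous_geo (t : ℤ) : Continuous fun s => geo s t := by
  unfold geo
  split_ifs <;> fun_prop

/-- The inverse of `F_{ℤ+1/2}(θ)`. -/
noncomputable def finv (θ : ℝ) (n k : ℤ) : ℝ :=
  if k = 1 ∨ k = -1 then
    geo (Real.sin θ) (|n| - 1) *
      ((if (0 < n ↔ 0 < k) then Real.cos (θ / 2) else Real.sin (θ / 2)) / Real.cos θ)
  else if (0 < n ↔ 0 < k) then geo (Real.sin θ) (|n| - |k|) else 0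

theorem cos_eq_half (θ : ℝ) : Real.cos θ = Real.cos (θ / 2) ^ 2 - Real.sin (θ / 2) ^ 2 := by
  rw [← Real.cos_two_mul']; ring_nf

theorem sin_eq_half (θ : ℝ) : Real.sin θ = 2 * Real.sin (θ / 2) * Real.cos (θ / 2) := by
  rw [← Real.sin_two_mul]; ring_nf

/-- Away from the centre F is 1 minus sin θ times a shift on each half-line, inverted by a geometric
series. The central block at ±1/2 has determinant cos²(θ/2) - sin²(θ/2) = cos θ, whence the
denominator in `finv`. -/
theorem fMat_finv_row {θ : ℝ} (hθ : Real.cos θ ≠ 0) {n m : ℤ} (hn : ∃ u, n = 1 + 2 * u)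
    (hm : ∃ u, m = 1 + 2 * u) :
    (if n = 0 then Real.cos θ * finv θ 0 m else if n = 1 ∨ n = -1 then
        Real.cos (θ / 2) * finv θ n m + -Real.sin (θ / 2) * finv θ (-n) m
        else 1 * finv θ n m + -Real.sin θ * finv θ (n - 2 * n.sign) m) = if n = m then 1 else 0 := by
  obtain ⟨u, hu⟩ := hn
  obtain ⟨w, hw⟩ := hm
  have hc := cos_eq_half θ
  rw [if_neg (by omega)]
  by_cases h1 : n = 1 ∨ n = -1
  · have hn1 : |n| - 1 = 0 := by rcases h1 with h | h <;> simp [h]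
    have hn2 : |-n| - 1 = 0 := by rw [abs_neg, hn1]
    rw [if_pos h1]
    by_cases h2 : m = 1 ∨ m = -1
    · simp only [finv, if_pos h2, hn1, hn2, geo_zero, one_mul]
      by_cases h3 : n = m
      · rw [if_pos h3, if_pos (by omega), if_neg (by omega)]
        field_simp
        rw [hc]; ring
      · rw [if_neg h3, if_neg (by omega), if_pos (by omega)]
        ring
    · have hm3 : |m| ≥ 3 := by rcases abs_cases m with h | h <;> omega
      have hnm : |n| - |m| < 0 := by omega
      have hnm' : |-n| - |m| < 0 := by omega
      simp only [finv, if_neg h2, geo_of_neg _ hnm, geo_of_neg _ hnm']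
      rw [if_neg (show ¬ n = m by rintro rfl; exact h2 h1)]
      simp
  · rw [if_neg h1]
    have hn3 : |n - 2 * n.sign| = |n| - 2 ∧ (0 < n ↔ 0 < n - 2 * n.sign) := by
      rcases lt_or_gt_of_ne (show n ≠ 0 by omega) with h | h
      · rw [Int.sign_eq_neg_one_of_neg h, abs_of_neg h, abs_of_neg (by omega)]
        constructor <;> omega
      · rw [Int.sign_eq_one_of_pos h, abs_of_pos h, abs_of_pos (by omega)]
        constructor <;> omega
    have hn4 : (0 < n - 2 * n.sign ↔ 0 < m) ↔ (0 < n ↔ 0 < m) := by rw [hn3.2]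
    by_cases h2 : m = 1 ∨ m = -1
    · simp only [finv, if_pos h2, hn4, hn3.1]
      have hd : (2 : ℤ) ∣ |n| - 1 := by rcases abs_cases n with h | h <;> omega
      have hd' : ¬ |n| - 1 = 0 := by rcases abs_cases n with h | h <;> omega
      rw [geo_eq hd, if_neg hd', if_neg (show ¬ n = m by omega),
        show |n| - 1 - 2 = |n| - 2 - 1 by ring]
      ring
    · simp only [finv, if_neg h2, hn4, hn3.1]
      by_cases h3 : (0 < n ↔ 0 < m)
      · simp only [if_pos h3]
        have hd : (2 : ℤ) ∣ |n| - |m| := by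
          rcases abs_cases n with h | h <;> rcases abs_cases m with h' | h' <;> omega
        have he : (|n| - |m| = 0) ↔ (n = m) := by
          rcases abs_cases n with h | h <;> rcases abs_cases m with h' | h' <;> omega
        rw [geo_eq hd, show |n| - |m| - 2 = |n| - 2 - |m| by ring, if_congr he rfl rfl]
        ring
      · simp only [if_neg h3]
        rw [if_neg (by rintro rfl; exact h3 Iff.rfl)]
        ring

/-- The same telescoping along columns. For infinite matrices both products have to be checked. -/
theorem finv_fMat_col {θ : ℝ} (hθ : Real.cos θ ≠ 0) {n k : ℤ} (hn : ∃ u, n = 1 + 2 * u)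
    (hk : ∃ u, k = 1 + 2 * u) :
    (if k = 1 ∨ k = -1 then Real.cos (θ / 2) * finv θ n k - Real.sin (θ / 2) * finv θ n (-k)
        else finv θ n k) - Real.sin θ * finv θ n (k + 2 * k.sign) = if n = k then 1 else 0 := by
  obtain ⟨u, hu⟩ := hn
  obtain ⟨w, hw⟩ := hk
  have hc := cos_eq_half θ
  have hks : |k + 2 * k.sign| = |k| + 2 ∧ (0 < k + 2 * k.sign ↔ 0 < k) := by
    rcases lt_or_gt_of_ne (show k ≠ 0 by omega) with h | h
    · rw [Int.sign_eq_neg_one_of_neg h, abs_of_neg h, abs_of_neg (by omega)]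
      constructor <;> omega
    · rw [Int.sign_eq_one_of_pos h, abs_of_pos h, abs_of_pos (by omega)]
      constructor <;> omega
  have hk1 : ¬ (k + 2 * k.sign = 1 ∨ k + 2 * k.sign = -1) := by
    rcases abs_cases k with h | h <;> rcases abs_cases (k + 2 * k.sign) with h' | h' <;> omega
  have hk2 : (0 < n ↔ 0 < k + 2 * k.sign) ↔ (0 < n ↔ 0 < k) := by rw [hks.2]
  have hd : (2 : ℤ) ∣ |n| - |k| := by
    rcases abs_cases n with h | h <;> rcases abs_cases k with h' | h' <;> omega
  have he : (0 < n ↔ 0 < k) → ((|n| - |k| = 0) ↔ (n = k)) := by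
    rcases abs_cases n with h | h <;> rcases abs_cases k with h' | h' <;> omega
  have hgk : finv θ n (k + 2 * k.sign) =
      if (0 < n ↔ 0 < k) then geo (Real.sin θ) (|n| - |k| - 2) else 0 := by
    simp only [finv, if_neg hk1, hk2, hks.1]
    rw [show |n| - (|k| + 2) = |n| - |k| - 2 by ring]
  rw [hgk]
  by_cases h1 : k = 1 ∨ k = -1
  · have hk3 : |k| = 1 := by rcases h1 with h | h <;> simp [h]
    have h1' : -k = 1 ∨ -k = -1 := by omega
    have hk4 : (0 < n ↔ 0 < -k) ↔ ¬ (0 < n ↔ 0 < k) := by omega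
    rw [if_pos h1]
    simp only [finv, if_pos h1, if_pos h1', hk4]
    rw [hk3] at hd he
    rw [hk3, geo_eq hd]
    by_cases h3 : (0 < n ↔ 0 < k)
    · rw [if_pos h3, if_pos h3, if_neg (not_not.2 h3), if_congr (he h3) rfl rfl]
      field_simp
      rw [hc]; ring
    · rw [if_neg h3, if_neg h3, if_pos h3,
        if_neg (show ¬ n = k by rintro rfl; exact h3 Iff.rfl)]
      ring
  · rw [if_neg h1]
    simp only [finv, if_neg h1]
    by_cases h3 : (0 < n ↔ 0 < k)
    · rw [if_pos h3, if_pos h3, geo_eq hd, if_congr (he h3) rfl rfl]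
      ring
    · rw [if_neg h3, if_neg h3, if_neg (by rintro rfl; exact h3 Iff.rfl)]
      ring

theorem Idx.odd (n : Idx 1) : ∃ u, n.1 = 1 + 2 * u := n.even_sub ⟨1, by decide⟩

theorem Idx.even (n : Idx 0) : ∃ u, n.1 = 2 * u := by
  obtain ⟨u, hu⟩ := n.even_sub ⟨0, by decide⟩
  exact ⟨u, by simpa using hu⟩

theorem abs_sin_lt_one {θ : ℝ} (hθ : Real.cos θ ≠ 0) : |Real.sin θ| < 1 := by
  rw [← sq_lt_one_iff_abs_lt_one]
  have h1 := Real.sin_sq_add_cos_sq θ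
  have h2 : 0 < Real.cos θ ^ 2 := by positivity
  nlinarith

/-- For cos θ ≠ 0, |sin θ| < 1, and the entries decay geometrically in |n| - |m|. -/
theorem finv_rapid {θ : ℝ} (hθ : Real.cos θ ≠ 0) (s : ℕ) : ∃ K : ℝ, ∀ n m : Idx 1,
    (1 + CyclicExtension.diagWeight n.1 m.1) ^ s * |finv θ n.1 m.1| ≤ K := by
  obtain ⟨K, hK⟩ := exists_bound_pow_mul_geometric (abs_sin_lt_one hθ) s
  have hK0 : 0 ≤ K := le_trans (by positivity) (hK 0)
  have hc0 : 0 < |Real.cos θ| := abs_pos.2 hθ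
  have hc1 : 1 ≤ |Real.cos θ|⁻¹ := (one_le_inv₀ hc0).2 (Real.abs_cos_le_one θ)
  refine ⟨K * |Real.cos θ|⁻¹, fun n m => ?_⟩
  have h0 := CyclicExtension.diagWeight_nonneg n.1 m.1
  have hgeo : (1 + CyclicExtension.diagWeight n.1 m.1) ^ s * |geo (Real.sin θ) (|n.1| - |m.1|)| ≤
      K := by
    by_cases h : 0 ≤ |n.1| - |m.1|
    · have hd : (2 : ℤ) ∣ |n.1| - |m.1| := by
        obtain ⟨u, hu⟩ := n.odd
        obtain ⟨w, hw⟩ := m.odd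
        rcases abs_cases n.1 with h | h <;> rcases abs_cases m.1 with h' | h' <;> omega
      obtain ⟨t, ht⟩ := Int.eq_ofNat_of_zero_le (show 0 ≤ (|n.1| - |m.1|) / 2 by omega)
      have h1 : |n.1| - |m.1| = 2 * t := by omega
      have h2 : CyclicExtension.diagWeight n.1 m.1 = 2 * t := by
        rw [CyclicExtension.diagWeight, ← Int.cast_abs, ← Int.cast_abs, ← Int.cast_sub, h1]
        push_cast
        rw [abs_of_nonneg (by positivity)]
      rw [geo, if_pos h, h2, abs_pow, ht]
      exact hK t
    · rw [geo_of_neg _ (by omega), abs_zero, mul_zero]; exact hK0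
  have hfin : |finv θ n.1 m.1| ≤ |geo (Real.sin θ) (|n.1| - |m.1|)| * |Real.cos θ|⁻¹ := by
    rw [finv]
    split_ifs with h1 h2 h3
    · have hm : |m.1| = 1 := by rcases h1 with h | h <;> simp [h]
      rw [hm, abs_mul, abs_div, div_eq_mul_inv]
      exact mul_le_mul_of_nonneg_left (mul_le_of_le_one_left (by positivity)
        (Real.abs_cos_le_one _)) (abs_nonneg _)
    · have hm : |m.1| = 1 := by rcases h1 with h | h <;> simp [h]
      rw [hm, abs_mul, abs_div, div_eq_mul_inv]
      exact mul_le_mul_of_nonneg_left (mul_le_of_le_one_left (by positivity)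
        (Real.abs_sin_le_one _)) (abs_nonneg _)
    · exact le_mul_of_one_le_right (abs_nonneg _) hc1
    · rw [abs_zero]; positivity
  calc _ ≤ (1 + CyclicExtension.diagWeight n.1 m.1) ^ s *
        (|geo (Real.sin θ) (|n.1| - |m.1|)| * |Real.cos θ|⁻¹) :=
        mul_le_mul_of_nonneg_left hfin (by positivity)
    _ = ((1 + CyclicExtension.diagWeight n.1 m.1) ^ s * |geo (Real.sin θ) (|n.1| - |m.1|)|) *
        |Real.cos θ|⁻¹ := by ring
    _ ≤ _ := mul_le_mul_of_nonneg_right hgeo (by positivity)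

end RealMatrices

/-! ### Invertibility of D^z(θ). -/

namespace CyclicExtension

variable {C : Type*} [Ring C] [Algebra ℝ C] [UniformSpace C] {E : CyclicExtension C}
variable [IsTopologicalRing C]
variable [IsUniformAddGroup C] [ContinuousSMul ℝ C] [LocallyConvexSpace ℝ C] [T2Space C]

theorem tameLoop_fMat (i : ZMod 2) (θ : ℝ) : E.TameLoop 0 0 (E.realMat (fMat i θ)) :=
  tameLoop_realMat (fMat_rapid i θ)

theorem tameLoop_toepMat {θ : ℝ} (hθ : Real.cos θ ≠ 0) (i : ZMod 2) (α : ℝ) :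
    E.TameLoop 0 0 (E.realMat (toepMat i α θ)) :=
  tameLoop_realMat (toepMat_rapid hθ i α)

theorem tameLoop_finv {θ : ℝ} (hθ : Real.cos θ ≠ 0) :
    E.TameLoop 0 0 (E.realMat fun n m : Idx 1 => finv θ n.1 m.1) :=
  tameLoop_realMat (finv_rapid hθ)

theorem Dz_eq (hE : E.SeqComplete) {θ : ℝ} (hθ : Real.cos θ ≠ 0) (i : ZMod 2) :
    E.Dz i θ = E.realMat (fMat i θ) ⬝ E.realMat (toepMat i (-(1 / 2)) θ) := by
  rw [realMat_mul_realMat hE (tameLoop_fMat i θ) (tameLoop_toepMat hθ i _) (hasSum_Dmat i θ)]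
  refine E.ro_injective fun n m x => ?_
  rw [ro_realMat, ro_apply, Dz, zPow]
  simp only [Pi.smul_apply, mono]
  have hx : (x.ε = 0 ∧ x.p - n.1 + sg x.ε * m.1 = m.1 - n.1) ↔ x = 1 := by
    rw [Dih.ext_iff]
    refine and_congr_right fun h => ?_
    rw [h, sg_zero]
    constructor <;> intro h' <;> simp at h' ⊢ <;> omega
  rw [if_congr hx rfl rfl]
  split_ifs
  · have hz : E.zp n.1 * E.zp (m.1 - n.1) = E.zp m.1 := by rw [← zp_add]; congr 1; ring
    have hm : idem (C := C) ((0 : ZMod 2) + (m.1 : ZMod 2)) = idem i := by rw [zero_add, m.2]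
    rw [mul_smul_comm, smul_mul_assoc, ← mul_assoc, hz, zp_mul_idem, mul_assoc,
      zp_mul_zp_neg, mul_one, hm]
  · simp

theorem tameLoop_Dz (hE : E.SeqComplete) {θ : ℝ} (hθ : Real.cos θ ≠ 0) (i : ZMod 2) :
    E.TameLoop 0 0 (E.Dz i θ) := by
  rw [Dz_eq hE hθ]
  exact (tameLoop_fMat i θ).mul hE (tameLoop_toepMat hθ i _)

theorem toepMat_mul_neg (hE : E.SeqComplete) {θ : ℝ} (hθ : Real.cos θ ≠ 0) (i : ZMod 2) (α : ℝ) :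
    E.realMat (toepMat i α θ) ⬝ E.realMat (toepMat i (-α) θ) = oneM 0 i := by
  rw [realMat_mul_realMat hE (tameLoop_toepMat hθ i α) (tameLoop_toepMat hθ i (-α))
    (hasSum_toepMat hθ i α), realMat_one]

/-- The inverse is T(ω^{1/2}) F⁻¹, where T denotes the Toeplitz matrix. -/
theorem exists_isInverse_Dz (hE : E.SeqComplete) {θ : ℝ} (hθ : Real.cos θ ≠ 0) :
    ∃ W, E.IsInverse 0 (E.Dz 1 θ) W := by
  have hF : E.TameLoop 0 0 (E.realMat (fMat 1 θ)) := tameLoop_fMat 1 θ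
  have hT : E.TameLoop 0 0 (E.realMat (toepMat 1 (-(1 / 2)) θ)) := tameLoop_toepMat hθ 1 _
  have hT' : E.TameLoop 0 0 (E.realMat (toepMat 1 (1 / 2) θ)) := tameLoop_toepMat hθ 1 _
  have hF' : E.TameLoop 0 0 (E.realMat fun n m : Idx 1 => finv θ n.1 m.1) := tameLoop_finv hθ
  have h1 : E.realMat (fMat 1 θ) ⬝ (E.realMat fun n m : Idx 1 => finv θ n.1 m.1) = oneM 0 1 := by
    rw [← realMat_one]
    refine realMat_mul_realMat hE hF hF' fun n m => ?_
    have h := hasSum_fMat_mul θ n (fun l => finv θ l m.1)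
    rw [fMat_finv_row hθ n.odd m.odd] at h
    simpa only [Subtype.ext_iff] using h
  have h2 : (E.realMat fun n m : Idx 1 => finv θ n.1 m.1) ⬝ E.realMat (fMat 1 θ) = oneM 0 1 := by
    rw [← realMat_one]
    refine realMat_mul_realMat hE hF' hF fun n m => ?_
    have h := hasSum_mul_fMat θ m (fun l => finv θ n.1 l)
    rw [finv_fMat_col hθ n.odd m.odd] at h
    simpa only [Subtype.ext_iff] using h
  have h3 : E.realMat (toepMat 1 (-(1 / 2)) θ) ⬝ E.realMat (toepMat 1 (1 / 2) θ) = oneM 0 1 := by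
    have := toepMat_mul_neg hE hθ 1 (-(1 / 2)) (E := E)
    rwa [neg_neg] at this
  have h4 : E.realMat (toepMat 1 (1 / 2) θ) ⬝ E.realMat (toepMat 1 (-(1 / 2)) θ) = oneM 0 1 :=
    toepMat_mul_neg hE hθ 1 (1 / 2)
  refine ⟨_, IsInverse.of_tameLoop (hT'.mul hE hF') ?_ ?_⟩
  · rw [Dz_eq hE hθ, mulM_assoc hE hF hT (hT'.mul hE hF'), ← mulM_assoc hE hT hT' hF', h3,
      oneM_mulM hE hF', h1]
  · rw [Dz_eq hE hθ, mulM_assoc hE hT' hF' (hF.mul hE hT), ← mulM_assoc hE hF' hF hT, h2,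
      oneM_mulM hE hT, h4]

end CyclicExtension

end CyclicLoop

/-! ### The coefficients of U(a, θ) in closed form. -/

namespace CyclicLoop

section RealMatrices

open Real (cos sin)

/-- The rotated `(n, k)` entry of the deformation in row `n ≥ 0`, as the coefficient of the even
term of degree `p / 2` of the series. -/
noncomputable def deformBase (θ : ℝ) (p n k : ℤ) : ℝ :=
  if 2 ≤ n then
    if 3 ≤ k then (if p = n - k then 1 else 0)
    else if k = 1 then
      cos (θ / 2) * (if p = n - 1 then 1 else 0) + cos θ * sin (θ / 2) * geo (sin θ) (p - n - 1)
    else if k = -1 then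
      -sin (θ / 2) * (if p = n - 1 then 1 else 0) + cos θ * cos (θ / 2) * geo (sin θ) (p - n - 1)
    else -sin θ * (if p = n - 2 - k then 1 else 0) + cos θ ^ 2 * geo (sin θ) (p - n + k)
  else
    if 3 ≤ k then 0 * 0 + cos θ * geo (sin θ) (-p - k)
    else if k = 1 then
      cos (θ / 2) * geo (sin θ) (-p - 1) + sin (θ / 2) * geo (sin θ) (p - 1)
    else if k = -1 then
      sin (θ / 2) * geo (sin θ) (-p - 1) + cos (θ / 2) * geo (sin θ) (p - 1)
    else 0 * 0 + cos θ * geo (sin θ) (p + k)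

/-- The coefficients of the matrices `U_{ℤ,ℤ+1/2}(a, θ)`. -/
noncomputable def deformCoeff (θ : ℝ) (p n k : ℤ) : ℝ :=
  if 0 ≤ n then deformBase θ p n k else deformBase θ (-p) (-n) (-k)

/-- No denominator cos θ is left in the closed form, so nothing singular happens at cos θ = 0. This
is what provides the continuous extension. -/
theorem continuous_deformBase (p n k : ℤ) : Continuous fun θ => deformBase θ p n k := by
  have hg : ∀ t, Continuous fun θ => geo (sin θ) t := fun t =>
    (continuous_geo t).comp Real.continuous_sin
  unfold deformBase
  split_ifs <;> fun_prop

theorem continuous_deformCoeff (p n k : ℤ) : Continuous fun θ => deformCoeff θ p n k := by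
  unfold deformCoeff
  split_ifs <;> exact continuous_deformBase _ _ _

/-- Apart from the 0/1 branch, every branch of `deformBase` is written as a * b + c * d with factors
of absolute value at most 1. The summands `0 * 0` in the definition serve to keep this shape. -/
theorem abs_mul_add_mul_le {a b c d : ℝ} (ha : |a| ≤ 1) (hb : |b| ≤ 1) (hc : |c| ≤ 1)
    (hd : |d| ≤ 1) : |a * b + c * d| ≤ 2 := by
  have h1 := mul_le_one₀ ha (abs_nonneg b) hb
  have h2 := mul_le_one₀ hc (abs_nonneg d) hd
  have h3 := abs_add_le (a * b) (c * d)
  rw [abs_mul, abs_mul] at h3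
  linarith

theorem abs_deformBase_le (θ : ℝ) (p n k : ℤ) : |deformBase θ p n k| ≤ 2 := by
  have hg := abs_geo_le (Real.abs_sin_le_one θ)
  have hi : ∀ (q : Prop) [Decidable q], |(if q then 1 else 0 : ℝ)| ≤ 1 := fun q _ => by
    split_ifs <;> simp
  have h1 := Real.abs_cos_le_one
  have h2 := Real.abs_sin_le_one
  have h1' : ∀ x y : ℝ, |cos x * cos y| ≤ 1 := fun x y => by
    rw [abs_mul]; exact mul_le_one₀ (h1 _) (abs_nonneg _) (h1 _)
  have h2' : ∀ x y : ℝ, |cos x * sin y| ≤ 1 := fun x y => by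
    rw [abs_mul]; exact mul_le_one₀ (h1 _) (abs_nonneg _) (h2 _)
  have h3 : |(0 : ℝ)| ≤ 1 := by simp
  have h4 : ∀ x, |-sin x| ≤ 1 := fun x => by rw [abs_neg]; exact h2 x
  have h5 : |cos θ ^ 2| ≤ 1 := by rw [sq]; exact h1' _ _
  unfold deformBase
  split_ifs with k1 k2 k3 k4 k5 <;> first
    | (norm_num; done)
    | (refine abs_mul_add_mul_le ?_ ?_ ?_ ?_ <;>
        first
        | exact h3
        | exact hg _
        | exact h1 _
        | exact h2 _
        | exact h1' _ _
        | exact h2' _ _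
        | exact h4 _
        | exact h5
        | norm_num)

/-- When |n| + |k| exceeds |p| + 2, every geometric factor has a negative argument and vanishes, as
do the indicators with trigonometric factors. Only the diagonal n - k = p for n ≥ 2, k ≥ 3 remains,
and it does not involve θ. -/
theorem deformBase_of_lt (θ : ℝ) {p n k : ℤ} (hn : 0 ≤ n) (hn' : 2 ∣ n) (hk : ¬ 2 ∣ k)
    (h : |p| + 2 < n + |k|) :
    deformBase θ p n k = if 2 ≤ n ∧ 3 ≤ k ∧ p = n - k then 1 else 0 := by
  have hp := abs_le.1 (le_refl |p|)
  rw [deformBase]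
  by_cases h0 : 2 ≤ n
  · rw [if_pos h0]
    by_cases h1 : 3 ≤ k
    · rw [if_pos h1]
      simp only [h0, h1, true_and]
    · have hk' : |k| = -k ∨ k = 1 := by rcases abs_cases k with h | h <;> omega
      rw [if_neg h1, if_neg (show ¬ (2 ≤ n ∧ 3 ≤ k ∧ p = n - k) by omega)]
      by_cases h2 : k = 1
      · subst h2
        rw [abs_one] at h
        rw [if_pos rfl, if_neg (by omega), geo_of_neg _ (by omega)]; ring
      · rw [if_neg h2]
        have hk2 : |k| = -k := by omega
        by_cases h3 : k = -1
        · rw [if_pos h3, if_neg (by omega), geo_of_neg _ (by omega)]; ring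
        · rw [if_neg h3, if_neg (by omega), geo_of_neg _ (by omega)]; ring
  · rw [if_neg h0, if_neg (show ¬ (2 ≤ n ∧ 3 ≤ k ∧ p = n - k) by omega)]
    by_cases h1 : 3 ≤ k
    · rw [abs_of_pos (show 0 < k by omega)] at h
      rw [if_pos h1, geo_of_neg _ (by omega)]; ring
    · have hk' : |k| = -k ∨ k = 1 := by rcases abs_cases k with h | h <;> omega
      rw [if_neg h1]
      by_cases h2 : k = 1
      · subst h2
        rw [abs_one] at h
        rw [if_pos rfl, geo_of_neg _ (by omega), geo_of_neg _ (by omega)]; ring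
      · rw [if_neg h2]
        have hk2 : |k| = -k := by omega
        by_cases h3 : k = -1
        · rw [if_pos h3, geo_of_neg _ (by omega), geo_of_neg _ (by omega)]; ring
        · rw [if_neg h3, geo_of_neg _ (by omega)]; ring

theorem deformCoeff_of_lt (θ : ℝ) {p n k : ℤ} (hn' : 2 ∣ n) (hk : ¬ 2 ∣ k)
    (h : |p| + 2 < |n| + |k|) : deformCoeff θ p n k =
      if p = n - k ∧ (2 ≤ n ∧ 3 ≤ k ∨ n ≤ -2 ∧ k ≤ -3) then 1 else 0 := by
  rw [deformCoeff]
  split_ifs with h1 h2 h2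
  · rw [abs_of_nonneg h1] at h
    rw [deformBase_of_lt θ h1 hn' hk h, if_pos (by omega)]
  · rw [abs_of_nonneg h1] at h
    rw [deformBase_of_lt θ h1 hn' hk h, if_neg (by omega)]
  · rw [abs_of_neg (show n < 0 by omega), ← abs_neg p, ← abs_neg k] at h
    rw [deformBase_of_lt θ (by omega) (by omega) (by omega) h, if_pos (by omega)]
  · rw [abs_of_neg (show n < 0 by omega), ← abs_neg p, ← abs_neg k] at h
    rw [deformBase_of_lt θ (by omega) (by omega) (by omega) h, if_neg (by omega)]

theorem abs_deformCoeff_le (θ : ℝ) (p n k : ℤ) : |deformCoeff θ p n k| ≤ 2 := by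
  unfold deformCoeff
  split_ifs <;> exact abs_deformBase_le _ _ _ _

theorem deformCoeff_support {θ : ℝ} {p n k : ℤ} (hn : 2 ∣ n) (hk : ¬ 2 ∣ k)
    (h : deformCoeff θ p n k ≠ 0) : |(|n| - |k|)| ≤ |p| + 2 := by
  by_contra! h1
  have h2 : |p| + 2 < |n| + |k| := by
    rcases abs_cases (|n| - |k|) with h | h <;> have := abs_nonneg n <;> have := abs_nonneg k <;>
      omega
  rw [deformCoeff_of_lt θ hn hk h2] at h
  split_ifs at h with h3
  · obtain ⟨h4, h5⟩ := h3
    rcases h5 with h5 | h5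
    · rw [abs_of_pos (show 0 < n by omega), abs_of_pos (show 0 < k by omega), ← h4] at h1
      omega
    · rw [abs_of_neg (show n < 0 by omega), abs_of_neg (show k < 0 by omega),
        show -n - -k = -p by omega, abs_neg] at h1
      omega
  · exact h rfl

theorem geo_zero_left {t : ℤ} (ht : 2 ∣ t) : geo 0 t = if t = 0 then 1 else 0 := by
  rw [geo_eq ht, zero_mul, add_zero]

theorem deformBase_zero {p n k : ℤ} (hn : 0 ≤ n) (hn' : 2 ∣ n) (hk : ¬ 2 ∣ k) (hp : ¬ 2 ∣ p) :
    deformBase 0 p n k = if p = n - k then 1 else 0 := by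
  simp only [deformBase, zero_div, Real.cos_zero, Real.sin_zero, one_mul, zero_mul, mul_zero,
    neg_zero, zero_add, add_zero, one_pow]
  split_ifs with h0 h1 h2 h2 h2 h3 h3 h3 h4 h4 h4 <;>
    first
    | rfl
    | (exfalso; omega)
    | (rw [geo_zero_left (by omega)]; first | rw [if_pos (by omega)] | rw [if_neg (by omega)])

theorem deformCoeff_zero {p n k : ℤ} (hn : 2 ∣ n) (hk : ¬ 2 ∣ k) (hp : ¬ 2 ∣ p) :
    deformCoeff 0 p n k = if p = n - k then 1 else 0 := by
  rw [deformCoeff]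
  split_ifs with h1 h2 h2
  · rw [deformBase_zero h1 hn hk hp, if_pos h2]
  · rw [deformBase_zero h1 hn hk hp, if_neg h2]
  · rw [deformBase_zero (by omega) (by omega) (by omega) (by omega), if_pos (by omega)]
  · rw [deformBase_zero (by omega) (by omega) (by omega) (by omega), if_neg (by omega)]

theorem deformBase_of_ge {θ : ℝ} {p n k : ℤ} (hn : 2 ≤ n) (hk : 3 ≤ k) :
    deformBase θ p n k = if p = n - k then 1 else 0 := by
  rw [deformBase, if_pos hn, if_pos hk]

theorem deformBase_one {θ : ℝ} {p n : ℤ} (hn : 2 ≤ n) :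
    deformBase θ p n 1 = cos (θ / 2) * (if p = n - 1 then 1 else 0) +
      cos θ * sin (θ / 2) * geo (sin θ) (p - n - 1) := by
  rw [deformBase, if_pos hn]; norm_num

theorem deformBase_neg_one {θ : ℝ} {p n : ℤ} (hn : 2 ≤ n) :
    deformBase θ p n (-1) = -sin (θ / 2) * (if p = n - 1 then 1 else 0) +
      cos θ * cos (θ / 2) * geo (sin θ) (p - n - 1) := by
  rw [deformBase, if_pos hn]; norm_num

theorem deformBase_of_le {θ : ℝ} {p n k : ℤ} (hn : 2 ≤ n) (hk : k ≤ -2) :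
    deformBase θ p n k =
      -sin θ * (if p = n - 2 - k then 1 else 0) + cos θ ^ 2 * geo (sin θ) (p - n + k) := by
  rw [deformBase, if_pos hn, if_neg (by omega), if_neg (by omega), if_neg (by omega)]

theorem deformBase_zero_of_ge {θ : ℝ} {p k : ℤ} (hk : 3 ≤ k) :
    deformBase θ p 0 k = cos θ * geo (sin θ) (-p - k) := by
  rw [deformBase, if_neg (by omega), if_pos hk, zero_mul, zero_add]

theorem deformBase_zero_one {θ : ℝ} {p : ℤ} :
    deformBase θ p 0 1 = cos (θ / 2) * geo (sin θ) (-p - 1) + sin (θ / 2) * geo (sin θ) (p - 1) := by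
  rw [deformBase]; norm_num

theorem deformBase_zero_neg_one {θ : ℝ} {p : ℤ} :
    deformBase θ p 0 (-1) =
      sin (θ / 2) * geo (sin θ) (-p - 1) + cos (θ / 2) * geo (sin θ) (p - 1) := by
  rw [deformBase]; norm_num

theorem deformBase_zero_of_le {θ : ℝ} {p k : ℤ} (hk : k ≤ -2) :
    deformBase θ p 0 k = cos θ * geo (sin θ) (p + k) := by
  rw [deformBase, if_neg (by omega), if_neg (by omega), if_neg (by omega), if_neg (by omega),
    zero_mul, zero_add]

/-- The defining relation X F = F U for one term, in a row n ≥ 0. The geometric tails of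
neighbouring columns cancel by `geo_eq`; what remains is sin² + cos² = 1 at θ or θ/2, or cos θ =
cos²(θ/2) - sin²(θ/2). -/
theorem deformBase_fMat (θ : ℝ) {p n k : ℤ} (hn : 0 ≤ n) (hn' : 2 ∣ n) (hk : ¬ 2 ∣ k)
    (hp : ¬ 2 ∣ p) :
    (if k = 1 ∨ k = -1 then cos (θ / 2) * deformBase θ p n k - sin (θ / 2) * deformBase θ p n (-k)
      else deformBase θ p n k) - sin θ * deformBase θ p n (k + 2 * k.sign) =
    if n = 0 then cos θ * (if p = -k then 1 else 0)
      else (if p = n - k then 1 else 0) - sin θ * (if p = n - 2 - k then 1 else 0) := by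
  have h1 := Real.sin_sq_add_cos_sq (θ / 2)
  have h2 := Real.sin_sq_add_cos_sq θ
  have hc := cos_eq_half θ
  have hs := sin_eq_half θ
  rcases lt_or_gt_of_ne (show k ≠ 0 by omega) with hk1 | hk1
  · rw [Int.sign_eq_neg_one_of_neg hk1]
    by_cases hk2 : k = -1
    · subst hk2
      rw [if_pos (Or.inr rfl), neg_neg, show (-1 : ℤ) + 2 * -1 = -3 by norm_num]
      by_cases h0 : 2 ≤ n
      · rw [deformBase_neg_one h0, deformBase_one h0, deformBase_of_le h0 (by norm_num),
          if_neg (show ¬ n = 0 by omega), show p - n + -3 = p - n - 1 - 2 by ring,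
          geo_eq (show 2 ∣ p - n - 1 by omega), show n - 2 - -3 = n - -1 by ring,
          if_congr (show p - n - 1 = 0 ↔ p = n - -1 by omega) rfl rfl,
          if_congr (show p = n - 2 - -1 ↔ p = n - 1 by omega) rfl rfl]
        generalize geo (sin θ) (p - n - 1 - 2) = g
        generalize (if p = n - -1 then (1 : ℝ) else 0) = u
        generalize (if p = n - 1 then (1 : ℝ) else 0) = v
        rw [hs] at h2 ⊢
        rw [hc] at h2 ⊢
        generalize cos (θ / 2) = c at *
        generalize sin (θ / 2) = σ at *
        linear_combination u * h2
      · obtain rfl : n = 0 := by omega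
        rw [deformBase_zero_neg_one, deformBase_zero_one, deformBase_zero_of_le (by norm_num),
          if_pos rfl, show p + -3 = p - 1 - 2 by ring, geo_eq (show 2 ∣ p - 1 by omega),
          if_congr (show p - 1 = 0 ↔ p = 1 by omega) rfl rfl, hc]
        ring
    · rw [if_neg (by omega)]
      by_cases h0 : 2 ≤ n
      · rw [deformBase_of_le h0 (by omega), deformBase_of_le h0 (by omega),
          if_neg (show ¬ n = 0 by omega), show p - n + (k + 2 * -1) = p - n + k - 2 by ring,
          geo_eq (show 2 ∣ p - n + k by omega), show n - 2 - (k + 2 * -1) = n - k by ring,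
          if_congr (show p - n + k = 0 ↔ p = n - k by omega) rfl rfl]
        linear_combination (if p = n - k then (1 : ℝ) else 0) * h2
      · obtain rfl : n = 0 := by omega
        rw [deformBase_zero_of_le (by omega), deformBase_zero_of_le (by omega), if_pos rfl,
          show p + (k + 2 * -1) = p + k - 2 by ring, geo_eq (show 2 ∣ p + k by omega),
          if_congr (show p + k = 0 ↔ p = -k by omega) rfl rfl]
        ring
  · rw [Int.sign_eq_one_of_pos hk1]
    by_cases hk2 : k = 1
    · subst hk2
      rw [if_pos (Or.inl rfl), show (1 : ℤ) + 2 * 1 = 3 by norm_num]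
      by_cases h0 : 2 ≤ n
      · rw [deformBase_neg_one h0, deformBase_one h0, deformBase_of_ge h0 (by norm_num),
          if_neg (show ¬ n = 0 by omega),
          if_congr (show p = n - 2 - 1 ↔ p = n - 3 by omega) rfl rfl]
        linear_combination (if p = n - 1 then (1 : ℝ) else 0) * h1
      · obtain rfl : n = 0 := by omega
        rw [deformBase_zero_neg_one, deformBase_zero_one, deformBase_zero_of_ge (by norm_num),
          if_pos rfl, show -p - 3 = -p - 1 - 2 by ring, geo_eq (show 2 ∣ -p - 1 by omega),
          if_congr (show -p - 1 = 0 ↔ p = -1 by omega) rfl rfl, hc]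
        ring
    · rw [if_neg (by omega)]
      by_cases h0 : 2 ≤ n
      · rw [deformBase_of_ge h0 (by omega), deformBase_of_ge h0 (by omega),
          if_neg (show ¬ n = 0 by omega), show n - (k + 2 * 1) = n - 2 - k by ring]
      · obtain rfl : n = 0 := by omega
        rw [deformBase_zero_of_ge (by omega), deformBase_zero_of_ge (by omega), if_pos rfl,
          show -p - (k + 2 * 1) = -p - k - 2 by ring, geo_eq (show 2 ∣ -p - k by omega),
          if_congr (show -p - k = 0 ↔ p = -k by omega) rfl rfl]
        ring

theorem deformCoeff_fMat (θ : ℝ) {p n k : ℤ} (hn : 2 ∣ n) (hk : ¬ 2 ∣ k) (hp : ¬ 2 ∣ p) :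
    (if k = 1 ∨ k = -1 then cos (θ / 2) * deformCoeff θ p n k - sin (θ / 2) * deformCoeff θ p n (-k)
      else deformCoeff θ p n k) - sin θ * deformCoeff θ p n (k + 2 * k.sign) =
    if n = 0 then cos θ * (if k + p = 0 then 1 else 0) else if n = 1 ∨ n = -1 then
      cos (θ / 2) * (if k + p = n then 1 else 0) + -sin (θ / 2) * (if k + p = -n then 1 else 0)
      else 1 * (if k + p = n then 1 else 0) + -sin θ * (if k + p = n - 2 * n.sign then 1 else 0) := by
  rw [if_neg (show ¬ (n = 1 ∨ n = -1) by omega)]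
  rcases le_or_gt 0 n with h0 | h0
  · simp only [deformCoeff, if_pos h0]
    rw [deformBase_fMat θ h0 hn hk hp]
    by_cases h1 : n = 0
    · rw [if_pos h1, if_pos h1, if_congr (show p = -k ↔ k + p = 0 by omega) rfl rfl]
    · rw [if_neg h1, if_neg h1, Int.sign_eq_one_of_pos (show 0 < n by omega),
        if_congr (show p = n - k ↔ k + p = n by omega) rfl rfl,
        if_congr (show p = n - 2 - k ↔ k + p = n - 2 * 1 by omega) rfl rfl]
      ring
  · simp only [deformCoeff, if_neg (not_le.2 h0)]
    -- Negative rows follow by reversing the signs of `p`, `n` and `k` together.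
    have h := deformBase_fMat θ (p := -p) (n := -n) (k := -k) (by omega) (by omega) (by omega)
      (by omega)
    rw [Int.sign_neg, show -k + 2 * -k.sign = -(k + 2 * k.sign) by ring,
      if_congr (show (-k = 1 ∨ -k = -1) ↔ (k = 1 ∨ k = -1) by omega) rfl rfl,
      if_neg (show ¬ -n = 0 by omega)] at h
    rw [h, if_neg (show ¬ n = 0 by omega), Int.sign_eq_neg_one_of_neg h0,
      if_congr (show -p = -n - -k ↔ k + p = n by omega) rfl rfl,
      if_congr (show -p = -n - 2 - -k ↔ k + p = n - 2 * -1 by omega) rfl rfl]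
    ring

end RealMatrices

theorem Idx.two_dvd (n : Idx 0) : (2 : ℤ) ∣ n.1 := n.even

theorem Idx.not_two_dvd (n : Idx 1) : ¬ (2 : ℤ) ∣ n.1 := by
  obtain ⟨u, hu⟩ := n.odd; omega

theorem sg_eq_or (ε : ZMod 2) : sg ε = 1 ∨ sg ε = -1 := by
  rcases zmod_two_cases ε with rfl | rfl
  · exact Or.inl sg_zero
  · exact Or.inr sg_one

/-! ### U(a, θ) as the deformation of U(a). -/

namespace CyclicExtension

variable {C : Type*} [Ring C] [Algebra ℝ C] [UniformSpace C] [IsTopologicalRing C]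
  {E : CyclicExtension C} {i j : ZMod 2}

/-- Rotation cancels all the powers of `z` that depend on the indices. An even term of degree p
appears unchanged along the diagonal n - k = p, an odd one along the antidiagonal n + k = p. -/
theorem conj_multEntry (a : Series C) (n k : ℤ) (ε : ZMod 2) (p : ℤ) :
    E.zp n * E.multEntry a n k ε (p - n + sg ε * k) * E.zp (-k) =
      if n = sg ε * k + p then a ε p else 0 := by
  rw [multEntry]
  rcases zmod_two_cases ε with rfl | rfl
  · simp only [Pi.add_apply, mono, sg_zero, one_mul, true_and, zero_ne_one, false_and, if_false,
      add_zero]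
    by_cases h : p - n + k = 0
    · rw [if_pos h, if_pos (by omega), show n - k = p by omega]
      simp only [mul_assoc, zp_mul_zp_neg, mul_one]
      rw [← mul_assoc (E.zp (-k)), ← mul_assoc, ← zp_add, ← zp_add,
        show n + (-k + -p) = 0 by omega, zp_zero, one_mul]
    · rw [if_neg h, if_neg (by omega)]; simp
  · simp only [Pi.add_apply, mono, true_and, one_ne_zero, false_and, if_false, zero_add]
    have hs := sg_one
    by_cases h : p - n + sg 1 * k = 0
    · rw [if_pos h, if_pos (show n = sg 1 * k + p by omega),
        show n + k = p by rw [hs] at h; omega]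
      simp only [mul_assoc, zp_mul_zp_neg, mul_one]
      rw [← mul_assoc (E.zp k), ← mul_assoc, ← zp_add, ← zp_add,
        show n + (k + -p) = 0 by rw [hs] at h; omega, zp_zero, one_mul]
    · rw [if_neg h, if_neg (show ¬ n = sg 1 * k + p by omega)]; simp

theorem ro_multMat (a : Series C) (n : Idx i) (k : Idx j) (x : Dih) :
    E.ro (E.multMat i j a) n k x = if n.1 = sg x.ε * k.1 + x.p then a x.ε x.p else 0 := by
  rw [ro_apply, multMat, conj_multEntry]

theorem multMat_eq_famMat (a : Series C) : E.multMat i j a =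
    E.famMat (fun x n k => if n.1 = sg x.ε * k.1 + x.p then 1 else 0) a := by
  refine E.ro_injective fun n k x => ?_
  rw [ro_multMat, ro_famMat]
  split_ifs <;> simp

variable (E) in
/-- The matrix `U_{ℤ,ℤ+1/2}(a, θ)`. -/
noncomputable def deformMat (a : Series C) (θ : ℝ) : Mat C 0 1 :=
  E.famMat (fun x n k => deformCoeff θ x.p n.1 (sg x.ε * k.1)) a

theorem not_two_dvd_sg_mul (ε : ZMod 2) (k : Idx 1) : ¬ (2 : ℤ) ∣ sg ε * k.1 := by
  have := k.not_two_dvd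
  rcases sg_eq_or ε with h | h <;> rw [h] <;> omega

theorem IsLoop.not_two_dvd {a : Series C} (ha : E.IsLoop 0 1 a) {x : Dih} (hx : a x.ε x.p ≠ 0) :
    ¬ (2 : ℤ) ∣ x.p := by
  have h : (x.p : ZMod 2) = 1 := by
    by_contra h; exact hx (ha.eq_zero _ _ (by rwa [zero_add]))
  exact Idx.not_two_dvd ⟨x.p, h⟩

theorem deformMat_zero {a : Series C} (ha : E.IsLoop 0 1 a) :
    E.deformMat a 0 = E.multMat 0 1 a := by
  rw [multMat_eq_famMat]
  refine famMat_congr fun x hx n k => ?_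
  rw [deformCoeff_zero n.two_dvd (not_two_dvd_sg_mul _ k) (ha.not_two_dvd hx)]
  exact if_congr (by omega) rfl rfl

theorem sumWeight_nonneg (n m : ℤ) : 0 ≤ sumWeight n m := by rw [sumWeight]; positivity

theorem diagWeight_le_of_abs_le {n m p B : ℤ} (h : |(|n| - |m|)| ≤ |p| + B) (hB : 0 ≤ B) :
    1 + diagWeight n m ≤ (1 + B) * (1 + |(p : ℝ)|) := by
  have h' : diagWeight n m ≤ |(p : ℝ)| + B := by
    rw [diagWeight]; exact_mod_cast h
  have hB' : (0 : ℝ) ≤ B := by exact_mod_cast hB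
  nlinarith [abs_nonneg (p : ℝ)]

theorem sumWeight_le_of_abs_le {n m p B : ℤ} (h : |n| + |m| ≤ |p| + B) (hB : 0 ≤ B) :
    1 + sumWeight n m ≤ (1 + B) * (1 + |(p : ℝ)|) := by
  have h' : sumWeight n m ≤ |(p : ℝ)| + B := by
    rw [sumWeight]; exact_mod_cast h
  have hB' : (0 : ℝ) ≤ B := by exact_mod_cast hB
  nlinarith [abs_nonneg (p : ℝ)]

theorem abs_sg_mul (ε : ZMod 2) (k : ℤ) : |sg ε * k| = |k| := by
  rcases sg_eq_or ε with h | h <;> simp [h]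

/-- On the diagonal and on the antidiagonal belonging to `p`, ||n| - |k|| ≤ |p|. This is why
tameness is measured by the difference of absolute values. -/
theorem tameLoop_multMat {c d : ZMod 2} {a : Series C} (ha : E.IsLoop (c + i) (d + j) a) :
    E.TameLoop c d (E.multMat i j a) := by
  rw [multMat_eq_famMat]
  refine tameLoop_famMat ha (R := 1) (B := 1 + (0 : ℤ)) (fun x n m => by split_ifs <;> simp)
    fun x _ n m h => diagWeight_le_of_abs_le ?_ le_rfl
  have h1 : n.1 = sg x.ε * m.1 + x.p := by by_contra h1; exact h (if_neg h1)
  rw [← abs_sg_mul x.ε m.1, h1, add_zero]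
  have := abs_abs_sub_abs_le_abs_sub (sg x.ε * m.1 + x.p) (sg x.ε * m.1)
  rwa [add_sub_cancel_left] at this

theorem tameLoop_deformMat {a : Series C} (ha : E.IsLoop 0 1 a) (θ : ℝ) :
    E.TameLoop 0 0 (E.deformMat a θ) :=
  tameLoop_famMat (by rwa [zero_add, zero_add]) (fun _ _ _ => abs_deformCoeff_le _ _ _ _)
    (B := 1 + (2 : ℤ)) fun x _ n m h => diagWeight_le_of_abs_le (by
      have := deformCoeff_support n.two_dvd (not_two_dvd_sg_mul x.ε m) h
      rwa [abs_sg_mul] at this) (by norm_num)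

/-- A nonzero difference forces |n| + |k| ≤ |p| + 2, by `deformCoeff_of_lt`; the decrease of `a` in
`p` then controls both indices. -/
theorem decays_deformMat_sub {a : Series C} (ha : E.IsLoop 0 1 a) (θ φ : ℝ) :
    E.Decays sumWeight (E.deformMat a θ - E.deformMat a φ) := by
  have h : E.deformMat a θ - E.deformMat a φ = E.famMat (fun x (n : Idx 0) (k : Idx 1) =>
      deformCoeff θ x.p n.1 (sg x.ε * k.1) - deformCoeff φ x.p n.1 (sg x.ε * k.1)) a :=
    E.ro_injective fun n m x => by
      rw [ro_sub, deformMat, deformMat, ro_famMat, ro_famMat, ro_famMat, sub_smul]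
  rw [h]
  refine decays_famMat (c := 0) (d := 0) sumWeight_nonneg (by rwa [zero_add, zero_add])
    (R := 4) (B := 1 + (2 : ℤ)) (fun x n m => ?_)
    fun x _ n m h => sumWeight_le_of_abs_le (not_lt.1 fun hlt => h ?_) (by norm_num)
  · refine (abs_sub _ _).trans ?_
    linarith [abs_deformCoeff_le θ x.p n.1 (sg x.ε * m.1),
      abs_deformCoeff_le φ x.p n.1 (sg x.ε * m.1)]
  · rw [← abs_sg_mul x.ε m.1] at hlt
    rw [deformCoeff_of_lt θ n.two_dvd (not_two_dvd_sg_mul _ _) hlt,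
      deformCoeff_of_lt φ n.two_dvd (not_two_dvd_sg_mul _ _) hlt, sub_self]

variable [IsUniformAddGroup C] [ContinuousSMul ℝ C] [LocallyConvexSpace ℝ C] [T2Space C]

theorem deformMat_mul_fMat (hE : E.SeqComplete) {a : Series C} (ha : E.IsLoop 0 1 a) (θ : ℝ) :
    E.deformMat a θ ⬝ E.realMat (fMat 1 θ) = E.realMat (fMat 0 θ) ⬝ E.multMat 0 1 a := by
  have hU : E.TameLoop 0 0 (E.multMat 0 1 a) := tameLoop_multMat (by rwa [zero_add, zero_add])
  rw [multMat_eq_famMat] at hU ⊢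
  rw [realMat_mul_famMat hE (by rwa [zero_add]) hU (tameLoop_fMat 0 θ) fun x hx n m =>
    hasSum_fMat_mul θ n fun l => if l = sg x.ε * m.1 + x.p then 1 else 0]
  refine famMat_mul_realMat hE (by rwa [zero_add]) (tameLoop_deformMat ha θ) (tameLoop_fMat 1 θ)
    fun x hx n m => ?_
  have h := hasSum_mul_fMat θ m fun l => deformCoeff θ x.p n.1 (sg x.ε * l)
  have h2 := deformCoeff_fMat θ n.two_dvd (not_two_dvd_sg_mul x.ε m) (ha.not_two_dvd hx)
  convert h using 1
  simp only [eq_comm (b := sg x.ε * m.1 + x.p)]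
  rw [← h2]
  -- For odd terms the column index enters as -k; the column formula of F is compatible with this
  -- reflection.
  rcases sg_eq_or x.ε with hs | hs
  · simp only [hs, one_mul]
  · simp only [hs, neg_mul, one_mul, Int.sign_neg, neg_add, mul_neg, neg_neg]
    rw [if_congr (show (-m.1 = 1 ∨ -m.1 = -1) ↔ (m.1 = 1 ∨ m.1 = -1) by omega) rfl rfl]

/-- A Toeplitz matrix passes through a shift. It passes through a reflection, and hence through odd
terms, because ω is even in x and its coefficients are symmetric. -/
theorem multMat_mul_toepMat (hE : E.SeqComplete) {a : Series C} (ha : E.IsLoop 0 1 a) {θ : ℝ}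
    (hθ : Real.cos θ ≠ 0) (α : ℝ) :
    E.multMat 0 1 a ⬝ E.realMat (toepMat 1 α θ) = E.realMat (toepMat 0 α θ) ⬝ E.multMat 0 1 a := by
  have hU : E.TameLoop 0 0 (E.multMat 0 1 a) := tameLoop_multMat (by rwa [zero_add, zero_add])
  rw [multMat_eq_famMat] at hU ⊢
  have key : ∀ x : Dih, a x.ε x.p ≠ 0 → ∀ (n : Idx 0) (m : Idx 1),
      (((sg x.ε * (n.1 - x.p) : ℤ) : ZMod 2) = 1) ∧ ((sg x.ε * m.1 + x.p : ℤ) : ZMod 2) = 0 := by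
    intro x hx n m
    have hp := ha.not_two_dvd hx
    have hn := n.two_dvd
    have hm := m.not_two_dvd
    have hs : ¬ (2 : ℤ) ∣ sg x.ε * (n.1 - x.p) ∧ (2 : ℤ) ∣ sg x.ε * m.1 + x.p := by
      rcases sg_eq_or x.ε with h | h <;> rw [h] <;> omega
    refine ⟨?_, (ZMod.intCast_zmod_eq_zero_iff_dvd _ 2).2 hs.2⟩
    have := mt (ZMod.intCast_zmod_eq_zero_iff_dvd _ 2).1 hs.1
    rcases zmod_two_cases ((sg x.ε * (n.1 - x.p) : ℤ) : ZMod 2) with h | h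
    · exact absurd h this
    · exact h
  rw [realMat_mul_famMat hE (M' := fun x n m => powCoeff α θ ((n.1 - (sg x.ε * m.1 + x.p)) / 2))
    (by rwa [zero_add]) hU (tameLoop_toepMat hθ 0 α) fun x hx n m => ?_]
  · refine famMat_mul_realMat hE (by rwa [zero_add]) hU (tameLoop_toepMat hθ 1 α)
      fun x hx n m => ?_
    have h := hasSum_single_index (key x hx n m).1 (fun l => powCoeff α θ ((l - m.1) / 2)) 1
    rw [one_mul] at h
    convert h using 1
    · funext l
      rw [if_congr (show n.1 = sg x.ε * l.1 + x.p ↔ l.1 = sg x.ε * (n.1 - x.p) by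
        rcases sg_eq_or x.ε with h | h <;> rw [h] <;> omega) rfl rfl]
      rfl
    · have hp := ha.not_two_dvd hx
      have hn := n.two_dvd
      have hm := m.not_two_dvd
      rcases sg_eq_or x.ε with h | h <;> rw [h]
      · congr 1; omega
      · rw [← powCoeff_neg]; congr 1; omega
  · have h := hasSum_single_index (key x hx n m).2 (fun l => powCoeff α θ ((n.1 - l) / 2)) 1
    rw [one_mul] at h
    convert h using 1
    funext l
    rw [mul_comm]
    rfl

/-- X D = X F T = F U T = F T U = D U, with the index sets changing accordingly; the invertible
matrix D^z on ℤ + 1/2 is then cancelled on the right. -/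
theorem deform₀_eq (hE : E.SeqComplete) {a : Series C} (ha : E.IsLoop 0 1 a) {θ : ℝ}
    (hθ : Real.cos θ ≠ 0) : E.deform₀ a θ = E.deformMat a θ := by
  obtain ⟨W, hW⟩ := exists_isInverse_Dz hE hθ
  have hX := tameLoop_deformMat ha θ
  have hD := tameLoop_Dz hE hθ 1 (E := E)
  have hU : E.TameLoop 0 0 (E.multMat 0 1 a) := tameLoop_multMat (by rwa [zero_add, zero_add])
  have h : E.deformMat a θ ⬝ E.Dz 1 θ = E.Dz 0 θ ⬝ E.multMat 0 1 a := by
    rw [Dz_eq hE hθ, Dz_eq hE hθ, ← mulM_assoc hE hX (tameLoop_fMat 1 θ) (tameLoop_toepMat hθ 1 _),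
      deformMat_mul_fMat hE ha, mulM_assoc hE (tameLoop_fMat 0 θ) hU (tameLoop_toepMat hθ 1 _),
      multMat_mul_toepMat hE ha hθ, mulM_assoc hE (tameLoop_fMat 0 θ) (tameLoop_toepMat hθ 0 _) hU]
  rw [deform₀, hW.inv_eq hE hD, ← h, mulM_assoc hE hX hD hW.tameLoop, hW.mul_inv, mulM_oneM hE hX]

theorem continuous_deformMat (a : Series C) : Continuous (E.deformMat a) := by
  refine continuous_pi fun n => continuous_pi fun m => continuous_pi fun ε => continuous_pi
    fun p => ?_
  unfold deformMat famMat
  exact ((continuous_const.mul (((continuous_deformCoeff _ _ _)).smul continuous_const)).mul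
    continuous_const)

theorem dense_cos_ne_zero : Dense {θ : ℝ | Real.cos θ ≠ 0} := by
  refine Set.Countable.dense_compl ℝ (s := {θ : ℝ | Real.cos θ = 0}) ?_
  refine (Set.countable_range fun k : ℤ => (2 * (k : ℝ) + 1) * Real.pi / 2).mono fun θ hθ => ?_
  obtain ⟨k, hk⟩ := Real.cos_eq_zero_iff.1 hθ
  exact ⟨k, hk.symm⟩

theorem deform_eq (hE : E.SeqComplete) {a : Series C} (ha : E.IsLoop 0 1 a) :
    E.deform a = E.deformMat a := by
  funext θ
  refine extendFrom_eq (dense_cos_ne_zero θ) ?_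
  refine (((continuous_deformMat a).tendsto θ).mono_left nhdsWithin_le_nhds).congr' ?_
  filter_upwards [self_mem_nhdsWithin] with φ hφ using (deform₀_eq hE ha hφ).symm

end CyclicExtension

end CyclicLoop

/-! ### The matrix Û(a) and its inverse. -/

namespace CyclicLoop

section Series

variable {C : Type*} [Ring C] [TopologicalSpace C]

theorem zero_mulS (f : Series C) : 0 ⋄ f = 0 := by
  funext ε p; simp [mulS]

theorem mulS_zero (f : Series C) : f ⋄ 0 = 0 := by
  funext ε p; simp [mulS]

theorem diag_mulM_apply {i j : ZMod 2} {A : Mat C i i} {B : Mat C i j}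
    (hA : ∀ n m, n ≠ m → A n m = 0) (n : Idx i) (m : Idx j) : (A ⬝ B) n m = A n n ⋄ B n m :=
  tsum_eq_single n fun l hl => by rw [hA n l hl.symm, zero_mulS]

theorem mulM_diag_apply {i j : ZMod 2} {A : Mat C i j} {B : Mat C j j}
    (hB : ∀ n m, n ≠ m → B n m = 0) (n : Idx i) (m : Idx j) : (A ⬝ B) n m = A n m ⋄ B m m :=
  tsum_eq_single m fun l hl => by rw [hB l m hl, mulS_zero]

variable [Algebra ℝ C] [IsTopologicalRing C] [ContinuousSMul ℝ C] [T2Space C]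

theorem parity_apply (f : Series C) (ε : ZMod 2) (p : ℤ) :
    parity f ε p = (sg ε : ℝ) • f ε p := by
  rcases zmod_two_cases ε with rfl | rfl <;> simp [parity, sg_zero, sg_one]

theorem smul_mulS (r : ℝ) (f g : Series C) : (r • f) ⋄ g = r • (f ⋄ g) := by
  funext ε p
  simp only [mulS, Pi.smul_apply, smul_mul_assoc, tsum_const_smul'', smul_add]

theorem mulS_smul (r : ℝ) (f g : Series C) : f ⋄ (r • g) = r • (f ⋄ g) := by
  funext ε p
  simp only [mulS, Pi.smul_apply, mul_smul_comm, tsum_const_smul'', smul_add]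

/-- The grading involution is multiplicative, so the sign change of odd terms in Û does not affect
products. -/
theorem parity_mulS_parity (f g : Series C) : parity f ⋄ parity g = parity (f ⋄ g) := by
  funext ε p
  rcases zmod_two_cases ε with rfl | rfl
  · simp [mulS, parity]
  · have h : (1 + 1 : ZMod 2) = 0 := by decide
    simp only [mulS, parity, h, one_ne_zero, if_true, if_false, mul_neg, neg_mul, tsum_neg, neg_add]

theorem parity_zero : parity (0 : Series C) = 0 := by funext ε p; simp [parity]

theorem parity_oneS (c : ZMod 2) : parity (oneS c : Series C) = oneS c := by
  funext ε p
  rcases zmod_two_cases ε with rfl | rfl <;> simp [parity, oneS, mono]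

end Series

section Sums

theorem hasSum_of_range_compl {α β V : Type*} [AddCommGroup V] [TopologicalSpace V]
    [ContinuousAdd V] {e : α → β} (he : Function.Injective e) {x : β} (hx : x ∉ Set.range e)
    (hr : ∀ y, y ≠ x → y ∈ Set.range e) {g : β → V} {S : V} (h : HasSum (g ∘ e) S) :
    HasSum g (S + g x) := by
  classical
  have h1 : HasSum (Function.update g x 0) S := by
    rw [← he.hasSum_iff (f := Function.update g x 0)]
    · refine h.congr_fun fun y => ?_
      exact Function.update_of_ne (fun h' => hx ⟨y, h'⟩) _ _
    · intro y hy
      by_cases hyx : y = x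
      · rw [hyx, Function.update_self]
      · exact absurd (hr y hyx) hy
  refine (h1.add (hasSum_ite_eq x (g x))).congr_fun fun y => ?_
  by_cases hyx : y = x
  · simp [hyx]
  · simp [hyx]

variable {V : Type*} [AddCommGroup V] [Module ℝ V] [TopologicalSpace V]
  [IsTopologicalAddGroup V] [ContinuousConstSMul ℝ V]

/-- The map k ↦ k - sgn k from odd to even integers takes the value 0 at k = ±1 and every other
value once. The weight 1/2 at ±1 corrects the double counting; it is the square of the entry √2/2 in
Û. -/
theorem hasSum_sub_sign {G : ℤ → V} {S : V} (h : HasSum (fun l : Idx 0 => G l.1) S) :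
    HasSum (fun k : Idx 1 => (if k.1 = 1 ∨ k.1 = -1 then (1 / 2 : ℝ) else 1) •
      G (k.1 - k.1.sign)) S := by
  have h1 : ∀ l : Idx 0, ((if 0 ≤ l.1 then l.1 + 1 else l.1 - 1 : ℤ) : ZMod 2) = 1 := by
    intro l
    split_ifs <;> push_cast <;> rw [l.2] <;> decide
  set e : Idx 0 → Idx 1 := fun l => ⟨if 0 ≤ l.1 then l.1 + 1 else l.1 - 1, h1 l⟩ with he
  have hv : ∀ l, (e l).1 = if 0 ≤ l.1 then l.1 + 1 else l.1 - 1 := fun l => rfl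
  have hs : ∀ l, (e l).1 - (e l).1.sign = l.1 := by
    intro l
    rw [hv]
    split_ifs with h
    · rw [Int.sign_eq_one_of_pos (by omega)]; ring
    · rw [Int.sign_eq_neg_one_of_neg (by omega)]; ring
  have hi : Function.Injective e := fun l l' h => by
    ext; rw [← hs l, ← hs l', h]
  -- The section `e` sends 0 to 1 and omits -1, so half of `G 0` is removed here and returns as the
  -- summand at -1.
  have h0 : HasSum (fun l : Idx 0 => if l = ⟨0, by decide⟩ then (1 / 2 : ℝ) • G 0 else 0)
    ((1 / 2 : ℝ) • G 0) := hasSum_ite_eq _ _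
  have h2 := h.sub h0
  have h3 := hasSum_of_range_compl hi (x := (⟨-1, by decide⟩ : Idx 1)) ?_ ?_
    (g := fun k : Idx 1 => (if k.1 = 1 ∨ k.1 = -1 then (1 / 2 : ℝ) else 1) •
      G (k.1 - k.1.sign)) (h2.congr_fun fun l => ?_)
  · convert h3 using 1
    simp
  · rintro ⟨l, hl⟩
    have := congrArg Subtype.val hl
    rw [hv] at this
    split_ifs at this <;> simp at this <;> omega
  · intro y hy
    have hy' : y.1 ≠ -1 := fun h => hy (Subtype.ext h)
    obtain ⟨u, hu⟩ := y.odd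
    by_cases hp : 0 < y.1
    · refine ⟨⟨2 * u, by push_cast; rw [show (2 : ZMod 2) = 0 from rfl, zero_mul]⟩, ?_⟩
      ext; rw [hv]; simp only; rw [if_pos (by omega), hu]; ring
    · refine ⟨⟨2 * (u + 1), by push_cast; rw [show (2 : ZMod 2) = 0 from rfl, zero_mul]⟩, ?_⟩
      ext; rw [hv]; simp only; rw [if_neg (by omega), hu]; ring
  · simp only [Function.comp_apply, hs]
    by_cases hl : l.1 = 0
    · rw [if_pos (show l = ⟨0, _⟩ from Subtype.ext hl), if_pos (by rw [hv, hl]; simp), hl]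
      module
    · rw [if_neg (show ¬ l = ⟨0, _⟩ from fun h => hl (congrArg Subtype.val h)), if_neg, one_smul,
        sub_zero]
      rw [hv]; split_ifs <;> omega

/-- On nonzero even integers n ↦ n - sgn n is a bijection onto the odd integers; the index 0
contributes the extra summand. -/
theorem hasSum_sub_sign_add {G : ℤ → V} {S : V} (v : V) (h : HasSum (fun l : Idx 1 => G l.1) S) :
    HasSum (fun n : Idx 0 => if n.1 = 0 then v else G (n.1 - n.1.sign)) (S + v) := by
  have h1 : ∀ l : Idx 1, ((l.1 + l.1.sign : ℤ) : ZMod 2) = 0 := by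
    intro l
    obtain ⟨u, hu⟩ := l.odd
    refine (ZMod.intCast_zmod_eq_zero_iff_dvd _ 2).2 ?_
    rcases lt_or_gt_of_ne (show l.1 ≠ 0 by omega) with h | h
    · rw [Int.sign_eq_neg_one_of_neg h]; omega
    · rw [Int.sign_eq_one_of_pos h]; omega
  set e : Idx 1 → Idx 0 := fun l => ⟨l.1 + l.1.sign, h1 l⟩ with he
  have hv : ∀ l, (e l).1 = l.1 + l.1.sign := fun l => rfl
  have hs : ∀ l, (e l).1 - (e l).1.sign = l.1 ∧ (e l).1 ≠ 0 := by
    intro l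
    obtain ⟨u, hu⟩ := l.odd
    rw [hv]
    rcases lt_or_gt_of_ne (show l.1 ≠ 0 by omega) with h | h
    · rw [Int.sign_eq_neg_one_of_neg h, Int.sign_eq_neg_one_of_neg (by omega)]; omega
    · rw [Int.sign_eq_one_of_pos h, Int.sign_eq_one_of_pos (by omega)]; omega
  have hi : Function.Injective e := fun l l' h => by
    ext; rw [← (hs l).1, ← (hs l').1, h]
  have h3 := hasSum_of_range_compl hi (x := (⟨0, by decide⟩ : Idx 0)) ?_ ?_
    (g := fun n : Idx 0 => if n.1 = 0 then v else G (n.1 - n.1.sign)) (h.congr_fun fun l => ?_)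
  · simpa using h3
  · rintro ⟨l, hl⟩
    exact (hs l).2 (congrArg Subtype.val hl)
  · intro y hy
    have hy' : y.1 ≠ 0 := fun h => hy (Subtype.ext h)
    obtain ⟨u, hu⟩ := y.even
    rcases lt_or_gt_of_ne hy' with h | h
    · refine ⟨⟨2 * u + 1, by push_cast; rw [show (2 : ZMod 2) = 0 from rfl, zero_mul, zero_add]⟩, ?_⟩
      ext; rw [hv]; simp only; rw [Int.sign_eq_neg_one_of_neg (by omega), hu]; ring
    · refine ⟨⟨2 * u - 1, by
        push_cast; rw [show (2 : ZMod 2) = 0 from rfl, zero_mul]; decide⟩, ?_⟩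
      ext; rw [hv]; simp only; rw [Int.sign_eq_one_of_pos (by omega), hu]; ring
  · simp only [Function.comp_apply, (hs l).1, if_neg (hs l).2]

end Sums

theorem abs_half_sqrt_two_le : |√2 / 2| ≤ 1 := by
  rw [abs_of_nonneg (by positivity), div_le_one (by norm_num)]
  exact Real.sqrt_le_iff.2 (by norm_num)

theorem half_sqrt_two_mul_self : √2 / 2 * (√2 / 2) = 1 / 2 := by
  have := Real.mul_self_sqrt (show (0 : ℝ) ≤ 2 by norm_num)
  linear_combination this / 4

theorem cast_sign_odd {n : ℤ} (hn : n ≠ 0) : ((n.sign : ℤ) : ZMod 2) = 1 := by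
  rcases lt_or_gt_of_ne hn with h | h
  · rw [Int.sign_eq_neg_one_of_neg h]; decide
  · rw [Int.sign_eq_one_of_pos h]; decide

theorem abs_sign_le_one (n : ℤ) : |n.sign| ≤ 1 := by
  rcases lt_trichotomy n 0 with h | rfl | h
  · rw [Int.sign_eq_neg_one_of_neg h]; decide
  · decide
  · rw [Int.sign_eq_one_of_pos h]; decide

namespace CyclicExtension

variable {C : Type*} [Ring C] [Algebra ℝ C] [UniformSpace C] [IsTopologicalRing C]
  {E : CyclicExtension C} {i j : ZMod 2}

variable (E) in
/-- The matrix with entries of a multiplication matrix, with the index `0` inserted. -/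
noncomputable def bordMat (r : Idx i → Idx j → ℝ) (a : Series C) : Mat C i j := fun n m =>
  r n m • parity (E.multEntry a (n.1 - n.1.sign) (m.1 - m.1.sign))

/-- The multiplication entry is naturally rotated by n - sgn n and m - sgn m, so the full rotation
leaves powers z^{±1/2} outside and shifts the degree. -/
theorem ro_bordMat (r : Idx i → Idx j → ℝ) (a : Series C) (n : Idx i) (m : Idx j) (x : Dih) :
    E.ro (E.bordMat r a) n m x =
      if n.1 - n.1.sign = sg x.ε * (m.1 - m.1.sign) + (x.p - n.1.sign + sg x.ε * m.1.sign) then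
        (r n m * sg x.ε) • (E.zp n.1.sign * a x.ε (x.p - n.1.sign + sg x.ε * m.1.sign) *
          E.zp (-m.1.sign)) else 0 := by
  have h := E.conj_multEntry a (n.1 - n.1.sign) (m.1 - m.1.sign) x.ε
    (x.p - n.1.sign + sg x.ε * m.1.sign)
  rw [show x.p - n.1.sign + sg x.ε * m.1.sign - (n.1 - n.1.sign) + sg x.ε * (m.1 - m.1.sign) =
    x.p - n.1 + sg x.ε * m.1 by ring] at h
  rw [ro_apply, bordMat, Pi.smul_apply, Pi.smul_apply]
  have hp : ∀ f : Series C, parity f x.ε (x.p - n.1 + sg x.ε * m.1) =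
      (sg x.ε : ℝ) • f x.ε (x.p - n.1 + sg x.ε * m.1) := fun f => by
    rcases zmod_two_cases x.ε with h | h <;> simp [parity, h, sg_zero, sg_one]
  rw [hp, smul_smul, mul_smul_comm, smul_mul_assoc,
    show E.zp n.1 = E.zp n.1.sign * E.zp (n.1 - n.1.sign) by rw [← zp_add]; congr 1; ring,
    show E.zp (-m.1) = E.zp (-(m.1 - m.1.sign)) * E.zp (-m.1.sign) by
      rw [← zp_add]; congr 1; ring]
  rw [show ∀ s t u v w : Half C, s * t * u * (v * w) = s * (t * u * v) * w by
    intros; simp only [mul_assoc], h]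
  split_ifs <;> simp

theorem tameLoop_bordMat {r : Idx i → Idx j → ℝ} {a : Series C} (ha : E.IsLoop i j a)
    (hr : ∀ n m, |r n m| ≤ 1) (hr' : ∀ n m, r n m ≠ 0 → n.1 ≠ 0 ∧ m.1 ≠ 0) :
    E.TameLoop 1 1 (E.bordMat r a) where
  mem n m x := by
    rw [ro_bordMat]
    by_cases hz : r n m = 0
    · rw [hz, zero_mul, zero_smul, ite_self]; exact zero_mem _
    split_ifs with h
    · refine Submodule.smul_mem _ _ (E.term_conj (E.isLoop_mem_term ha
        ⟨x.ε, x.p - n.1.sign + sg x.ε * m.1.sign⟩) ?_ ?_ rfl (by simp only; ring))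
      · rw [cast_sign_odd (hr' n m hz).1, add_comm]
      · rw [cast_sign_odd (hr' n m hz).2, add_comm]
    · exact zero_mem _
  tame := by
    -- The sign shifts change the index weight and the degree by at most 2 each, and 1 + (P + 2) +
    -- (P + 2) ≤ 5 (1 + P).
    refine Decays.of_series diagWeight_nonneg ha.rapid (M := 5) (R := 1) fun n m x => ?_
    rw [ro_bordMat]
    by_cases h : n.1 - n.1.sign = sg x.ε * (m.1 - m.1.sign) + (x.p - n.1.sign + sg x.ε * m.1.sign)
    · rw [if_pos h]
      refine Or.inr ⟨_, n.1.sign, -m.1.sign, ⟨x.ε, x.p - n.1.sign + sg x.ε * m.1.sign⟩, ?_,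
        abs_sign_le_one _, ?_, ?_, rfl⟩
      · rw [abs_mul]
        refine mul_le_one₀ (hr n m) (abs_nonneg _) ?_
        rcases sg_eq_or x.ε with h | h <;> rw [h] <;> simp
      · rw [abs_neg]; exact abs_sign_le_one _
      · have h1 := abs_sign_le_one n.1
        have h2 := abs_sign_le_one m.1
        have h3 : |(|n.1| - |m.1|)| ≤ |x.p - n.1.sign + sg x.ε * m.1.sign| + 2 := by
          generalize n.1.sign = t at *
          generalize m.1.sign = u at *
          rcases sg_eq_or x.ε with h' | h' <;> rw [h'] at h ⊢ <;>
            rcases abs_cases n.1 with h3 | h3 <;> rcases abs_cases m.1 with h4 | h4 <;>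
            rcases abs_cases (|n.1| - |m.1|) with h5 | h5 <;>
            rcases abs_cases t with h6 | h6 <;> rcases abs_cases u with h7 | h7 <;>
            have h8 := abs_le.1 (le_refl |x.p - t + 1 * u|) <;>
            have h9 := abs_le.1 (le_refl |x.p - t + -1 * u|) <;> omega
        have h4 : |x.p| ≤ |x.p - n.1.sign + sg x.ε * m.1.sign| + 2 := by
          generalize n.1.sign = t at *
          generalize m.1.sign = u at *
          rcases sg_eq_or x.ε with h' | h' <;> rw [h'] <;>
            rcases abs_cases x.p with h5 | h5 <;>
            rcases abs_cases t with h6 | h6 <;> rcases abs_cases u with h7 | h7 <;>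
            have h8 := abs_le.1 (le_refl |x.p - t + 1 * u|) <;>
            have h9 := abs_le.1 (le_refl |x.p - t + -1 * u|) <;> omega
        have h3' : diagWeight n.1 m.1 ≤
            |((x.p - n.1.sign + sg x.ε * m.1.sign : ℤ) : ℝ)| + 2 := by
          rw [diagWeight]; exact_mod_cast h3
        have h4' : |(x.p : ℝ)| ≤ |((x.p - n.1.sign + sg x.ε * m.1.sign : ℤ) : ℝ)| + 2 := by
          exact_mod_cast h4
        have h0 := abs_nonneg ((x.p - n.1.sign + sg x.ε * m.1.sign : ℤ) : ℝ)
        simp only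
        linarith
    · exact Or.inl (if_neg h)

/-- A real matrix supported on indices of absolute value at most `1/2`, as a matrix over
`𝔅^{1,1}`. -/
def cornerMat (r : Idx i → Idx j → ℝ) : Mat C i j := fun n m => r n m • oneS 1

theorem ro_cornerMat (r : Idx i → Idx j → ℝ) (n : Idx i) (m : Idx j) (x : Dih) :
    E.ro (cornerMat r) n m x = if x = ⟨0, n.1 - m.1⟩ then
      r n m • (E.zp n.1 * oneS 1 0 0 * E.zp (-m.1)) else 0 := by
  obtain ⟨ε, p⟩ := x
  rw [ro_apply, cornerMat]
  simp only [Pi.smul_apply, oneS, mono, Dih.mk.injEq, true_and, if_true]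
  rcases zmod_two_cases ε with rfl | rfl
  · simp only [true_and, sg_zero, one_mul]
    by_cases h : p = n.1 - m.1
    · rw [if_pos h, if_pos (by omega), mul_smul_comm, smul_mul_assoc]
    · rw [if_neg h, if_neg (by omega)]; simp
  · simp

variable [IsUniformAddGroup C] [ContinuousSMul ℝ C] [LocallyConvexSpace ℝ C] [T2Space C]

theorem tameLoop_cornerMat {r : Idx i → Idx j → ℝ} (hr : ∀ n m, |r n m| ≤ 1)
    (hr' : ∀ n m, r n m ≠ 0 → |n.1| ≤ 1 ∧ |m.1| ≤ 1) : E.TameLoop 1 1 (cornerMat r) where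
  mem n m x := by
    rw [ro_cornerMat]
    split_ifs with h
    · exact Submodule.smul_mem _ _ (E.term_conj (E.isLoop_mem_term (isLoop_oneS 1) 1)
        (by rw [n.2]) (by rw [m.2]) (by rw [h]; rfl) (by rw [h]; simp [sg_zero]))
    · exact zero_mem _
  tame := by
    refine Decays.of_series diagWeight_nonneg (E.isLoop_oneS 1).rapid (M := 5) (R := 1)
      fun n m x => ?_
    rw [ro_cornerMat]
    by_cases h : x = ⟨0, n.1 - m.1⟩
    · rw [if_pos h]
      by_cases hz : r n m = 0
      · left; rw [hz, zero_smul]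
      obtain ⟨h1, h2⟩ := hr' n m hz
      refine Or.inr ⟨_, n.1, -m.1, 1, hr n m, h1, by rwa [abs_neg], ?_, rfl⟩
      have h3 : |(|n.1| - |m.1|)| ≤ 1 := by
        have := abs_nonneg n.1; have := abs_nonneg m.1
        rw [abs_le]; omega
      have h4 : |x.p| ≤ 2 := by
        rw [abs_le] at *; rw [h]; simp only; omega
      have h3' : diagWeight n.1 m.1 ≤ 1 := by rw [diagWeight]; exact_mod_cast h3
      have h4' : |(x.p : ℝ)| ≤ 2 := by exact_mod_cast h4
      have h0 := abs_nonneg (((1 : Dih).p : ℤ) : ℝ)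
      linarith
    · exact Or.inl (if_neg h)

/-- The weights `√2/2` at `±1/2` in the matrix `Û`. -/
noncomputable def halfWeight (k : ℤ) : ℝ := if k = 1 ∨ k = -1 then √2 / 2 else 1

theorem abs_halfWeight_le (k : ℤ) : |halfWeight k| ≤ 1 := by
  rw [halfWeight]; split_ifs
  · exact abs_half_sqrt_two_le
  · simp

theorem halfWeight_mul_self (k : ℤ) :
    halfWeight k * halfWeight k = if k = 1 ∨ k = -1 then (1 / 2 : ℝ) else 1 := by
  rw [halfWeight]; split_ifs
  · exact half_sqrt_two_mul_self
  · simp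

theorem abs_sign_mul_le (n k : ℤ) : |((n.sign * k.sign : ℤ) : ℝ)| ≤ 1 := by
  have h : |n.sign * k.sign| ≤ 1 := by
    rw [abs_mul]; exact mul_le_one₀ (abs_sign_le_one _) (abs_nonneg _) (abs_sign_le_one _)
  exact_mod_cast h

variable (E) in
/-- The inverse of the matrix `Û(a)`, where `b` is the inverse of `a`. -/
noncomputable def hatInv (b : Series C) : Mat C 1 0 := fun k n =>
  if n.1 = 0 then (if k.1 = 1 ∨ k.1 = -1 then (√2 / 2) • oneS 1 else 0)
  else (((k.1.sign * n.1.sign : ℤ) : ℝ) * halfWeight k.1) •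
    parity (E.multEntry b (k.1 - k.1.sign) (n.1 - n.1.sign))

theorem hatMat_eq (a : Series C) : E.hatMat a =
    E.bordMat (fun (n : Idx 0) (k : Idx 1) => ((n.1.sign * k.1.sign : ℤ) : ℝ) * halfWeight k.1) a +
      cornerMat fun n k => if n.1 = 0 ∧ (k.1 = 1 ∨ k.1 = -1) then √2 / 2 else 0 := by
  funext n k
  simp only [Pi.add_apply, hatMat, bordMat, cornerMat]
  by_cases h : n.1 = 0
  · simp only [h, Int.sign_zero, zero_mul, Int.cast_zero, zero_smul, zero_add, if_true, true_and]
    split_ifs <;> simp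
  · simp only [h, if_false, false_and, zero_smul, add_zero, halfWeight]

theorem hatInv_eq (b : Series C) : E.hatInv b =
    E.bordMat (fun (k : Idx 1) (n : Idx 0) => ((k.1.sign * n.1.sign : ℤ) : ℝ) * halfWeight k.1) b +
      cornerMat fun k n => if n.1 = 0 ∧ (k.1 = 1 ∨ k.1 = -1) then √2 / 2 else 0 := by
  funext k n
  simp only [Pi.add_apply, hatInv, bordMat, cornerMat]
  by_cases h : n.1 = 0
  · simp only [h, Int.sign_zero, mul_zero, Int.cast_zero, zero_mul, zero_smul, zero_add, if_true,
      true_and]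
    split_ifs <;> simp
  · simp only [h, if_false, false_and, zero_smul, add_zero]

theorem abs_le_one_of_eq {k : ℤ} (h : k = 1 ∨ k = -1) : |k| ≤ 1 := by
  rcases h with rfl | rfl <;> decide

theorem tameLoop_hatMat {a : Series C} (ha : E.IsLoop 0 1 a) : E.TameLoop 1 1 (E.hatMat a) := by
  rw [hatMat_eq]
  refine (tameLoop_bordMat ha (fun n m => ?_) fun n m h => ?_).add
    (tameLoop_cornerMat (fun n m => ?_) fun n m h => ?_)
  · rw [abs_mul]; exact mul_le_one₀ (abs_sign_mul_le _ _) (abs_nonneg _) (abs_halfWeight_le _)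
  · refine ⟨fun h0 => h (by simp [h0]), fun h0 => h (by simp [h0])⟩
  · split_ifs
    · exact abs_half_sqrt_two_le
    · simp
  · have h' := by_contra fun h' => h (if_neg h')
    exact ⟨by rw [h'.1]; decide, abs_le_one_of_eq h'.2⟩

theorem tameLoop_hatInv {b : Series C} (hb : E.IsLoop 1 0 b) : E.TameLoop 1 1 (E.hatInv b) := by
  rw [hatInv_eq]
  refine (tameLoop_bordMat hb (fun n m => ?_) fun n m h => ?_).add
    (tameLoop_cornerMat (fun n m => ?_) fun n m h => ?_)
  · rw [abs_mul]; exact mul_le_one₀ (abs_sign_mul_le _ _) (abs_nonneg _) (abs_halfWeight_le _)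
  · refine ⟨fun h0 => h (by simp [h0]), fun h0 => h (by simp [h0])⟩
  · split_ifs
    · exact abs_half_sqrt_two_le
    · simp
  · have h' := by_contra fun h' => h (if_neg h')
    exact ⟨abs_le_one_of_eq h'.2, by rw [h'.1]; decide⟩

theorem mulS_oneS {c d : ZMod 2} {f : Series C} (hf : E.IsLoop c d f) : f ⋄ oneS d = f := by
  funext ε p
  rw [oneS, mulS_mono, mul_zero, sub_zero]
  exact (E.term_eq_single (E.isLoop_mem_term hf ⟨ε, p⟩)).2

/-- The matrix with the single entry `u` at `(0, 0)`. -/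
def originMat (u : Series C) : Mat C 0 0 := fun n m => if n.1 = 0 ∧ m.1 = 0 then u else 0

theorem originMat_eq_famMat (u : Series C) :
    originMat u = E.famMat (fun _ (n m : Idx 0) => if n.1 = 0 ∧ m.1 = 0 then 1 else 0) u := by
  funext n m ε p
  rw [originMat, famMat]
  by_cases h : n.1 = 0 ∧ m.1 = 0
  · simp [h.1, h.2, zp_zero]
  · simp [h]

theorem ro_originMat (u : Series C) (n m : Idx 0) (x : Dih) :
    E.ro (originMat u) n m x = if n.1 = 0 ∧ m.1 = 0 then u x.ε x.p else 0 := by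
  rw [originMat_eq_famMat (E := E), ro_famMat]
  split_ifs <;> simp

theorem decays_originMat {c d : ZMod 2} {u : Series C} (hu : E.IsLoop c d u) :
    E.Decays sumWeight (originMat u) := by
  rw [originMat_eq_famMat (E := E)]
  refine decays_famMat (c := c) (d := d) sumWeight_nonneg (by rwa [add_zero, add_zero])
    (R := 1) (B := 1 + (0 : ℤ)) (fun x n m => by split_ifs <;> simp)
    fun x _ n m h => sumWeight_le_of_abs_le ?_ le_rfl
  have h' := by_contra fun h' => h (if_neg h')
  rw [h'.1, h'.2]
  simp

theorem tameLoop_originMat {c d : ZMod 2} {u : Series C} (hu : E.IsLoop c d u) :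
    E.TameLoop c d (originMat u) where
  mem n m x := by
    rw [ro_originMat, add_zero, add_zero]
    split_ifs
    · exact E.isLoop_mem_term hu x
    · exact zero_mem _
  tame := Decays.mono diagWeight_nonneg diagWeight_le_sumWeight (decays_originMat hu)

/-- A series is a matrix with one entry at the origin, where rotation is trivial, so the convolution
formula for matrices specializes to series. -/
theorem tsum_mulS (hE : E.SeqComplete) {k : ZMod 2} {a b : Series C} (ha : E.IsLoop i j a)
    (hb : E.IsLoop j k b) (x : Dih) :
    (a ⋄ b) x.ε x.p = ∑' y : Dih, a y.ε y.p * b (y⁻¹ * x).ε (y⁻¹ * x).p := by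
  set o : Idx 0 := ⟨0, by decide⟩ with ho
  have h := ro_mulM hE (tameLoop_originMat ha) (tameLoop_originMat hb) o o x
  have h1 : (originMat a ⬝ originMat b) o o = a ⋄ b := by
    rw [mulM, tsum_eq_single o]
    · simp [originMat, o]
    · intro l hl
      have : ¬ l.1 = 0 := fun h => hl (Subtype.ext h)
      simp [originMat, this, mulS_zero]
  have h2 : E.ro (originMat a ⬝ originMat b) o o x = (a ⋄ b) x.ε x.p := by
    rw [ro_apply, h1]; simp [o, zp_zero]
  have hinj : Function.Injective fun y : Dih => (o, y) := fun y y' h => (Prod.mk.inj h).2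
  rw [← h2, h, ← hinj.tsum_eq]
  · refine tsum_congr fun y => ?_
    rw [flat, ro_originMat, ro_originMat, if_pos ⟨rfl, rfl⟩, if_pos ⟨rfl, rfl⟩]
  · rintro ⟨l, y⟩ hy
    by_contra hl
    refine hy ?_
    rw [flat, ro_originMat, if_neg, zero_mul]
    exact fun h => hl ⟨y, Prod.ext (Subtype.ext h.2.symm) rfl⟩

/-- The label (ε, p) acts on indices by k ↦ sg ε · k + p, and this is an action of the dihedral
group. Hence for each label `y` of `a` exactly one inner index contributes, and the convolution for
`a ⋄ b` remains. -/
theorem multMat_mul_multMat (hE : E.SeqComplete) {c l : ZMod 2} {a b : Series C}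
    (ha : E.IsLoop (c + i) (c + j) a) (hb : E.IsLoop (c + j) (c + l) b) :
    E.multMat i j a ⬝ E.multMat j l b = E.multMat i l (a ⋄ b) := by
  refine E.ro_injective fun n m x => ?_
  rw [ro_mulM hE (tameLoop_multMat ha) (tameLoop_multMat hb), ro_multMat, tsum_mulS hE ha hb]
  have hsg : sg x.ε = 1 ∨ sg x.ε = -1 := sg_eq_or _
  have hdih : ∀ (y : Dih) (k : ℤ), n.1 = sg y.ε * k + y.p →
      ((k = sg (y⁻¹ * x).ε * m.1 + (y⁻¹ * x).p) ↔ n.1 = sg x.ε * m.1 + x.p) := by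
    intro y k h
    rw [Dih.inv_mul_p, Dih.inv_mul_ε, sg_add, h]
    rcases sg_eq_or y.ε with h1 | h1 <;> rcases hsg with h2 | h2 <;> rw [h1, h2] <;> omega
  have hpar : ∀ y : {y : Dih // (y.p : ZMod 2) = i + j},
      ((sg y.1.ε * (n.1 - y.1.p) : ℤ) : ZMod 2) = j := by
    intro y
    have h1 : (((n.1 - y.1.p) : ℤ) : ZMod 2) = j := by
      push_cast; rw [y.2, n.2, sub_add_cancel_left, neg_two]
    rw [Int.cast_mul, h1, cast_sg, one_mul]
  -- The first component is that unique inner index, the solution k of n = sg ε · k + p.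
  set φ : {y : Dih // (y.p : ZMod 2) = i + j} → Idx j × Dih := fun y => (⟨_, hpar y⟩, y.1) with hφ
  have hφi : Function.Injective φ := fun y y' h => Subtype.ext (Prod.mk.inj h).2
  have hz : ∀ y : Dih, a y.ε y.p ≠ 0 → (y.p : ZMod 2) = i + j := by
    intro y hy
    by_contra h
    refine hy (ha.eq_zero _ _ fun h' => h ?_)
    rw [h', add_add_add_comm, add_self_two, zero_add]
  have hval : ∀ y, E.flat (E.multMat i j a) (E.multMat j l b) n m x (φ y) =
      if n.1 = sg x.ε * m.1 + x.p then a y.1.ε y.1.p * b (y.1⁻¹ * x).ε (y.1⁻¹ * x).p else 0 := by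
    intro y
    have hn : n.1 = sg y.1.ε * (sg y.1.ε * (n.1 - y.1.p)) + y.1.p := by
      rcases sg_eq_or y.1.ε with h1 | h1 <;> rw [h1] <;> omega
    rw [flat, ro_multMat, ro_multMat, if_pos hn, if_congr (hdih y.1 _ hn) rfl rfl]
    split_ifs
    · rfl
    · exact mul_zero _
  rw [← hφi.tsum_eq]
  · simp only [hval]
    split_ifs with h
    · refine Subtype.val_injective.tsum_eq (f := fun y : Dih =>
        a y.ε y.p * b (y⁻¹ * x).ε (y⁻¹ * x).p) fun y hy => ⟨⟨y, hz y fun h0 => hy ?_⟩, rfl⟩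
      simp only [h0, zero_mul]
    · exact tsum_zero
  · rintro ⟨k, y⟩ hy
    have h1 : a y.ε y.p ≠ 0 := fun h0 => hy (by rw [flat, ro_multMat, h0, ite_self, zero_mul])
    have h2 : n.1 = sg y.ε * k.1 + y.p := by
      by_contra h0; exact hy (by rw [flat, ro_multMat, if_neg h0, zero_mul])
    refine ⟨⟨y, hz y h1⟩, Prod.ext (Subtype.ext ?_) rfl⟩
    change sg y.ε * (n.1 - y.p) = k.1
    rcases sg_eq_or y.ε with h1 | h1 <;> rw [h1] at h2 ⊢ <;> omega

theorem multMat_oneS (c : ZMod 2) : E.multMat i i (oneS (c + i)) = oneM c i := by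
  refine E.ro_injective fun n m x => ?_
  rw [ro_multMat, ro_oneM, oneS_apply]
  by_cases hx : x = 1
  · rw [hx, Dih.one_ε, Dih.one_p, sg_zero, one_mul, add_zero]
    simp [Subtype.ext_iff]
  · simp [hx]

theorem hasSum_multEntry (hE : E.SeqComplete) {c : ZMod 2} {a b : Series C}
    (ha : E.IsLoop (c + i) (c + j) a) (hb : E.IsLoop (c + j) (c + i) b)
    (hab : a ⋄ b = oneS (c + i)) (n m : Idx i) :
    HasSum (fun k : Idx j => E.multEntry a n.1 k.1 ⋄ E.multEntry b k.1 m.1)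
      (if n.1 = m.1 then oneS c else 0) := by
  have h := ((summableM hE (tameLoop_multMat ha) (tameLoop_multMat hb)).2 n m).hasSum
  have h1 := congrFun (congrFun (multMat_mul_multMat hE ha hb) n) m
  rw [hab, multMat_oneS] at h1
  rw [mulM] at h1
  rw [h1] at h
  simp only [oneM, Subtype.ext_iff] at h
  exact h

theorem hasSum_parity {ι : Type*} {f : ι → Series C} {S : Series C} (h : HasSum f S) :
    HasSum (fun x => parity (f x)) (CyclicLoop.parity S) := by
  refine Pi.hasSum.2 fun ε => Pi.hasSum.2 fun p => ?_
  simp only [parity_apply]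
  exact (Pi.hasSum.1 (Pi.hasSum.1 h ε) p).const_smul _

theorem sub_sign_inj {n m : ℤ} (hn : n ≠ 0) (hm : m ≠ 0) (hn2 : 2 ∣ n) (hm2 : 2 ∣ m) :
    n - n.sign = m - m.sign ↔ n = m := by
  rcases lt_or_gt_of_ne hn with h | h <;> rcases lt_or_gt_of_ne hm with h' | h' <;>
    simp only [Int.sign_eq_neg_one_of_neg, Int.sign_eq_one_of_pos, h, h'] <;> omega

theorem sign_mul_self {n : ℤ} (hn : n ≠ 0) : ((n.sign : ℤ) : ℝ) * n.sign = 1 := by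
  have : n.sign * n.sign = 1 := by
    rcases lt_or_gt_of_ne hn with h | h
    · rw [Int.sign_eq_neg_one_of_neg h]; rfl
    · rw [Int.sign_eq_one_of_pos h]; rfl
  exact_mod_cast this

/-- Row 0 is symmetric in ±1/2 and every other row is antisymmetric there, so the border decouples.
The remaining rows reproduce U(a) U(b) = 1. -/
theorem hatMat_mul_hatInv (hE : E.SeqComplete) {a b : Series C} (ha : E.IsLoop 0 1 a)
    (hb : E.IsLoop 1 0 b) (hab : a ⋄ b = oneS 0) : E.hatMat a ⬝ E.hatInv b = oneM 1 0 := by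
  funext n m
  have hS := ((summableM hE (tameLoop_hatMat ha) (tameLoop_hatInv hb)).2 n m)
  set o : Idx 0 := ⟨0, by decide⟩
  set p₁ : Idx 1 := ⟨1, by decide⟩
  set p₂ : Idx 1 := ⟨-1, by decide⟩
  have hp : p₁ ≠ p₂ := fun h => absurd (congrArg Subtype.val h) (by decide)
  have hpm : ∀ k : Idx 1, (k.1 = 1 ∨ k.1 = -1) ↔ (k = p₁ ∨ k = p₂) := fun k => by
    rw [Subtype.ext_iff, Subtype.ext_iff]
  rw [mulM, oneM]
  -- products with the border row or column
  have hfin : n.1 = 0 ∨ m.1 = 0 → (∑' k, E.hatMat a n k ⋄ E.hatInv b k m) =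
      E.hatMat a n p₁ ⋄ E.hatInv b p₁ m + E.hatMat a n p₂ ⋄ E.hatInv b p₂ m := by
    intro h
    rw [tsum_eq_sum (s := {p₁, p₂}), Finset.sum_pair hp]
    intro k hk
    simp only [Finset.mem_insert, Finset.mem_singleton] at hk
    rw [← hpm] at hk
    rcases h with h | h
    · rw [hatMat, if_pos h, if_neg hk, zero_mulS]
    · rw [hatInv, if_pos h, if_neg hk, mulS_zero]
  have h1 : p₁.1 = 1 := rfl
  have h2 : p₂.1 = -1 := rfl
  have hone : (oneS 1 : Series C) ⋄ oneS 1 = oneS 1 := mulS_oneS (E.isLoop_oneS 1)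
  by_cases hn : n.1 = 0
  · rw [hfin (Or.inl hn)]
    by_cases hm : m.1 = 0
    · rw [if_pos (Subtype.ext (hn.trans hm.symm))]
      simp only [hatMat, hatInv, h1, h2, if_pos hn, if_pos hm, true_or, or_true, if_true, smul_mulS,
        mulS_smul, hone, smul_smul, half_sqrt_two_mul_self]
      module
    · rw [if_neg (fun h => hm (by rw [← h, hn]))]
      simp only [hatMat, hatInv, h1, h2, if_pos hn, if_neg hm, true_or, or_true, if_true, smul_mulS,
        mulS_smul, smul_smul, halfWeight]
      norm_num
  · by_cases hm : m.1 = 0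
    · rw [hfin (Or.inr hm), if_neg (fun h => hn (by rw [h, hm]))]
      simp only [hatMat, hatInv, h1, h2, if_neg hn, if_pos hm, true_or, or_true, if_true, smul_mulS,
        mulS_smul, smul_smul]
      norm_num
    -- For nonzero `n` and `m` the sum over `k` is the sum for U(a) U(b) with the inner index 0
    -- split evenly between k = ±1; the signs of `k` occur squared.
    · set n' : Idx 1 := ⟨n.1 - n.1.sign, by
        push_cast; rw [n.2, cast_sign_odd hn]; decide⟩
      set m' : Idx 1 := ⟨m.1 - m.1.sign, by
        push_cast; rw [m.2, cast_sign_odd hm]; decide⟩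
      have h := hasSum_multEntry hE (c := 1) (i := 1) (j := 0) ha hb hab n' m'
      have h3 := (hasSum_parity (hasSum_sub_sign (G := fun l => E.multEntry a n'.1 l ⋄ E.multEntry b l m'.1)
        h)).const_smul (((n.1.sign * m.1.sign : ℤ) : ℝ))
      have h4 : ∀ k : Idx 1, E.hatMat a n k ⋄ E.hatInv b k m =
          ((n.1.sign * m.1.sign : ℤ) : ℝ) • parity ((if k.1 = 1 ∨ k.1 = -1 then (1 / 2 : ℝ) else 1) •
            (E.multEntry a n'.1 (k.1 - k.1.sign) ⋄ E.multEntry b (k.1 - k.1.sign) m'.1)) := by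
        intro k
        have hk : ((k.1.sign : ℤ) : ℝ) * k.1.sign = 1 :=
          sign_mul_self (by obtain ⟨u, hu⟩ := k.odd; omega)
        rw [hatMat, hatInv, if_neg hn, if_neg hm, smul_mulS, mulS_smul, parity_mulS_parity,
          ← halfWeight_mul_self, smul_smul]
        change _ = _ • CyclicLoop.parity (_ • _)
        rw [show ∀ (r : ℝ) (f : Series C), CyclicLoop.parity (r • f) = r • CyclicLoop.parity f from
          fun r f => by funext ε p; simp only [parity_apply, Pi.smul_apply, smul_comm r], smul_smul]
        congr 1
        rw [halfWeight]
        push_cast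
        linear_combination (n.1.sign : ℝ) * m.1.sign * (if k.1 = 1 ∨ k.1 = -1 then √2 / 2 else 1) *
          (if k.1 = 1 ∨ k.1 = -1 then √2 / 2 else 1) * hk
      rw [tsum_congr h4, h3.tsum_eq]
      have h5 : (n'.1 = m'.1) ↔ n = m := by
        rw [Subtype.ext_iff]; exact sub_sign_inj hn hm n.two_dvd m.two_dvd
      rw [if_congr h5 rfl rfl]
      split_ifs with h6
      · rw [h6, Int.cast_mul, sign_mul_self hm, one_smul, parity_oneS]
      · rw [parity_zero, smul_zero]

end CyclicExtension

end CyclicLoop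

/-! ### The second inverse identity, and diagonal matrices. -/

namespace CyclicLoop.CyclicExtension

variable {C : Type*} [Ring C] [Algebra ℝ C] [UniformSpace C] [IsTopologicalRing C]
  {E : CyclicExtension C} {i j : ZMod 2}
variable [IsUniformAddGroup C] [ContinuousSMul ℝ C] [LocallyConvexSpace ℝ C] [T2Space C]

/-- The product U(b) U(a) contributes 1 whenever the shifted indices agree, so on the block at ±1/2
it gives one half of the matrix with rows (1, -1) and (-1, 1). The inner index 0 adds one half of
the all-ones matrix, which completes the identity. -/
theorem hatInv_mul_hatMat (hE : E.SeqComplete) {a b : Series C} (ha : E.IsLoop 0 1 a)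
    (hb : E.IsLoop 1 0 b) (hba : b ⋄ a = oneS 1) : E.hatInv b ⬝ E.hatMat a = oneM 1 1 := by
  funext k m
  rw [mulM, oneM]
  have hk2 := k.not_two_dvd
  have hm2 := m.not_two_dvd
  have hs : ∀ l : Idx 1, ((l.1 - l.1.sign : ℤ) : ZMod 2) = 0 := fun l => by
    have hl := l.not_two_dvd
    push_cast; rw [l.2, cast_sign_odd (by omega)]; decide
  have h := hasSum_multEntry hE (c := 1) (i := 0) (j := 1) hb ha hba ⟨_, hs k⟩ ⟨_, hs m⟩
  have h1 := (hasSum_parity h).const_smul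
    (((k.1.sign * m.1.sign : ℤ) : ℝ) * (halfWeight k.1 * halfWeight m.1))
  have h2 := hasSum_sub_sign_add (V := Series C) (G := fun l =>
    (((k.1.sign * m.1.sign : ℤ) : ℝ) * (halfWeight k.1 * halfWeight m.1)) •
      parity (E.multEntry b (k.1 - k.1.sign) l ⋄ E.multEntry a l (m.1 - m.1.sign)))
    (E.hatInv b k ⟨0, by decide⟩ ⋄ E.hatMat a ⟨0, by decide⟩ m) h1
  have h3 : ∀ n : Idx 0, E.hatInv b k n ⋄ E.hatMat a n m = if n.1 = 0 then
      E.hatInv b k ⟨0, by decide⟩ ⋄ E.hatMat a ⟨0, by decide⟩ m else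
      (((k.1.sign * m.1.sign : ℤ) : ℝ) * (halfWeight k.1 * halfWeight m.1)) •
      parity (E.multEntry b (k.1 - k.1.sign) (n.1 - n.1.sign) ⋄
        E.multEntry a (n.1 - n.1.sign) (m.1 - m.1.sign)) := by
    intro n
    split_ifs with hn
    · rw [show n = ⟨0, by decide⟩ from Subtype.ext hn]
    · rw [hatInv, hatMat, if_neg hn, if_neg hn, smul_mulS, mulS_smul, parity_mulS_parity, smul_smul]
      congr 1
      change _ * (_ * halfWeight m.1) = _
      push_cast
      linear_combination (k.1.sign : ℝ) * m.1.sign * halfWeight k.1 * halfWeight m.1 *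
        sign_mul_self hn
  rw [tsum_congr h3, h2.tsum_eq]
  have hone : (oneS 1 : Series C) ⋄ oneS 1 = oneS 1 := mulS_oneS (E.isLoop_oneS 1)
  simp only [hatInv, hatMat, if_true]
  have hsub : k.1 - k.1.sign = m.1 - m.1.sign ↔
      (k = m ∨ ((k.1 = 1 ∨ k.1 = -1) ∧ (m.1 = 1 ∨ m.1 = -1))) := by
    rw [Subtype.ext_iff]
    rcases lt_or_gt_of_ne (show k.1 ≠ 0 by omega) with h | h <;>
      rcases lt_or_gt_of_ne (show m.1 ≠ 0 by omega) with h' | h' <;>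
      simp only [Int.sign_eq_neg_one_of_neg, Int.sign_eq_one_of_pos, h, h'] <;> omega
  rw [if_congr hsub rfl rfl]
  by_cases hk : k.1 = 1 ∨ k.1 = -1
  · by_cases hm : m.1 = 1 ∨ m.1 = -1
    · rw [if_pos (Or.inr ⟨hk, hm⟩), if_pos hk, if_pos hm, smul_mulS, mulS_smul, hone, smul_smul,
        parity_oneS, halfWeight, halfWeight, if_pos hk, if_pos hm, half_sqrt_two_mul_self]
      by_cases hkm : k = m
      · rw [if_pos hkm, hkm, Int.cast_mul, sign_mul_self (by omega)]
        module
      · rw [if_neg hkm]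
        have h4 : k.1.sign * m.1.sign = -1 := by
          have : k.1 ≠ m.1 := fun h => hkm (Subtype.ext h)
          rcases hk with h | h <;> rcases hm with h' | h' <;> rw [h, h'] <;>
            first | (exfalso; omega) | decide
        rw [h4]
        push_cast
        module
    · have hkm : k ≠ m := fun h => hm (h ▸ hk)
      rw [if_neg (by tauto), if_neg hkm, if_neg hm, mulS_zero, parity_zero, smul_zero, add_zero]
  · rw [if_neg hk, zero_mulS, add_zero]
    by_cases hkm : k = m
    · rw [if_pos (Or.inl hkm), if_pos hkm, ← hkm, Int.cast_mul, sign_mul_self (by omega),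
        halfWeight, if_neg hk, parity_oneS, one_mul, one_mul, one_smul]
    · rw [if_neg (by tauto), if_neg hkm, parity_zero, smul_zero]

theorem isInverse_hatInv (hE : E.SeqComplete) {a b : Series C} (ha : E.IsLoop 0 1 a)
    (hb : E.IsLoop 1 0 b) (hab : a ⋄ b = oneS 0) (hba : b ⋄ a = oneS 1) :
    E.IsInverse 1 (E.hatMat a) (E.hatInv b) :=
  .of_tameLoop (tameLoop_hatInv hb) (hatMat_mul_hatInv hE ha hb hab)
    (hatInv_mul_hatMat hE ha hb hba)

/-! Diagonal matrices with entries `z^{±1/2}`. -/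

theorem isLoop_zPow (d : ZMod 2) (p : ℤ) : E.IsLoop (p + d) d (E.zPow d p) := by
  refine E.isLoop_of_mem_term (fun x => ?_) fun q _ s => rapid_mono _ _ _ q s
  rw [zPow, mono]
  split_ifs with h
  · have := E.term_conj (idem_mem_term (E := E) d) (n := p) (m := 0) (i' := p + d) (j' := d) (y := x)
      (add_comm _ _) (by simp) (by rw [h.1]; rfl) (by rw [h.2]; simp)
    rwa [neg_zero, zp_zero, mul_one] at this
  · exact zero_mem _

variable (E) in
/-- The diagonal matrix with entries `z^{e/2}` at negative indices, `z^{-e/2}` at positive indices,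
and `u` at `0`. -/
noncomputable def diagMat (i d : ZMod 2) (e : ℤ) (u : Series C) : Mat C i i := fun n m =>
  if n = m then (if n.1 < 0 then E.zPow d e else if 0 < n.1 then E.zPow d (-e) else u) else 0

theorem Lmat_eq_diagMat (u : Series C) : E.Lmat i u = E.diagMat i 1 1 u := rfl

theorem diagMat_off {d : ZMod 2} {e : ℤ} {u : Series C} (n m : Idx i) (h : n ≠ m) :
    E.diagMat i d e u n m = 0 := if_neg h

theorem diagMat_diag {d : ZMod 2} {e : ℤ} {u : Series C} (n : Idx i) (hn : n.1 ≠ 0) :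
    E.diagMat i d e u n n = E.zPow d (-(n.1.sign * e)) := by
  rw [diagMat, if_pos rfl]
  rcases lt_or_gt_of_ne hn with h | h
  · rw [if_pos h, Int.sign_eq_neg_one_of_neg h]; simp
  · rw [if_neg (by omega), if_pos h, Int.sign_eq_one_of_pos h]; simp

theorem diagMat_diag_zero {d : ZMod 2} {e : ℤ} {u : Series C} (n : Idx i) (hn : n.1 = 0) :
    E.diagMat i d e u n n = u := by
  rw [diagMat, if_pos rfl, if_neg (by omega), if_neg (by omega)]

theorem diagMat_mul_diagMat {d : ZMod 2} {e : ℤ} {u v : Series C}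
    (huv : i = 0 → u ⋄ v = oneS (e + d)) :
    E.diagMat i d e u ⬝ E.diagMat i (e + d) (-e) v = oneM (e + d) i := by
  funext n m
  rw [diag_mulM_apply diagMat_off, oneM]
  by_cases h : n = m
  · subst h
    rw [if_pos rfl]
    by_cases hn : n.1 = 0
    · rw [diagMat_diag_zero n hn, diagMat_diag_zero n hn, huv (by rw [← n.2, hn]; rfl)]
    · rw [diagMat_diag n hn, diagMat_diag n hn]
      have hcast : ∀ t : ℤ, ((-(n.1.sign * t) : ℤ) : ZMod 2) = t := fun t => by
        push_cast; rw [cast_sign_odd hn, one_mul, neg_two]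
      funext ε p
      rw [zPow, zPow, mono_mulS, oneS, mono, mono]
      by_cases hp : ε = 0 ∧ p = 0
      · rw [if_pos hp, if_pos ⟨hp.1, by rw [hp.2]; ring⟩, zp_mul_idem, hcast,
          mul_assoc, ← mul_assoc (E.zp _) (E.zp _), ← zp_add,
          show -(n.1.sign * e) + -(n.1.sign * -e) = 0 by ring, zp_zero, one_mul, add_comm d,
          idem_mul_idem]
      · rw [if_neg hp, if_neg (fun h => hp ⟨h.1, by linear_combination h.2⟩), mul_zero]
  · rw [if_neg h, diagMat_off n m h, mulS_zero]

/-- Away from index 0 a diagonal factor only shifts the degree by the sign of the row index and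
leaves a power of `z` in front. -/
theorem ro_diagMat_mul {d f : ZMod 2} {e : ℤ} {u : Series C} {B : Mat C i j}
    (hB : E.TameLoop d f B) {n : Idx i} (hn : n.1 ≠ 0) (m : Idx j) (x : Dih) :
    E.ro (E.diagMat i d e u ⬝ B) n m x =
      E.zp (-(n.1.sign * e)) * E.ro B n m ⟨x.ε, x.p + n.1.sign * e⟩ := by
  have h1 := (E.term_eq_single (hB.mem n m ⟨x.ε, x.p + n.1.sign * e⟩)).1
  rw [← h1, ro_apply, ro_apply, diag_mulM_apply diagMat_off, diagMat_diag n hn, zPow, mono_mulS]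
  simp only [← mul_assoc]
  congr 2
  · rw [mul_assoc _ (idem _) (E.zp n.1), show idem (d + i) * E.zp n.1 = E.zp n.1 * idem d by
      rw [zp_mul_idem, n.2], ← mul_assoc, ← zp_add, ← zp_add, add_comm]
  · congr 1; ring

theorem ro_mul_diagMat {c d : ZMod 2} {e : ℤ} {u : Series C} {A : Mat C i j}
    (hA : E.TameLoop c (e + d) A) (n : Idx i) {m : Idx j} (hm : m.1 ≠ 0) (x : Dih) :
    E.ro (A ⬝ E.diagMat j d e u) n m x =
      E.ro A n m ⟨x.ε, x.p + sg x.ε * (m.1.sign * e)⟩ * E.zp (-(m.1.sign * e)) := by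
  have h1 := (E.term_eq_single (hA.mem n m ⟨x.ε, x.p + sg x.ε * (m.1.sign * e)⟩)).2
  have hcast : ((-(m.1.sign * e) : ℤ) : ZMod 2) = e := by
    push_cast; rw [cast_sign_odd hm, one_mul, neg_two]
  have hcm : ((-m.1 : ℤ) : ZMod 2) = j := by push_cast; rw [m.2, neg_two]
  have h2 : E.zp (-(m.1.sign * e)) * idem d * E.zp (-m.1) =
      E.zp (-m.1) * (idem (e + d + j) * E.zp (-(m.1.sign * e))) := by
    rw [← mul_assoc (E.zp (-m.1)), zp_mul_idem, zp_mul_idem, hcast, hcm, mul_assoc, mul_assoc,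
      ← zp_add, ← zp_add, add_comm d, add_assoc _ j j, add_self_two, add_zero,
      add_comm (-(m.1.sign * e))]
  rw [← h1, ro_apply, ro_apply, mulM_diag_apply diagMat_off, diagMat_diag m hm, zPow, mulS_mono]
  rw [← mul_assoc, mul_assoc _ _ (E.zp (-m.1)), h2]
  simp only [← mul_assoc]
  congr 5
  ring

theorem ro_diagMat {d : ZMod 2} {e : ℤ} (n m : Idx i) (x : Dih) :
    E.ro (E.diagMat i d e 0) n m x = if n = m ∧ n.1 ≠ 0 ∧ x = ⟨0, -(n.1.sign * e)⟩ then
      E.zp (-(n.1.sign * e)) * idem (d + i) else 0 := by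
  by_cases h : n = m
  · subst h
    by_cases hn : n.1 = 0
    · rw [if_neg (fun h => h.2.1 hn), ro_apply, diagMat_diag_zero n hn]; simp
    · rw [ro_apply, diagMat_diag n hn, zPow, mono]
      obtain ⟨ε, p⟩ := x
      have hx : (ε = 0 ∧ p - n.1 + sg ε * n.1 = -(n.1.sign * e)) ↔
          (n = n ∧ n.1 ≠ 0 ∧ (⟨ε, p⟩ : Dih) = ⟨0, -(n.1.sign * e)⟩) := by
        rw [Dih.mk.injEq]
        constructor
        · rintro ⟨rfl, h⟩
          exact ⟨rfl, hn, rfl, by rw [← h, sg_zero]; ring⟩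
        · rintro ⟨-, -, rfl, h⟩
          exact ⟨rfl, by rw [← h, sg_zero]; ring⟩
      rw [if_congr hx rfl rfl]
      split_ifs
      · rw [← mul_assoc, ← zp_add, add_comm, zp_add, mul_assoc _ (E.zp n.1), zp_mul_idem, n.2,
          mul_assoc, mul_assoc, zp_mul_zp_neg, mul_one]
      · simp
  · rw [if_neg (fun h' => h h'.1), ro_apply, diagMat_off n m h]; simp

theorem tameLoop_diagMat_zero {d : ZMod 2} {e : ℤ} (he : |e| ≤ 1) :
    E.TameLoop (e + d) d (E.diagMat i d e 0) where
  mem n m x := by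
    rw [ro_diagMat]
    split_ifs with h
    · have := E.term_conj (idem_mem_term (E := E) (d + i)) (n := -(n.1.sign * e)) (m := 0)
        (i' := e + d + i) (j' := d + i) (y := x)
        (by push_cast; rw [cast_sign_odd h.2.1, one_mul, neg_two]; ring) (by simp)
        (by rw [h.2.2]; rfl) (by rw [h.2.2]; simp)
      rwa [neg_zero, zp_zero, mul_one] at this
    · exact zero_mem _
  tame := by
    refine Decays.of_series diagWeight_nonneg (E.isLoop_oneS (d + i)).rapid (M := 2) (R := 1)
      fun n m x => ?_
    rw [ro_diagMat]
    by_cases h : n = m ∧ n.1 ≠ 0 ∧ x = ⟨0, -(n.1.sign * e)⟩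
    · have hse : |-(n.1.sign * e)| ≤ 1 := by
        rw [abs_neg, abs_mul]; exact mul_le_one₀ (abs_sign_le_one _) (abs_nonneg _) he
      refine Or.inr ⟨1, -(n.1.sign * e), 0, 1, by simp, hse, by simp, ?_, ?_⟩
      · have h1 : diagWeight n.1 m.1 = 0 := by rw [h.1, diagWeight]; simp
        have h2 : |(x.p : ℝ)| ≤ 1 := by rw [h.2.2]; exact_mod_cast hse
        rw [h1, Dih.one_p]
        norm_num
        linarith
      · rw [if_pos h, oneS_apply, if_pos rfl, zp_zero, mul_one, one_smul]
    · exact Or.inl (if_neg h)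

theorem diagMat_eq_add {d : ZMod 2} {e : ℤ} (u : Series C) :
    E.diagMat 0 d e u = E.diagMat 0 d e 0 + originMat u := by
  funext n m
  simp only [Pi.add_apply, originMat]
  by_cases h : n = m
  · subst h
    by_cases hn : n.1 = 0
    · rw [diagMat_diag_zero n hn, diagMat_diag_zero n hn, if_pos ⟨hn, hn⟩, zero_add]
    · rw [diagMat_diag n hn, diagMat_diag n hn, if_neg (fun h => hn h.1), add_zero]
  · rw [diagMat_off n m h, diagMat_off n m h, if_neg, add_zero]
    exact fun h' => h (Subtype.ext (h'.1.trans h'.2.symm))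

theorem tameLoop_diagMat {d : ZMod 2} {e : ℤ} (he : |e| ≤ 1) {u : Series C}
    (hu : E.IsLoop (e + d) d u) : E.TameLoop (e + d) d (E.diagMat 0 d e u) := by
  rw [diagMat_eq_add]
  exact (tameLoop_diagMat_zero he).add (tameLoop_originMat hu)

end CyclicLoop.CyclicExtension

/-! ### The value at θ = π/2 and the factorization of U(a, π/2). -/

namespace CyclicLoop

theorem geo_one_left (t : ℤ) : geo 1 t = if 0 ≤ t then 1 else 0 := by simp [geo]

/-- cos θ = 0 removes all geometric tails; the surviving indicators, with coefficients ±1 and ±√2/2,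
follow the index pattern of Û. -/
theorem deformBase_pi_div_two {p n k : ℤ} (hn : 2 ≤ n) (hk : ¬ 2 ∣ k) :
    deformBase (Real.pi / 2) p n k = ((n.sign * k.sign : ℤ) : ℝ) *
      CyclicExtension.halfWeight k * if n - n.sign = k - k.sign + p then 1 else 0 := by
  have h4 : Real.pi / 2 / 2 = Real.pi / 4 := by ring
  rw [Int.sign_eq_one_of_pos (show 0 < n by omega), CyclicExtension.halfWeight]
  by_cases h1 : 3 ≤ k
  · rw [deformBase_of_ge hn h1, Int.sign_eq_one_of_pos (show 0 < k by omega),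
      if_neg (show ¬ (k = 1 ∨ k = -1) by omega),
      if_congr (show p = n - k ↔ n - 1 = k - 1 + p by omega) rfl rfl]
    simp
  · by_cases h2 : k = 1
    · subst h2
      rw [deformBase_one hn, Real.cos_pi_div_two, h4, Real.cos_pi_div_four,
        if_pos (Or.inl rfl), Int.sign_one,
        if_congr (show p = n - 1 ↔ n - 1 = 1 - 1 + p by omega) rfl rfl]
      simp
    · by_cases h3 : k = -1
      · subst h3
        rw [deformBase_neg_one hn, Real.cos_pi_div_two, h4, Real.sin_pi_div_four,
          if_pos (Or.inr rfl), Int.sign_eq_neg_one_of_neg (show (-1 : ℤ) < 0 by decide),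
          if_congr (show p = n - 1 ↔ n - 1 = -1 - -1 + p by omega) rfl rfl]
        simp
      · rw [deformBase_of_le hn (by omega), Real.cos_pi_div_two, Real.sin_pi_div_two,
          Int.sign_eq_neg_one_of_neg (show k < 0 by omega), if_neg (show ¬ (k = 1 ∨ k = -1) by omega),
          if_congr (show p = n - 2 - k ↔ n - 1 = k - -1 + p by omega) rfl rfl]
        simp

theorem deformCoeff_pi_div_two {p n k : ℤ} (hn : 2 ∣ n) (hk : ¬ 2 ∣ k) (hn0 : n ≠ 0) :
    deformCoeff (Real.pi / 2) p n k = ((n.sign * k.sign : ℤ) : ℝ) *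
      CyclicExtension.halfWeight k * if n - n.sign = k - k.sign + p then 1 else 0 := by
  rw [deformCoeff]
  split_ifs with h h1 h1
  · rw [deformBase_pi_div_two (by omega) hk, if_pos h1]
  · rw [deformBase_pi_div_two (by omega) hk, if_neg h1]
  all_goals
    rw [deformBase_pi_div_two (by omega) (by omega), Int.sign_neg, Int.sign_neg, neg_mul_neg,
      CyclicExtension.halfWeight, CyclicExtension.halfWeight,
      if_congr (show (-k = 1 ∨ -k = -1) ↔ (k = 1 ∨ k = -1) by omega) rfl rfl,
      if_congr (show (-n - -n.sign = -k - -k.sign + -p) ↔ n - n.sign = k - k.sign + p by omega)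
        rfl rfl]
  · rw [if_pos h1]
  · rw [if_neg h1]

/-- At columns ±1/2 both geometric factors are step functions. For odd `p` exactly one of -p - 1 and
p - 1 is nonnegative, so the sum is √2/2 whatever `p` is: row 0 carries all of `a`. -/
theorem deformCoeff_pi_div_two_zero {p k : ℤ} (hk : ¬ 2 ∣ k) (hp : ¬ 2 ∣ p) :
    deformCoeff (Real.pi / 2) p 0 k = if k = 1 ∨ k = -1 then √2 / 2 else 0 := by
  have h4 : Real.pi / 2 / 2 = Real.pi / 4 := by ring
  rw [deformCoeff, if_pos le_rfl]
  by_cases h1 : 3 ≤ k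
  · rw [deformBase_zero_of_ge h1, Real.cos_pi_div_two, if_neg (by omega), zero_mul]
  · by_cases h2 : k = 1
    · subst h2
      rw [deformBase_zero_one, h4, Real.cos_pi_div_four, Real.sin_pi_div_four,
        Real.sin_pi_div_two, geo_one_left, geo_one_left, if_pos (Or.inl rfl)]
      by_cases hp0 : 0 ≤ p - 1
      · rw [if_neg (by omega), if_pos hp0]; ring
      · rw [if_pos (by omega), if_neg hp0]; ring
    · by_cases h3 : k = -1
      · subst h3
        rw [deformBase_zero_neg_one, h4, Real.cos_pi_div_four, Real.sin_pi_div_four,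
          Real.sin_pi_div_two, geo_one_left, geo_one_left, if_pos (Or.inr rfl)]
        by_cases hp0 : 0 ≤ p - 1
        · rw [if_neg (by omega), if_pos hp0]; ring
        · rw [if_pos (by omega), if_neg hp0]; ring
      · rw [deformBase_zero_of_le (by omega), Real.cos_pi_div_two, if_neg (by omega), zero_mul]

namespace CyclicExtension

variable {C : Type*} [Ring C] [Algebra ℝ C] [UniformSpace C] [IsTopologicalRing C]
  {E : CyclicExtension C} {i j : ZMod 2}
variable [IsUniformAddGroup C] [ContinuousSMul ℝ C] [LocallyConvexSpace ℝ C] [T2Space C]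

theorem tameLoop_Lmat_one : E.TameLoop 0 1 (E.Lmat 1 0) :=
  tameLoop_diagMat_zero (d := 1) (e := 1) (i := 1) (by decide)

theorem tameLoop_Lmat_zero {u : Series C} (hu : E.IsLoop 0 1 u) : E.TameLoop 0 1 (E.Lmat 0 u) :=
  tameLoop_diagMat (d := 1) (e := 1) (by decide) hu

variable (E) in
/-- The inverse of `L[u]`, where `v` is the inverse of `u`. -/
noncomputable def Linv (i : ZMod 2) (v : Series C) : Mat C i i := E.diagMat i 0 (-1) v

theorem tameLoop_Linv_one : E.TameLoop 1 0 (E.Linv 1 0) :=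
  tameLoop_diagMat_zero (d := 0) (e := -1) (i := 1) (by decide)

theorem tameLoop_Linv_zero {v : Series C} (hv : E.IsLoop 1 0 v) : E.TameLoop 1 0 (E.Linv 0 v) :=
  tameLoop_diagMat (d := 0) (e := -1) (by decide) hv

theorem Lmat_mul_Linv {u v : Series C} (h : i = 0 → u ⋄ v = oneS 0) :
    E.Lmat i u ⬝ E.Linv i v = oneM 0 i :=
  diagMat_mul_diagMat (d := 1) (e := 1) h

theorem Linv_mul_Lmat {u v : Series C} (h : i = 0 → v ⋄ u = oneS 1) :
    E.Linv i v ⬝ E.Lmat i u = oneM 1 i :=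
  diagMat_mul_diagMat (d := 0) (e := -1) h

/-- The two factors L shift degrees by the signs of the column and row indices, which turns the
pattern at π/2 into that of Û. The sign sgn(sg ε · k) = sg ε · sgn k accounts for the parity
involution in Û, and row 0 becomes `a` times the border row. -/
theorem deformMat_mul_Lmat {a : Series C} (ha : E.IsLoop 0 1 a) :
    E.deformMat a (Real.pi / 2) ⬝ E.Lmat 1 0 = E.Lmat 0 a ⬝ E.hatMat a := by
  refine E.ro_injective fun n k x => ?_
  have hk2 := k.not_two_dvd
  have hsk : (sg x.ε * k.1).sign = sg x.ε * k.1.sign := by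
    rcases sg_eq_or x.ε with h | h <;> rw [h] <;> simp
  have hsw : ((sg x.ε * k.1 = 1) ∨ (sg x.ε * k.1 = -1)) ↔ (k.1 = 1 ∨ k.1 = -1) := by
    rcases sg_eq_or x.ε with h | h <;> rw [h] <;> omega
  rw [Lmat_eq_diagMat, Lmat_eq_diagMat, ro_mul_diagMat (tameLoop_deformMat ha _) n
    (show k.1 ≠ 0 by omega), deformMat, ro_famMat]
  by_cases hn : n.1 = 0
  · rw [ro_apply, diag_mulM_apply diagMat_off, diagMat_diag_zero n hn, hatMat, if_pos hn, hn]
    simp only [mul_one, sub_zero, zp_zero, one_mul]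
    have key : deformCoeff (Real.pi / 2) (x.p + sg x.ε * k.1.sign) 0 (sg x.ε * k.1) •
        a x.ε (x.p + sg x.ε * k.1.sign) = (if k.1 = 1 ∨ k.1 = -1 then √2 / 2 else 0) •
        a x.ε (x.p + sg x.ε * k.1.sign) := by
      by_cases h0 : a x.ε (x.p + sg x.ε * k.1.sign) = 0
      · rw [h0, smul_zero, smul_zero]
      · rw [deformCoeff_pi_div_two_zero (not_two_dvd_sg_mul _ k)
          (ha.not_two_dvd (x := ⟨x.ε, x.p + sg x.ε * k.1.sign⟩) h0), if_congr hsw rfl rfl]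
    rw [key]
    by_cases hk : k.1 = 1 ∨ k.1 = -1
    · have hks : k.1.sign = k.1 := by rcases hk with h | h <;> rw [h] <;> rfl
      rw [if_pos hk, if_pos hk, mulS_smul, mulS_oneS ha, hks]
      rfl
    · rw [if_neg hk, if_neg hk, mulS_zero]
      simp
  · rw [ro_diagMat_mul (tameLoop_hatMat ha) hn, hatMat_eq, ro_add, ro_bordMat, ro_cornerMat,
      if_neg (show ¬ (n.1 = 0 ∧ (k.1 = 1 ∨ k.1 = -1)) from fun h => hn h.1), zero_smul, ite_self,
      add_zero]
    simp only [mul_one, add_sub_cancel_right]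
    rw [deformCoeff_pi_div_two n.two_dvd (not_two_dvd_sg_mul _ k) hn, hsk,
      if_congr (show (n.1 - n.1.sign = sg x.ε * k.1 - sg x.ε * k.1.sign +
        (x.p + sg x.ε * k.1.sign)) ↔ (n.1 - n.1.sign = sg x.ε * (k.1 - k.1.sign) +
        (x.p + sg x.ε * k.1.sign)) by rw [mul_sub]) rfl rfl,
      show halfWeight (sg x.ε * k.1) = halfWeight k.1 from if_congr hsw rfl rfl]
    split_ifs
    · simp only [mul_one, mul_smul_comm, mul_assoc, zp_neg_mul_zp_mul, smul_mul_assoc]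
      congr 1
      push_cast
      ring
    · simp

/-- The factorization X L = L[a] Û exhibits X(π/2) as a product of invertible matrices. -/
theorem isInverse_deformMat (hE : E.SeqComplete) {a b : Series C} (ha : E.IsLoop 0 1 a)
    (hb : E.IsLoop 1 0 b) (hab : a ⋄ b = oneS 0) (hba : b ⋄ a = oneS 1) :
    E.IsInverse 0 (E.deformMat a (Real.pi / 2)) (E.Lmat 1 0 ⬝ E.hatInv b ⬝ E.Linv 0 b) := by
  have hX := tameLoop_deformMat ha (Real.pi / 2)
  have hL₁ := tameLoop_Lmat_one (E := E)
  have hL₁' := tameLoop_Linv_one (E := E)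
  have hL₀ := tameLoop_Lmat_zero ha
  have hL₀' := tameLoop_Linv_zero hb
  have hH := tameLoop_hatMat ha
  have hH' := tameLoop_hatInv hb
  have h1 : E.deformMat a (Real.pi / 2) ⬝ (E.Lmat 1 0 ⬝ E.hatInv b) = E.Lmat 0 a := by
    rw [← mulM_assoc hE hX hL₁ hH', deformMat_mul_Lmat ha, mulM_assoc hE hL₀ hH hH',
      hatMat_mul_hatInv hE ha hb hab, mulM_oneM hE hL₀]
  have h2 : E.Linv 0 b ⬝ E.deformMat a (Real.pi / 2) = E.hatMat a ⬝ E.Linv 1 0 := by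
    have h3 : E.deformMat a (Real.pi / 2) = E.Lmat 0 a ⬝ E.hatMat a ⬝ E.Linv 1 0 := by
      rw [← deformMat_mul_Lmat ha, mulM_assoc hE hX hL₁ hL₁',
        Lmat_mul_Linv (fun h => absurd h (by decide)), mulM_oneM hE hX]
    rw [h3, mulM_assoc hE hL₀ hH hL₁', ← mulM_assoc hE hL₀' hL₀ (hH.mul hE hL₁'),
      Linv_mul_Lmat (fun _ => hba), oneM_mulM hE (hH.mul hE hL₁')]
  refine .of_tameLoop ((hL₁.mul hE hH').mul hE hL₀') ?_ ?_
  · rw [← mulM_assoc hE hX (hL₁.mul hE hH') hL₀', h1, Lmat_mul_Linv fun _ => hab]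
  · rw [mulM_assoc hE (hL₁.mul hE hH') hL₀' hX, h2, mulM_assoc hE hL₁ hH' (hH.mul hE hL₁'),
      ← mulM_assoc hE hH' hH hL₁', hatInv_mul_hatMat hE ha hb hba, oneM_mulM hE hL₁',
      Lmat_mul_Linv fun h => absurd h (by decide)]

/-! ### The matrix N(a, θ). -/

section Main

variable {a b : Series C}

theorem N_eq (hE : E.SeqComplete) (ha : E.IsLoop 0 1 a) (hb : E.IsLoop 1 0 b)
    (hab : a ⋄ b = oneS 0) (hba : b ⋄ a = oneS 1) (θ : ℝ) :
    E.N a θ = E.deformMat a θ ⬝ E.Lmat 1 0 ⬝ E.hatInv b := by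
  rw [N, deform_eq hE ha, (isInverse_hatInv hE ha hb hab hba).inv_eq hE (tameLoop_hatMat ha)]

theorem N_eq_mul_inv (hE : E.SeqComplete) (ha : E.IsLoop 0 1 a) (hb : E.IsLoop 1 0 b)
    (hab : a ⋄ b = oneS 0) (hba : b ⋄ a = oneS 1) (θ : ℝ) :
    E.N a θ = E.deform a θ ⬝ E.inv 0 (E.deform a (Real.pi / 2)) ⬝ E.Lmat 0 a := by
  have hX := tameLoop_deformMat ha θ
  have hL₁ := tameLoop_Lmat_one (E := E)
  have hL₀ := tameLoop_Lmat_zero ha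
  have hL₀' := tameLoop_Linv_zero hb
  have hH' := tameLoop_hatInv hb
  have hV := hL₁.mul hE hH'
  rw [N_eq hE ha hb hab hba, deform_eq hE ha,
    (isInverse_deformMat hE ha hb hab hba).inv_eq hE (tameLoop_deformMat ha _),
    mulM_assoc hE hX (hV.mul hE hL₀') hL₀, mulM_assoc hE hV hL₀' hL₀,
    Linv_mul_Lmat (fun _ => hba), mulM_oneM hE hV, mulM_assoc hE hX hL₁ hH']

theorem N_pi_div_two (hE : E.SeqComplete) (ha : E.IsLoop 0 1 a) (hb : E.IsLoop 1 0 b)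
    (hab : a ⋄ b = oneS 0) (hba : b ⋄ a = oneS 1) : E.N a (Real.pi / 2) = E.Lmat 0 a := by
  rw [N_eq hE ha hb hab hba, deformMat_mul_Lmat ha, mulM_assoc hE (tameLoop_Lmat_zero ha)
    (tameLoop_hatMat ha) (tameLoop_hatInv hb), hatMat_mul_hatInv hE ha hb hab,
    mulM_oneM hE (tameLoop_Lmat_zero ha)]

theorem tameLoop_N (hE : E.SeqComplete) (ha : E.IsLoop 0 1 a) (hb : E.IsLoop 1 0 b)
    (hab : a ⋄ b = oneS 0) (hba : b ⋄ a = oneS 1) (θ : ℝ) : E.TameLoop 0 1 (E.N a θ) := by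
  rw [N_eq hE ha hb hab hba]
  exact ((tameLoop_deformMat ha θ).mul hE tameLoop_Lmat_one).mul hE (tameLoop_hatInv hb)

/-- N(θ) is compared with N(π/2) = L[0] + a e_{0,0}. The difference is X(θ) - X(π/2), rapidly
decreasing, times tame matrices on the right. -/
theorem isRapid_N_sub (hE : E.SeqComplete) (ha : E.IsLoop 0 1 a) (hb : E.IsLoop 1 0 b)
    (hab : a ⋄ b = oneS 0) (hba : b ⋄ a = oneS 1) (θ : ℝ) :
    E.IsRapid (E.N a θ - E.Lmat 0 0) := by
  have hX := tameLoop_deformMat ha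
  have hL₁ := tameLoop_Lmat_one (E := E)
  have hH' := tameLoop_hatInv hb
  have h1 : E.N a θ - E.Lmat 0 0 =
      (E.deformMat a θ - E.deformMat a (Real.pi / 2)) ⬝ E.Lmat 1 0 ⬝ E.hatInv b + originMat a := by
    have h2 : E.Lmat 0 a = E.Lmat 0 0 + originMat a := diagMat_eq_add a
    rw [mulM_sub hE (hX θ) (hX _) hL₁, mulM_sub hE ((hX θ).mul hE hL₁) ((hX _).mul hE hL₁) hH',
      ← N_eq hE ha hb hab hba, ← N_eq hE ha hb hab hba, N_pi_div_two hE ha hb hab hba, h2]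
    abel
  rw [isRapid_iff, h1]
  have hX' := (hX θ).sub (hX (Real.pi / 2))
  exact (rapid_mulM hE (hX'.mul hE hL₁) (rapid_mulM hE hX' (decays_deformMat_sub ha _ _) hL₁)
    hH').add sumWeight_nonneg (decays_originMat ha)

theorem N_zero (hE : E.SeqComplete) (ha : E.IsLoop 0 1 a) :
    E.N a 0 = E.multMat 0 1 a ⬝ E.Lmat 1 0 ⬝ E.inv 1 (E.hatMat a) := by
  rw [N, deform_eq hE ha, deformMat_zero ha]

end Main

end CyclicExtension

end CyclicLoop

/-! ### The special loops z^{1/2} and z^{-1/2}. -/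

namespace CyclicLoop

section RealMatrices

open Real (cos sin)

theorem hasSum_blockMat_mul {c : ℤ} (hc : (c : ZMod 2) = 1) (B : Matrix (Fin 2) (Fin 2) ℝ) (n : Idx 0)
    (v : ℤ → ℝ) : HasSum (fun l : Idx 0 => blockMat c B n.1 l.1 * v l.1)
      (if n.1 = c - 1 then B 0 0 * v (c - 1) + B 0 1 * v (c + 1)
        else if n.1 = c + 1 then B 1 0 * v (c - 1) + B 1 1 * v (c + 1) else v n.1) := by
  have h1 : ((c - 1 : ℤ) : ZMod 2) = 0 := by push_cast; rw [hc]; decide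
  have h2 : ((c + 1 : ℤ) : ZMod 2) = 0 := by push_cast; rw [hc]; decide
  split_ifs with h3 h4
  · refine ((hasSum_single_index h1 v (B 0 0)).add (hasSum_single_index h2 v (B 0 1))).congr_fun
      fun l => ?_
    rw [blockMat, ← add_mul]
    congr 1
    split_ifs <;> first | (exfalso; omega) | simp
  · refine ((hasSum_single_index h1 v (B 1 0)).add (hasSum_single_index h2 v (B 1 1))).congr_fun
      fun l => ?_
    rw [blockMat, ← add_mul]
    congr 1
    split_ifs <;> first | (exfalso; omega) | simp
  · have h5 := hasSum_single_index n.2 v 1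
    rw [one_mul] at h5
    refine h5.congr_fun fun l => ?_
    rw [blockMat]
    congr 1
    split_ifs <;> first | (exfalso; omega) | rfl

theorem blockMat_support {c : ℤ} {B : Matrix (Fin 2) (Fin 2) ℝ} {n m : ℤ} (h : blockMat c B n m ≠ 0) :
    n = m ∨ ((n = c - 1 ∨ n = c + 1) ∧ (m = c - 1 ∨ m = c + 1)) := by
  by_contra h'
  refine h ?_
  rw [blockMat]
  split_ifs <;> first | rfl | (exfalso; omega)

theorem abs_blockMat_halfBlock_le (c : ℤ) (φ : ℝ) (n m : ℤ) :
    |blockMat c (halfBlock φ) n m| ≤ 1 := by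
  rw [blockMat]
  split_ifs <;> simp [halfBlock, Real.abs_cos_le_one, Real.abs_sin_le_one]

theorem halfBlock_inv (φ : ℝ) : (halfBlock φ)⁻¹ = halfBlock (-φ) := by
  refine Matrix.inv_eq_right_inv ?_
  have h := Real.sin_sq_add_cos_sq (φ / 2)
  ext i j
  fin_cases i <;> fin_cases j <;>
    simp [halfBlock, Matrix.mul_apply, Fin.sum_univ_two, neg_div] <;> first | ring1 | linear_combination h

/-- For n ≠ 0 this is built into the definition; row 0 has the symmetry as well, branch by branch.
It reduces the term of degree -1/2 to the one of degree 1/2. -/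
theorem deformCoeff_neg (θ : ℝ) {p n k : ℤ} (hk : ¬ 2 ∣ k) :
    deformCoeff θ (-p) (-n) (-k) = deformCoeff θ p n k := by
  rcases lt_trichotomy n 0 with h | rfl | h
  · rw [deformCoeff, deformCoeff, if_pos (by omega), if_neg (by omega)]
  · rw [deformCoeff, deformCoeff, if_pos (by omega), if_pos le_rfl, neg_zero]
    by_cases h1 : 3 ≤ k
    · rw [deformBase_zero_of_le (by omega), deformBase_zero_of_ge h1]; rfl
    · by_cases h2 : k = 1
      · subst h2
        rw [deformBase_zero_neg_one, deformBase_zero_one, neg_neg]; ring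
      · by_cases h3 : k = -1
        · subst h3
          rw [neg_neg, deformBase_zero_neg_one, deformBase_zero_one, neg_neg]; ring
        · rw [deformBase_zero_of_ge (by omega), deformBase_zero_of_le (by omega), neg_neg,
            sub_neg_eq_add]
  · rw [deformCoeff, deformCoeff, if_neg (by omega), if_pos (by omega), neg_neg, neg_neg, neg_neg]

/-- For degree 1/2, θ enters only in the rows 0 and 1 and the columns ±1/2. Outside |n| + |k| ≤ 3,
in doubled indices, `deformCoeff_of_lt` applies, and finitely many entries remain. -/
theorem deformCoeff_one (θ : ℝ) {n k : ℤ} (hn : 2 ∣ n) (hk : ¬ 2 ∣ k) :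
    deformCoeff θ 1 n k =
      if n = 0 then (if k = 1 then sin (θ / 2) else if k = -1 then cos (θ / 2) else 0)
      else if n = 2 then (if k = 1 then cos (θ / 2) else if k = -1 then -sin (θ / 2) else 0)
      else if k = n - 1 then 1 else 0 := by
  have habs := abs_cases n
  have habs' := abs_cases k
  by_cases h : 3 < |n| + |k|
  · rw [deformCoeff_of_lt θ hn hk (by rw [abs_one]; omega)]
    split_ifs <;> first | rfl | (exfalso; omega)
  · have hk' : k = 1 ∨ k = -1 ∨ (n = 0 ∧ (k = 3 ∨ k = -3)) := by
      omega
    have hn' : n = 0 ∨ n = 2 ∨ n = -2 := by omega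
    rcases hk' with rfl | rfl | ⟨rfl, rfl | rfl⟩
    · rcases hn' with rfl | rfl | rfl
      · norm_num [deformCoeff, deformBase_zero_one, geo]
      · norm_num [deformCoeff, deformBase_one, geo]
      · norm_num [deformCoeff, deformBase_neg_one, geo]
    · rcases hn' with rfl | rfl | rfl
      · norm_num [deformCoeff, deformBase_zero_neg_one, geo]
      · norm_num [deformCoeff, deformBase_neg_one, geo]
      · norm_num [deformCoeff, deformBase_one, geo]
    · norm_num [deformCoeff, deformBase_zero_of_ge, geo]
    · norm_num [deformCoeff, deformBase_zero_of_le, geo]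

/-- The two rows affected by θ turn by half the angle: the addition formulas for θ/2 = (θ - π/2)/2 +
π/4. -/
theorem halfRot_mul_deformCoeff (θ : ℝ) {e : ℤ} (he : e = 1 ∨ e = -1) (n : Idx 0) (k : Idx 1) :
    HasSum (fun l : Idx 0 => blockMat e (halfBlock (e * (θ - Real.pi / 2))) n.1 l.1 *
      deformCoeff (Real.pi / 2) e l.1 k.1) (deformCoeff θ e n.1 k.1) := by
  have hc : ((e : ℤ) : ZMod 2) = 1 := by rcases he with rfl | rfl <;> decide
  convert hasSum_blockMat_mul hc (halfBlock (e * (θ - Real.pi / 2))) n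
    (fun l => deformCoeff (Real.pi / 2) e l k.1) using 1
  have hn := n.two_dvd
  have hk := k.not_two_dvd
  have hcos : cos (θ / 2) = cos ((θ - Real.pi / 2) / 2) * cos (Real.pi / 2 / 2) -
      sin ((θ - Real.pi / 2) / 2) * sin (Real.pi / 2 / 2) := by
    rw [← Real.cos_add]; congr 1; ring
  have hsin : sin (θ / 2) = sin ((θ - Real.pi / 2) / 2) * cos (Real.pi / 2 / 2) +
      cos ((θ - Real.pi / 2) / 2) * sin (Real.pi / 2 / 2) := by
    rw [← Real.sin_add]; congr 1; ring
  rcases he with rfl | rfl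
  · simp only [deformCoeff_one _ hn hk, deformCoeff_one _ (show (2 : ℤ) ∣ 1 - 1 by decide) hk,
      deformCoeff_one _ (show (2 : ℤ) ∣ 1 + 1 by decide) hk, halfBlock]
    norm_num
    split_ifs <;>
      first
      | rfl
      | (rw [hcos]; ring1)
      | (rw [hsin]; ring1)
      | exact hsin
      | simp
  · have hd : ∀ φ : ℝ, ∀ m : ℤ, deformCoeff φ (-1) m k.1 = deformCoeff φ 1 (-m) (-k.1) := by
      intro φ m
      rw [← deformCoeff_neg φ (show ¬ (2 : ℤ) ∣ -k.1 by omega), neg_neg, neg_neg]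
    simp only [hd]
    simp only [deformCoeff_one _ (show (2 : ℤ) ∣ -n.1 by omega) (show ¬ (2 : ℤ) ∣ -k.1 by omega),
      deformCoeff_one _ (show (2 : ℤ) ∣ -(-1 - 1) by decide) (show ¬ (2 : ℤ) ∣ -k.1 by omega),
      deformCoeff_one _ (show (2 : ℤ) ∣ -(-1 + 1) by decide) (show ¬ (2 : ℤ) ∣ -k.1 by omega),
      halfBlock]
    have hneg : ((-1 : ℤ) : ℝ) * (θ - Real.pi / 2) / 2 = -((θ - Real.pi / 2) / 2) := by
      push_cast; ring
    rw [hneg, Real.cos_neg, Real.sin_neg]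
    norm_num
    split_ifs <;>
      first
      | rfl
      | (exfalso; omega)
      | (rw [hcos]; ring1)
      | (rw [hsin]; ring1)
      | exact hsin
      | simp

end RealMatrices

end CyclicLoop

namespace CyclicLoop.CyclicExtension

variable {C : Type*} [Ring C] [Algebra ℝ C] [UniformSpace C] [IsTopologicalRing C]
  {E : CyclicExtension C}
variable [IsUniformAddGroup C] [ContinuousSMul ℝ C] [LocallyConvexSpace ℝ C] [T2Space C]

theorem zPow_mul_zPow (c d : ZMod 2) (p q : ℤ) (h : c = q + d) :
    E.zPow c p ⋄ E.zPow d q = E.zPow d (p + q) := by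
  funext ε r
  rw [zPow, zPow, zPow, mono_mulS, mono, mono]
  by_cases hr : ε = 0 ∧ r = p + q
  · rw [if_pos hr, if_pos ⟨hr.1, by rw [hr.2]; ring⟩, zp_add, mul_assoc, mul_assoc,
      ← mul_assoc (idem c), h, add_comm (q : ZMod 2), ← zp_mul_idem, mul_assoc, idem_mul_idem]
  · rw [if_neg hr, if_neg (fun h' => hr ⟨h'.1, by linear_combination h'.2⟩), mul_zero]

theorem zPow_zero (d : ZMod 2) : E.zPow d 0 = oneS d := by rw [zPow, zp_zero, one_mul]; rfl

theorem realMat_apply (A : Idx 0 → Idx 0 → ℝ) (n m : Idx 0) :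
    E.realMat A n m = A n m • E.zPow 0 (m.1 - n.1) := by
  funext ε p
  rw [E.apply_eq_ro (E.realMat A), ro_realMat, Pi.smul_apply, Pi.smul_apply, zPow, mono]
  have hx : ((⟨ε, p + n.1 - sg ε * m.1⟩ : Dih) = 1) ↔ (ε = 0 ∧ p = m.1 - n.1) := by
    rw [Dih.ext_iff, Dih.one_ε, Dih.one_p]
    refine and_congr_right fun h => ?_
    change p + n.1 - sg ε * m.1 = 0 ↔ p = m.1 - n.1
    rw [show ε = 0 from h, sg_zero]
    constructor <;> intro h' <;> omega
  rw [if_congr hx rfl rfl]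
  split_ifs
  · rw [mul_smul_comm, smul_mul_assoc, zp_mul_idem, Int.cast_neg, n.2, neg_two, add_zero, mul_assoc,
      ← zp_add, zp_mul_idem, show -n.1 + m.1 = m.1 - n.1 by ring]
    push_cast
    rw [n.2, m.2, sub_zero, add_zero]
  · simp

theorem tameLoop_blockMat {e : ℤ} (he : e = 1 ∨ e = -1) (φ : ℝ) :
    E.TameLoop 0 0 (E.realMat fun n m : Idx 0 => blockMat e (halfBlock φ) n.1 m.1) := by
  refine tameLoop_realMat fun s => ⟨3 ^ s, fun n m => ?_⟩
  by_cases hz : blockMat e (halfBlock φ) n.1 m.1 = 0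
  · rw [hz, abs_zero, mul_zero]; positivity
  have h1 := abs_blockMat_halfBlock_le e φ n.1 m.1
  have h2 : |(|n.1| - |m.1|)| ≤ 2 := by
    have h3 := abs_cases n.1
    have h4 := abs_cases m.1
    rw [abs_le]
    rcases he with rfl | rfl <;> rcases blockMat_support hz with h | h <;> omega
  have h2' : diagWeight n.1 m.1 ≤ 2 := by rw [diagWeight]; exact_mod_cast h2
  have h0 := diagWeight_nonneg n.1 m.1
  calc _ ≤ (1 + diagWeight n.1 m.1) ^ s * 1 := mul_le_mul_of_nonneg_left h1 (by positivity)
    _ ≤ 3 ^ s := by rw [mul_one]; exact pow_le_pow_left₀ (by positivity) (by linarith) s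

theorem deformMat_zPow (hE : E.SeqComplete) {e : ℤ} (he : e = 1 ∨ e = -1) (θ : ℝ) :
    E.deformMat (E.zPow 1 e) θ =
      (E.realMat fun n m : Idx 0 => blockMat e (halfBlock (e * (θ - Real.pi / 2))) n.1 m.1) ⬝
        E.deformMat (E.zPow 1 e) (Real.pi / 2) := by
  have ha : E.IsLoop 0 1 (E.zPow 1 e) := by
    have := E.isLoop_zPow 1 e
    rcases he with rfl | rfl <;> exact this
  refine (realMat_mul_famMat hE (by rwa [zero_add]) (tameLoop_deformMat ha _)
    (tameLoop_blockMat he _) fun x hx n m => ?_).symm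
  have hx' : x.ε = 0 ∧ x.p = e := by
    by_contra h; exact hx (by rw [zPow, mono, if_neg h])
  rw [hx'.1, hx'.2, sg_zero, one_mul]
  exact halfRot_mul_deformCoeff θ he n m

theorem Lmat_zPow_diag {e : ℤ} (m : Idx 0) : E.Lmat 0 (E.zPow 1 e) m m =
    E.zPow 1 (if m.1 < 0 then 1 else if 0 < m.1 then -1 else e) := by
  rw [Lmat, if_pos rfl]
  split_ifs <;> rfl

theorem mulReal_Lmat {u : Series C} (B : ℤ → ℤ → ℝ) (n m : Idx 0) :
    mulReal (E.Lmat 0 u) B n m = B n.1 m.1 • E.Lmat 0 u n n := by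
  rw [mulReal, tsum_eq_single n]
  intro l hl
  rw [Lmat, if_neg hl.symm, smul_zero]

theorem blockMat_row_sub (c : ℤ) (B : Matrix (Fin 2) (Fin 2) ℝ) (m : ℤ) :
    blockMat c B (c - 1) m = if m = c - 1 then B 0 0 else if m = c + 1 then B 0 1 else 0 := by
  rw [blockMat]
  split_ifs <;> first | rfl | (exfalso; omega)

theorem blockMat_row_add (c : ℤ) (B : Matrix (Fin 2) (Fin 2) ℝ) (m : ℤ) :
    blockMat c B (c + 1) m = if m = c - 1 then B 1 0 else if m = c + 1 then B 1 1 else 0 := by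
  rw [blockMat]
  split_ifs <;> first | rfl | (exfalso; omega)

theorem blockMat_row_of_ne {c : ℤ} {B : Matrix (Fin 2) (Fin 2) ℝ} {n m : ℤ} (h : n ≠ c - 1)
    (h' : n ≠ c + 1) : blockMat c B n m = if n = m then 1 else 0 := by
  rw [blockMat, if_neg (fun x => h x.1), if_neg (fun x => h x.1), if_neg (fun x => h' x.1),
    if_neg (fun x => h' x.1)]

/-- L is diagonal, so both real factors combine into one block, and the rotations by φ and -ψ
compose to φ - ψ. -/
theorem mulReal_mulReal_Lmat {e : ℤ} (he : e = 1 ∨ e = -1) {u : Series C} (φ ψ : ℝ) (n m : Idx 0) :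
    mulReal (mulReal (E.Lmat 0 u) (halfRot e φ)) (halfRotInv e ψ) n m =
      blockMat e (halfBlock (φ - ψ)) n.1 m.1 • E.Lmat 0 u n n := by
  have hc : ((e : ℤ) : ZMod 2) = 1 := by rcases he with rfl | rfl <;> decide
  have h := hasSum_blockMat_mul hc (halfBlock φ) n (fun l => blockMat e (halfBlock ψ)⁻¹ l m.1)
  have h1 : blockMat e (halfBlock (φ - ψ)) n.1 m.1 = if n.1 = e - 1 then
      halfBlock φ 0 0 * blockMat e (halfBlock ψ)⁻¹ (e - 1) m.1 +
        halfBlock φ 0 1 * blockMat e (halfBlock ψ)⁻¹ (e + 1) m.1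
      else if n.1 = e + 1 then halfBlock φ 1 0 * blockMat e (halfBlock ψ)⁻¹ (e - 1) m.1 +
        halfBlock φ 1 1 * blockMat e (halfBlock ψ)⁻¹ (e + 1) m.1
      else blockMat e (halfBlock ψ)⁻¹ n.1 m.1 := by
    rw [halfBlock_inv]
    have h2 : (φ - ψ) / 2 = φ / 2 - ψ / 2 := by ring
    have h3 : -ψ / 2 = -(ψ / 2) := by ring
    have h4 : ∀ x, halfBlock x 0 0 = Real.cos (x / 2) ∧ halfBlock x 0 1 = Real.sin (x / 2) ∧
      halfBlock x 1 0 = -Real.sin (x / 2) ∧ halfBlock x 1 1 = Real.cos (x / 2) := fun x =>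
      ⟨rfl, rfl, rfl, rfl⟩
    by_cases hn : n.1 = e - 1
    · rw [if_pos hn, hn, blockMat_row_sub, blockMat_row_sub, blockMat_row_add]
      simp only [(h4 _).1, (h4 _).2.1, (h4 _).2.2.1, (h4 _).2.2.2, h2, h3, Real.cos_neg,
        Real.sin_neg, Real.cos_sub, Real.sin_sub]
      split_ifs <;> ring1
    · by_cases hn' : n.1 = e + 1
      · rw [if_neg hn, if_pos hn', hn', blockMat_row_add, blockMat_row_sub, blockMat_row_add]
        simp only [(h4 _).1, (h4 _).2.1, (h4 _).2.2.1, (h4 _).2.2.2, h2, h3, Real.cos_neg,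
          Real.sin_neg, Real.cos_sub, Real.sin_sub]
        split_ifs <;> ring1
      · rw [if_neg hn, if_neg hn', blockMat_row_of_ne hn hn', blockMat_row_of_ne hn hn']
  rw [← h1] at h
  rw [mulReal, ← (h.smul_const (E.Lmat 0 u n n)).tsum_eq]
  refine tsum_congr fun l => ?_
  rw [mulReal_Lmat, smul_smul, mul_comm]
  rfl

/-- The rotation appears on the left of X, hence on the left of N(π/2) = L[a], conjugated by `R`. It
remains to move it to the right of L[a]. -/
theorem N_zPow (hE : E.SeqComplete) {e : ℤ} (he : e = 1 ∨ e = -1) (θ : ℝ) :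
    E.N (E.zPow 1 e) θ = mulReal (mulReal (E.Lmat 0 (E.zPow 1 e)) (halfRot e (e * θ)))
      (halfRotInv e (e * (Real.pi / 2))) := by
  have hc : ((e : ℤ) : ZMod 2) = 1 := by rcases he with rfl | rfl <;> decide
  have hc' : ((-e : ℤ) : ZMod 2) = 1 := by rcases he with rfl | rfl <;> decide
  have ha : E.IsLoop 0 1 (E.zPow 1 e) := by
    have := E.isLoop_zPow 1 e
    rw [hc] at this
    exact this
  have hb : E.IsLoop 1 0 (E.zPow 0 (-e)) := by
    have := E.isLoop_zPow 0 (-e)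
    rw [hc'] at this
    exact this
  have hab : E.zPow 1 e ⋄ E.zPow 0 (-e) = oneS 0 := by
    rw [zPow_mul_zPow _ _ _ _ (by rw [hc', add_zero]), add_neg_cancel, zPow_zero]
  have hba : E.zPow 0 (-e) ⋄ E.zPow 1 e = oneS 1 := by
    rw [zPow_mul_zPow _ _ _ _ (by rw [hc]; decide), neg_add_cancel, zPow_zero]
  have hG := tameLoop_blockMat (E := E) he (e * (θ - Real.pi / 2))
  have hX := tameLoop_deformMat ha (Real.pi / 2)
  have hL₁ := tameLoop_Lmat_one (E := E)
  rw [N_eq hE ha hb hab hba, deformMat_zPow hE he, mulM_assoc hE hG hX hL₁,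
    mulM_assoc hE hG (hX.mul hE hL₁) (tameLoop_hatInv hb), ← N_eq hE ha hb hab hba,
    N_pi_div_two hE ha hb hab hba]
  funext n m
  rw [mulReal_mulReal_Lmat he, Lmat_eq_diagMat, mulM_diag_apply diagMat_off, realMat_apply,
    smul_mulS, ← mul_sub, ← Lmat_eq_diagMat, Lmat_zPow_diag, Lmat_zPow_diag]
  by_cases hz : blockMat e (halfBlock (e * (θ - Real.pi / 2))) n.1 m.1 = 0
  · rw [hz, zero_smul, zero_smul]
  · congr 1
    -- In doubled indices, n plus the exponent of the n-th diagonal entry takes the same value `e`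
    -- at both indices of the block. The factor z^{(m-n)/2} from the rotation therefore exchanges
    -- the two diagonal entries of L.
    rw [zPow_mul_zPow]
    · congr 1
      rcases blockMat_support hz with h | h <;> split_ifs <;> omega
    · split_ifs
      · decide
      · decide
      · rw [hc]; decide

/-! The value at `θ = 0`. -/

theorem multEntry_degree (a : Series C) (n k : ℤ) {ε : ZMod 2} {p : ℤ} (hp : p ≠ 0) :
    E.multEntry a n k ε p = 0 := by
  simp [multEntry, mono, hp]

theorem hatInv_degree (b : Series C) (k : Idx 1) (n : Idx 0) {ε : ZMod 2} {p : ℤ} (hp : p ≠ 0) :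
    E.hatInv b k n ε p = 0 := by
  rw [hatInv]
  split_ifs
  · simp [oneS, mono, hp]
  · rfl
  · simp [parity_apply, multEntry_degree _ _ _ hp]

/-- At θ = 0 the outer factors U(a) and Û⁻¹ have entries of degree zero, so the degree comes from L
alone; odd coefficients to its left only flip the sign. -/
theorem N_zero_degree (hE : E.SeqComplete) {a b : Series C} (ha : E.IsLoop 0 1 a)
    (hb : E.IsLoop 1 0 b) (hab : a ⋄ b = oneS 0) (hba : b ⋄ a = oneS 1) (n m : Idx 0)
    {ε : ZMod 2} {p : ℤ} (hp : p ≠ 1) (hp' : p ≠ -1) : E.N a 0 n m ε p = 0 := by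
  have hU := tameLoop_deformMat ha 0
  have hL₁ := tameLoop_Lmat_one (E := E)
  rw [N_eq hE ha hb hab hba, mulM_apply hE (hU.mul hE hL₁) (tameLoop_hatInv hb)]
  have h1 : ∀ (k : Idx 1) (ε : ZMod 2) (q : ℤ), q ≠ 1 → q ≠ -1 →
      (E.deformMat a 0 ⬝ E.Lmat 1 0) n k ε q = 0 := by
    intro k ε q hq hq'
    have hk : k.1 ≠ 0 := by have := k.not_two_dvd; omega
    rw [deformMat_zero ha, Lmat_eq_diagMat, mulM_diag_apply diagMat_off, diagMat_diag k hk, zPow,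
      mulS_mono, multMat, multEntry_degree, zero_mul]
    rcases lt_or_gt_of_ne hk with h | h
    · rw [Int.sign_eq_neg_one_of_neg h]
      rcases sg_eq_or ε with h' | h' <;> rw [h'] <;> omega
    · rw [Int.sign_eq_one_of_pos h]
      rcases sg_eq_or ε with h' | h' <;> rw [h'] <;> omega
  refine (tsum_congr fun k => ?_).trans tsum_zero
  have h2 : ∀ (δ : ZMod 2) (ε : ZMod 2) (q r : ℤ), (r = 0 → q = p) →
      (E.deformMat a 0 ⬝ E.Lmat 1 0) n k δ q * E.hatInv b k m ε r = 0 := by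
    intro δ ε q r h
    by_cases hr : r = 0
    · rw [h1 k δ q (by rw [h hr]; exact hp) (by rw [h hr]; exact hp'), zero_mul]
    · rw [hatInv_degree b k m hr, mul_zero]
  rw [mulS, tsum_congr fun q => h2 0 ε q (p - q) fun h => by omega,
    tsum_congr fun q => h2 1 (ε + 1) q (q - p) fun h => by omega, tsum_zero, add_zero]

theorem exists_of_mem_term {ε : ZMod 2} {p : ℤ} (hp : (p : ZMod 2) = 1) {s : Half C}
    (hs : s ∈ E.term 0 1 ⟨ε, p⟩) :
    ∃ a ∈ E.part ε, s = Matrix.single 0 0 a * (E.zp (sg ε * p) * idem 1) := by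
  have hs1 := (E.term_eq_single hs).2
  -- The choice t = -p moves all powers of `z` to the right of the coefficient.
  obtain ⟨a, ha, h⟩ := (E.mem_term_iff (t := -p) (by push_cast; rw [hp]; decide)
    (by rw [hp, zero_add])).1 hs
  refine ⟨a, ha, ?_⟩
  rw [← hs1, ← h]
  simp [mul_assoc, zp_zero]

theorem eq_constS_mul {f : Series C} (hf : E.IsLoop 0 1 f)
    (hd : ∀ (ε : ZMod 2) (p : ℤ), p ≠ 1 → p ≠ -1 → f ε p = 0) :
    ∃ a₀ ∈ E.part 0, ∃ a₁ ∈ E.part 1, ∃ b₀ ∈ E.part 0, ∃ b₁ ∈ E.part 1,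
      f = constS a₀ a₁ ⋄ E.zPow 1 1 + constS b₀ b₁ ⋄ E.zPow 1 (-1) := by
  have hm := fun (ε : ZMod 2) (p : ℤ) (hp : (p : ZMod 2) = 1) =>
    exists_of_mem_term hp (E.isLoop_mem_term hf ⟨ε, p⟩)
  obtain ⟨a₀, ha₀, h₁⟩ := hm 0 1 (by decide)
  -- An odd coefficient followed by z^{1/2} has degree -1/2, so the odd parts of degree ±1/2 are
  -- attached to the opposite powers of `z`.
  obtain ⟨a₁, ha₁, h₂⟩ := hm 1 (-1) (by decide)
  obtain ⟨b₀, hb₀, h₃⟩ := hm 0 (-1) (by decide)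
  obtain ⟨b₁, hb₁, h₄⟩ := hm 1 1 (by decide)
  refine ⟨a₀, ha₀, a₁, ha₁, b₀, hb₀, b₁, hb₁, ?_⟩
  simp only [sg_zero, sg_one] at h₁ h₂ h₃ h₄
  norm_num at h₁ h₂ h₃ h₄
  funext ε p
  rw [Pi.add_apply, Pi.add_apply, zPow, zPow, mulS_mono, mulS_mono, constS, constS]
  simp only [Pi.add_apply, mono]
  rcases zmod_two_cases ε with rfl | rfl
  · by_cases hp : p = 1
    · subst hp; rw [h₁]; simp [sg_zero]
    · by_cases hp' : p = -1
      · subst hp'; rw [h₃]; simp [sg_zero]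
      · rw [hd 0 p hp hp', sg_zero, if_neg (by omega), if_neg (by simp), if_neg (by omega),
          if_neg (by simp)]
        simp
  · by_cases hp : p = 1
    · subst hp; rw [h₄]; simp [sg_one]
    · by_cases hp' : p = -1
      · subst hp'; rw [h₂]; simp [sg_one]
      · rw [hd 1 p hp hp', sg_one, if_neg (by simp), if_neg (by omega), if_neg (by simp),
          if_neg (by omega)]
        simp

end CyclicLoop.CyclicExtension

theorem mainTheorem4 {C : Type*} [Ring C] [Algebra ℝ C] [UniformSpace C] [IsUniformAddGroup C]
    [IsTopologicalRing C] [ContinuousSMul ℝ C] [LocallyConvexSpace ℝ C] [T2Space C]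
    (E : CyclicExtension C) (hE : E.SeqComplete) :
    (∀ a : Series C, E.IsLoop 0 1 a → E.IsInvertible a →
      -- the matrices entering the definition of `N` are well defined
      ((∀ θ : ℝ, Real.cos θ ≠ 0 →
          (∃! W, E.IsInverse 0 (E.Dz 1 θ) W) ∧ E.deform a θ = E.deform₀ a θ) ∧
        Continuous (E.deform a) ∧
        (∃! W, E.IsInverse 1 (E.hatMat a) W) ∧
        (∃! W, E.IsInverse 0 (E.deform a (Real.pi / 2)) W) ∧
        (∀ θ : ℝ, SummableM (E.deform a θ ⬝ E.Lmat 1 0) (E.inv 1 (E.hatMat a))) ∧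
        ∀ θ : ℝ, E.N a θ =
          E.deform a θ ⬝ E.inv 0 (E.deform a (Real.pi / 2)) ⬝ E.Lmat 0 a) ∧
      -- rapidly decreasing perturbation, with entries in `𝔅^{0,1}`
      (∀ θ : ℝ, (∀ n m, E.IsLoop 0 1 (E.N a θ n m)) ∧ E.IsRapid (E.N a θ - E.Lmat 0 0)) ∧
      -- the value at `θ = 0`: a linear loop
      (E.N a 0 = E.multMat 0 1 a ⬝ E.Lmat 1 0 ⬝ E.inv 1 (E.hatMat a) ∧
        ∀ n m, ∃ a₀ ∈ E.part 0, ∃ a₁ ∈ E.part 1, ∃ b₀ ∈ E.part 0, ∃ b₁ ∈ E.part 1,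
          E.N a 0 n m = constS a₀ a₁ ⋄ E.zPow 1 1
            + constS b₀ b₁ ⋄ E.zPow 1 (-1)) ∧
      -- the value at `θ = π / 2`: the trivial extension
      E.N a (Real.pi / 2) = E.Lmat 0 a) ∧
    -- the special cases `a = z^{1/2}` and `a = z^{-1/2}`
    (∀ θ : ℝ, E.N (E.zPow 1 1) θ =
      mulReal (mulReal (E.Lmat 0 (E.zPow 1 1)) (halfRot 1 θ)) (halfRotInv 1 (Real.pi / 2))) ∧
    (∀ θ : ℝ, E.N (E.zPow 1 (-1)) θ =
      mulReal (mulReal (E.Lmat 0 (E.zPow 1 (-1))) (halfRot (-1) (-θ)))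
        (halfRotInv (-1) (-(Real.pi / 2)))) := by
  refine ⟨fun a ha ⟨b, hb, hab, hba⟩ => ?_, fun θ => ?_, fun θ => ?_⟩
  · have hX := CyclicExtension.tameLoop_deformMat ha
    have hd := CyclicExtension.deform_eq hE ha
    have hH := CyclicExtension.isInverse_hatInv hE ha hb hab hba
    refine ⟨⟨fun θ hθ => ⟨?_, ?_⟩, ?_, ?_, ?_, fun θ => ?_,
      CyclicExtension.N_eq_mul_inv hE ha hb hab hba⟩, fun θ => ⟨?_, ?_⟩, ⟨?_, fun n m => ?_⟩, ?_⟩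
    · obtain ⟨W, hW⟩ := CyclicExtension.exists_isInverse_Dz (E := E) hE hθ
      exact hW.existsUnique hE (CyclicExtension.tameLoop_Dz hE hθ 1)
    · rw [hd, CyclicExtension.deform₀_eq hE ha hθ]
    · rw [hd]
      exact CyclicExtension.continuous_deformMat a
    · exact hH.existsUnique hE (CyclicExtension.tameLoop_hatMat ha)
    · rw [hd]
      exact (CyclicExtension.isInverse_deformMat hE ha hb hab hba).existsUnique hE (hX _)
    · rw [hd, hH.inv_eq hE (CyclicExtension.tameLoop_hatMat ha)]
      exact CyclicExtension.summableM hE ((hX θ).mul hE CyclicExtension.tameLoop_Lmat_one)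
        hH.tameLoop
    · exact (CyclicExtension.tameLoop_N hE ha hb hab hba θ).isLoop
    · exact CyclicExtension.isRapid_N_sub hE ha hb hab hba θ
    · exact CyclicExtension.N_zero hE ha
    · exact CyclicExtension.eq_constS_mul
        ((CyclicExtension.tameLoop_N hE ha hb hab hba 0).isLoop n m) fun ε p =>
        CyclicExtension.N_zero_degree hE ha hb hab hba n m
    · exact CyclicExtension.N_pi_div_two hE ha hb hab hba
  · have h := CyclicExtension.N_zPow (E := E) hE (e := 1) (Or.inl rfl) θ
    rwa [Int.cast_one, one_mul, one_mul] at h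
  · have h := CyclicExtension.N_zPow (E := E) hE (e := -1) (Or.inr rfl) θ
    rwa [Int.cast_neg, Int.cast_one, neg_one_mul, neg_one_mul] at h
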